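/- Let $m\ge 3$ and $1\le a<m$. Put $s_j=1$ for $j\le a$ and $s_j=-1$ for $a<j\le m$. A *case-(d) evolution* consists of $\alpha_1,\dots,\alpha_m>0$ with $\sum_{j\le a}1/\alpha_j=\sum_{j>a}1/\alpha_j$ and of differentiable functions $u,\theta_1,\dots,\theta_m:\mathbb R\to\mathbb R$ such that, with $Q(u)=\prod_{j=1}^m(\alpha_j+s_ju)$ and $\theta=\theta_1+\dots+\theta_m$, one has $\alpha_j+s_ju(t)>0$ for all $j$ and $t$, $$\frac{du}{dt}=2Q(u)^{1/2}\cos\theta,\qquad \frac{d\theta_j}{dt}=-s_j\,\frac{Q(u)^{1/2}\sin\theta}{\alpha_j+s_ju}\quad(j=1,\dots,m),$$ and $0<A<(\alpha_1\cdots\alpha_m)^{1/2}$, where $A=Q(u(0))^{1/2}\sin\theta(0)$. Let $T>0$ be the least common period of $u$ and $\theta$, and let $\beta_j$ be the numbers with $\theta_j(t+T)=\theta_j(t)+\beta_j$ for all $t$. The evolution is *periodic* if $\beta_1,\dots,\beta_m\in\pi\mathbb Q$. For $c\in\mathbb R$ let $$N_c=\Bigl\{\bigl(x_je^{i\theta_j(t)}\sqrt{\alpha_j+s_ju(t)}\bigr)_{j=1}^m:\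 t\in\mathbb R,\ x_j\in\mathbb R,\ x_1^2+\dots+x_a^2-x_{a+1}^2-\dots-x_m^2=c\Bigr\}\subset\mathbb C^m.$$ **Theorem.** There is an infinite sequence of periodic case-(d) evolutions with pairwise different vectors $(\beta_1,\dots,\beta_m)$, such that the sets $N_c$ obtained from all members of the sequence and all $c\in\mathbb R$ are pairwise distinct. So there is a countably infinite collection of 1-parameter families, parametrized by $c\in\mathbb R$, of distinct subsets $N_c$. Moreover, for every periodic case-(d) evolution: (a) if $c>0$, then $N_c$ is a closed, nonsingular, immersed special Lagrangian submanifold of $\mathbb C^m$ (the image of a proper special Lagrangian immersion), diffeomorphic to $S^{a-1}\times\mathbb R^{m-a}\times S^1$ or to a free quotient of this by $\mathbb Z_2$; (b) if $c<0$, then $N_c$ is a closed, nonsingular, immersed special Lagrangian submanifold of $\mathbb C^m$ (the image of a proper special Lagrangian immersion), diffeomorphic to $\mathbb R^a\times S^{m-a-1}\times S^1$ or to a free quotient of this by $\mathbb Z_2$; (c) if $c=0$, then $N_0$ is a closed, immersed special Lagrangian cone with an isolated singular point at $0$, diffeomorphic to the cone on $S^{a-1}\times S^{m-a-1}\times S^1$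 or to a cone on a free quotient of this by $\mathbb Z_2$. Here special Lagrangian means calibrated by $\operatorname{Re}(dz_1\wedge\dots\wedge dz_m)$ for the Euclidean metric. That an immersed submanifold $N$ is diffeomorphic to a manifold $M$ means that $N$ is the image of an immersion of $M$ that is generically injective, i.e. a dense set of points of $M$ are the only points in their fibres; for the cone in (c), $M$ is the cone without its vertex $0$, mapped onto $N_0\setminus\{0\}$ compatibly with dilations. That $0$ is singular means that $0\in N_0$ and no immersed $m$-dimensional $C^1$ disc through $0$ lies in $N_0$. -/

import Mathlib

open scoped Manifold ContDiff

noncomputable section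

namespace SLQuadric

/-- Complex `m`-space with its Euclidean metric `|dz_1|² + ⋯ + |dz_m|²`. -/
abbrev Cm (m : ℕ) : Type := EuclideanSpace ℂ (Fin m)

/-- The unit sphere `S^n` in `ℝ^(n+1)`. -/
abbrev Sph (n : ℕ) : Type := Metric.sphere (0 : EuclideanSpace ℝ (Fin (n + 1))) 1

/-! ### Special Lagrangian immersions -/

/-- The complex volume form `Ω = dz_1 ∧ ⋯ ∧ dz_m`. -/
def Omega {m : ℕ} (v : Fin m → Cm m) : ℂ :=
  Matrix.det (Matrix.of fun i j => v j i)

/-- A real `m`-plane `V` in `ℂ^m` is calibrated by `Re Ω` if, for a suitable orientation of `V`,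
the restriction of `Re Ω` to `V` is the Riemannian volume form of `V`. The orientation is given
through an oriented orthonormal basis `b`, whose determinant `b.toBasis.det` is the volume form. -/
def IsCalibratedPlane {m : ℕ} (V : Submodule ℝ (Cm m)) : Prop :=
  ∃ b : OrthonormalBasis (Fin m) ℝ V,
    ∀ v : Fin m → V, (Omega fun i => (v i : Cm m)).re = b.toBasis.det v

section Immersions

variable {E H X : Type} [NormedAddCommGroup E] [NormedSpace ℝ E] [TopologicalSpace H]
  (I : ModelWithCorners ℝ E H) [TopologicalSpace X] [ChartedSpace H X]

/-- The differential of `f : X → ℂ^m` at `x`, as a real linear map to `ℂ^m`. -/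
def differential {m : ℕ} (f : X → Cm m) (x : X) : E →L[ℝ] Cm m :=
  mfderiv I 𝓘(ℝ, Cm m) f x

/-- `f : X → ℂ^m` is a smooth immersion all of whose tangent planes are calibrated by `Re Ω`.
The orientations of the tangent planes are determined by the condition that `Re Ω` be positive
on them, so they automatically fit together to an orientation of `X`. -/
def IsSLImmersion {m : ℕ} (f : X → Cm m) : Prop :=
  ContMDiff I 𝓘(ℝ, Cm m) ∞ f ∧
    ∀ x : X, Function.Injective (differential I f x) ∧
      IsCalibratedPlane (LinearMap.range (differential I f x).toLinearMap)

/-- `τ` generates a smooth free action of `ℤ/2` on `X`. -/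
def IsFreeInvolution (τ : X → X) : Prop :=
  ContMDiff I I ∞ τ ∧ (∀ x, τ (τ x) = x) ∧ ∀ x, τ x ≠ x

end Immersions

/-- Every point of a dense set is the only point in its fibre of `f`. -/
def IsGenericallyInjective {X Y : Type} [TopologicalSpace X] (f : X → Y) : Prop :=
  Dense {x : X | ∀ y, f y = f x → y = x}

/-- `f` is invariant under `τ`, and the induced map on the quotient of `X` by `τ` is
generically injective. -/
def IsGenericallyInjectiveMod {X Y : Type} [TopologicalSpace X] (τ : X → X) (f : X → Y) : Prop :=
  (∀ x, f (τ x) = f x) ∧ Dense {x : X | ∀ y, f y = f x → y = x ∨ y = τ x}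

/-- `N` is a closed, nonsingular, immersed special Lagrangian submanifold of `ℂ^m`, diffeomorphic
as an immersed submanifold to `X` or to the quotient of `X` by a free `ℤ/2`-action.

In the second case, an immersion of the quotient manifold is the same thing as an immersion
of `X` which is invariant under the involution. -/
def IsClosedImmersedSL {E H : Type} [NormedAddCommGroup E] [NormedSpace ℝ E] [TopologicalSpace H]
    (I : ModelWithCorners ℝ E H) (X : Type) [TopologicalSpace X] [ChartedSpace H X]
    {m : ℕ} (N : Set (Cm m)) : Prop :=
  IsClosed N ∧
    ∃ f : X → Cm m, IsSLImmersion I f ∧ IsProperMap f ∧ Set.range f = N ∧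
      (IsGenericallyInjective f ∨
        ∃ τ : X → X, IsFreeInvolution I τ ∧ IsGenericallyInjectiveMod τ f)

/-- The map `(σ, s) ↦ e^s g(σ)`. With the radial coordinate `r = e^s`, this is the map
`(σ, r) ↦ r g(σ)` on `L × (0, ∞)`, the cone on `L` without its vertex. -/
def coneMap {L : Type} {m : ℕ} (g : L → Cm m) (p : L × ℝ) : Cm m :=
  Real.exp p.2 • g p.1

/-- `0` is a singular point of `N` as an immersed submanifold of dimension `m`: no immersed
`C¹` disc of dimension `m` through `0` is contained in `N`. -/
def IsSingularAtZero {m : ℕ} (N : Set (Cm m)) : Prop :=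
  (0 : Cm m) ∈ N ∧
    ∀ f : EuclideanSpace ℝ (Fin m) → Cm m, ContDiffAt ℝ 1 f 0 → f 0 = 0 →
      (∀ᶠ x in nhds 0, f x ∈ N) → ¬ Function.Injective (fderiv ℝ f 0)

/-- `N` is a closed, immersed special Lagrangian cone in `ℂ^m` with an isolated singular point
at its vertex `0`, diffeomorphic to the cone on `L` or to the cone on the quotient of `L` by a
free `ℤ/2`-action. -/
def IsClosedImmersedSLCone {E H : Type} [NormedAddCommGroup E] [NormedSpace ℝ E]
    [TopologicalSpace H] (I : ModelWithCorners ℝ E H) (L : Type) [TopologicalSpace L]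
    [ChartedSpace H L] {m : ℕ} (N : Set (Cm m)) : Prop :=
  IsClosed N ∧ (∀ r : ℝ, 0 ≤ r → ∀ z ∈ N, r • z ∈ N) ∧ IsSingularAtZero N ∧
    ∃ g : L → Cm m, IsSLImmersion (I.prod 𝓘(ℝ, ℝ)) (coneMap g) ∧
      Set.range (coneMap g) = N \ {0} ∧
      (IsGenericallyInjective (coneMap g) ∨
        ∃ τ : L → L, IsFreeInvolution I τ ∧
          IsGenericallyInjectiveMod (Prod.map τ id) (coneMap g))

/-! ### Evolving centred quadrics -/

/-- The sign of the `j`-th square in the quadratic form: `+1` for the first `a` coordinates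
and `-1` for the others. -/
def sgn {m : ℕ} (a : ℕ) (j : Fin m) : ℝ := if (j : ℕ) < a then 1 else -1

/-- The quadratic form `x_1² + ⋯ + x_a² - x_{a+1}² - ⋯ - x_m²`. -/
def quad {m : ℕ} (a : ℕ) (x : Fin m → ℝ) : ℝ := ∑ j, sgn a j * x j ^ 2

/-- The polynomial `Q(u) = ∏_{j ≤ a} (α_j + u) ∏_{j > a} (α_j - u)`. -/
def Qpoly {m : ℕ} (a : ℕ) (α : Fin m → ℝ) (u : ℝ) : ℝ := ∏ j, (α j + sgn a j * u)

/-- An evolution of the centred quadrics, defined for all times, in the case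
`0 < A < (α_1 ⋯ α_m)^{1/2}`. -/
structure CaseDEvolution (m a : ℕ) where
  α : Fin m → ℝ
  u : ℝ → ℝ
  θ : Fin m → ℝ → ℝ
  α_pos : ∀ j, 0 < α j
  /-- `∑_{j ≤ a} 1/α_j = ∑_{j > a} 1/α_j`. -/
  balance : ∑ j, sgn a j / α j = 0
  /-- `α_j + u > 0` for `j ≤ a` and `α_j - u > 0` for `j > a`. -/
  u_mem : ∀ t j, 0 < α j + sgn a j * u t
  /-- `du/dt = 2 Q(u)^{1/2} cos θ`, where `θ = θ_1 + ⋯ + θ_m`. -/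
  deriv_u : ∀ t, HasDerivAt u (2 * √(Qpoly a α (u t)) * Real.cos (∑ j, θ j t)) t
  /-- `dθ_j/dt = - Q(u)^{1/2} sin θ / (α_j + u)` for `j ≤ a`, and
  `dθ_j/dt = Q(u)^{1/2} sin θ / (α_j - u)` for `j > a`. -/
  deriv_θ : ∀ j t, HasDerivAt (θ j)
    (-sgn a j * (√(Qpoly a α (u t)) * Real.sin (∑ i, θ i t)) / (α j + sgn a j * u t)) t
  /-- The constant `A = Q(u)^{1/2} sin θ`, evaluated at `t = 0`, is positive. -/
  A_pos : 0 < √(Qpoly a α (u 0)) * Real.sin (∑ j, θ j 0)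
  /-- `A < (α_1 ⋯ α_m)^{1/2}`. -/
  A_lt : √(Qpoly a α (u 0)) * Real.sin (∑ j, θ j 0) < √(∏ j, α j)

namespace CaseDEvolution

variable {m a : ℕ} (D : CaseDEvolution m a)

/-- `T` is the period of `(u, θ)`, where `θ = θ_1 + ⋯ + θ_m`. -/
def IsPeriod (T : ℝ) : Prop :=
  IsLeast {S : ℝ | 0 < S ∧
    ∀ t, D.u (t + S) = D.u t ∧ ∑ j, D.θ j (t + S) = ∑ j, D.θ j t} T

/-- The numbers `β_1, …, β_m` are the increments of `θ_1, …, θ_m` over the period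
of `(u, θ)`. -/
def HasPhases (β : Fin m → ℝ) : Prop :=
  ∃ T, D.IsPeriod T ∧ ∀ j t, D.θ j (t + T) = D.θ j t + β j

/-- The evolution is periodic: the phases `β_j` are rational multiples of `π`. -/
def IsPeriodicWithPhases (β : Fin m → ℝ) : Prop :=
  D.HasPhases β ∧ ∀ j, ∃ q : ℚ, β j = Real.pi * q

/-- `w_j(t) = e^{i θ_j(t)} (α_j ± u(t))^{1/2}`. -/
def w (j : Fin m) (t : ℝ) : ℂ :=
  Complex.exp (Complex.I * (D.θ j t : ℂ)) * (√(D.α j + sgn a j * D.u t) : ℝ)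

/-- The subset of `ℂ^m` swept out by the quadric `x_1² + ⋯ + x_a² - x_{a+1}² - ⋯ - x_m² = c`. -/
def N (c : ℝ) : Set (Cm m) :=
  {z | ∃ (t : ℝ) (x : Fin m → ℝ), quad a x = c ∧ ∀ j, z j = (x j : ℂ) * D.w j t}

end CaseDEvolution

end SLQuadric

end

/-!
An evolution moves a centred quadric by the diagonal matrix with entries
`w_j = e^{iθ_j} (α_j + s_j u)^{1/2}`, and the evolution equations say that
`dw_j/dt = s_j conj (∏_{k ≠ j} w_k)`. A tangent vector of the swept-out set at `(x_j w_j)` therefore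
has the coordinates `w_j (p_j + τ conj (∏ w_k) s_j x_j / |w_j|²)`, where `p` is tangent to the quadric,
that is, orthogonal to `(s_j x_j)`. Hence the Hermitian products of such vectors are real, and so is
their determinant. A Lagrangian plane on which `Im Ω` vanishes is calibrated by `Re Ω` for one of its
orientations (`isCalibratedPlane_range`, `injective_and_isCalibratedPlane`).

With `v = Q(u)^{1/2} cos θ`, the pair `(u, v)` solves `u' = 2v`, `v' = Q'(u)`, and `Q(u)^{1/2} sin θ`
is constant. So two times with the same `u` and with all `θ_j` equal modulo `π` differ by a multiple
of a fixed time `S`, after which `w` returns up to signs `σ_j` (`exists_signPeriod`). Let the circle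
stand for time modulo `2S`. Then `(x, z) ↦ (x_j w_j)` maps the product of the quadric with the circle
onto `N_c \ {0}`, and it is invariant under the free involution `(x, z) ↦ (σ x, -z)`. A point of `N_c`
without zero coordinates determines `u` and the `θ_j` modulo `π`, so its fibre is an orbit of the
involution (`eq_or_eq_of_sweep_eq`). The quadrics are `S^{a-1} × ℝ^{m-a}`, `ℝ^a × S^{m-a-1}`, and the
cone on `S^{a-1} × S^{m-a-1}` (`isQuadricParam_pos`, `isQuadricParam_neg`, `isQuadricParam_zero`), and
the map is proper because `|w_j|` is bounded below. The tangent plane at `0` of a disc in the cone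
`N_0` would be a linear subspace of `N_0`, and there is none of dimension `m`
(`not_injective_of_forall_mem_N_zero`).

For the existence, put `m = a + b`, `α_j = a` for `j ≤ a`, and `α_j = b` for `j > a`. Then `Q` has its
maximum at `0`, so `u = G(R sin φ)`, where `G` is an inverse of `± (Q(0) - Q)^{1/2}`
(`exists_profileInverse`), and time and the angles `θ_j` are obtained by integration over `φ`
(`exists_symmetric_evolution`). All phases are rational multiples of one increment `turn`, which is a
continuous function of the amplitude `R`. Its value at `R = 0` is `π (2ab/m)^{1/2} > π`
(`turn_zero`, `pi_lt_turn_zero`), and `turn ≤ π + A T`, where the product of `A` and the period `T`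
tends to `0` at the maximal amplitude (`turn_le`, `area_mul_period_le`). By the intermediate value
theorem, `turn / π` takes infinitely many rational values (`exists_rational_turns`).

The sets are distinct because `N_c` determines `R` and `c` (`eq_and_eq_of_N_eq`). For `c ≠ 0`, the
values of `|z_j|²` on a coordinate axis which `N_c` meets fill the range of `|c| (α_j + s_j u)`, and
enlarging `R` moves the two ends of the range of `u` apart. For `c = 0`, the ratios `|z_j|² / |z_k|²`
on a coordinate plane determine the range of `u`.
-/

noncomputable section

namespace SLQuadric

/-! ### Calibrated planes -/

theorem inner_real_eq_re {m : ℕ} (x y : Cm m) : inner ℝ x y = (inner ℂ x y).re := by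
  simp [PiLp.inner_apply, Complex.inner]

/-- On a real `m`-plane, `Ω` is a complex multiple of the Riemannian volume form. -/
theorem Omega_eq_mul_det {m : ℕ} {V : Submodule ℝ (Cm m)} (b : OrthonormalBasis (Fin m) ℝ V)
    (v : Fin m → V) :
    Omega (fun i => (v i : Cm m)) = Omega (fun i => (b i : Cm m)) * (b.toBasis.det v : ℝ) := by
  have h : (Matrix.of fun i j => (v j : Cm m) i) =
      (Matrix.of fun i j => (b j : Cm m) i) * (b.toBasis.toMatrix v).map Complex.ofRealHom := by
    ext i j
    have hv : (v j : Cm m) = ∑ k, b.toBasis.repr (v j) k • (b k : Cm m) := by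
      conv_lhs => rw [← b.toBasis.sum_repr (v j)]
      simp
    simp only [Matrix.of_apply, Matrix.mul_apply, Matrix.map_apply, Module.Basis.toMatrix_apply]
    rw [hv]
    simp [mul_comm]
  rw [Omega, Omega, h, Matrix.det_mul, Module.Basis.det_apply, ← RingHom.mapMatrix_apply,
    ← RingHom.map_det]
  rfl

/-- A unitary matrix has a determinant of modulus `1`. -/
theorem normSq_Omega_eq_one {m : ℕ} (b : Fin m → Cm m)
    (h : ∀ i j, inner ℂ (b i) (b j) = if i = j then 1 else 0) :
    Complex.normSq (Omega b) = 1 := by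
  have h1 : (Matrix.of fun i j => b j i).conjTranspose * (Matrix.of fun i j => b j i)
      = (1 : Matrix (Fin m) (Fin m) ℂ) := by
    ext i j
    rw [Matrix.one_apply, ← h i j]
    simp [Matrix.mul_apply, PiLp.inner_apply, mul_comm]
  have h2 := congrArg Matrix.det h1
  rw [Matrix.det_mul, Matrix.det_conjTranspose, Matrix.det_one] at h2
  have h3 : (Complex.normSq (Omega b) : ℂ) = 1 := by
    rw [Complex.normSq_eq_conj_mul_self]; exact h2
  exact_mod_cast h3

/-- A Lagrangian plane on which `Im Ω` vanishes is calibrated: an orthonormal real basis of it is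
unitary, so `Ω` takes the value `±1` on the basis, and a transposition adjusts the sign. -/
theorem isCalibratedPlane_range {m : ℕ} (hm : 2 ≤ m) {E : Type*} [AddCommGroup E] [Module ℝ E]
    (L : E →ₗ[ℝ] Cm m) (hinj : Function.Injective L) (hdim : Module.finrank ℝ E = m)
    (hlag : ∀ v w, (inner ℂ (L v) (L w)).im = 0)
    (hΩ : ∀ v : Fin m → E, (Omega fun i => L (v i)).im = 0) :
    IsCalibratedPlane (LinearMap.range L) := by
  have hV : Module.finrank ℝ (LinearMap.range L) = m := by
    rw [LinearMap.finrank_range_of_inj hinj, hdim]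
  let b := (stdOrthonormalBasis ℝ (LinearMap.range L)).reindex (finCongr hV)
  have hlag' : ∀ x y : LinearMap.range L, (inner ℂ (x : Cm m) (y : Cm m)).im = 0 := by
    rintro ⟨_, v, rfl⟩ ⟨_, w, rfl⟩
    exact hlag v w
  have hΩ' : ∀ x : Fin m → LinearMap.range L, (Omega fun i => (x i : Cm m)).im = 0 := by
    intro x
    choose v hv using fun i => (x i).2
    simpa only [hv] using hΩ v
  have hcal : ∀ b : OrthonormalBasis (Fin m) ℝ (LinearMap.range L),
      Omega (fun i => (b i : Cm m)) = 1 → IsCalibratedPlane (LinearMap.range L) := by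
    intro b hb
    refine ⟨b, fun v => ?_⟩
    rw [Omega_eq_mul_det b v, hb]
    simp
  have hb : Complex.normSq (Omega fun i => (b i : Cm m)) = 1 := by
    apply normSq_Omega_eq_one
    intro i j
    have h1 := orthonormal_iff_ite.1 b.orthonormal i j
    rw [Submodule.coe_inner, inner_real_eq_re] at h1
    apply Complex.ext
    · rw [h1]; split_ifs <;> simp
    · rw [hlag']; split_ifs <;> simp
  rw [Complex.normSq_apply, hΩ' b] at hb
  have hre : (Omega fun i => (b i : Cm m)).re = 1 ∨ (Omega fun i => (b i : Cm m)).re = -1 :=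
    mul_self_eq_one_iff.1 (by linarith)
  rcases hre with h | h
  · exact hcal b (Complex.ext h (hΩ' b))
  · let e : Equiv.Perm (Fin m) := Equiv.swap ⟨0, by omega⟩ ⟨1, by omega⟩
    refine hcal (b.reindex e) ?_
    have h1 : Omega (fun i => ((b.reindex e) i : Cm m)) = - Omega (fun i => (b i : Cm m)) := by
      have h2 := Matrix.det_permute' e.symm (Matrix.of fun i j => (b j : Cm m) i)
      have h3 : Equiv.Perm.sign e.symm = -1 := by
        rw [Equiv.Perm.sign_symm]
        exact Equiv.Perm.sign_swap (by simp)
      rw [h3] at h2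
      simp only [Omega, OrthonormalBasis.reindex_apply]
      exact h2.trans (by simp)
    rw [h1]
    apply Complex.ext
    · simp [h]
    · simp [hΩ' b]

/-- If the real vectors `X i` lie in the hyperplane `n^⊥` and `n · y ≠ 0`, then the determinant of
the vectors `X i + z τ_i y` is `z` times a real number: the linear map that is the identity on
`n^⊥` and multiplies `y` by `z` has determinant `z`. -/
theorem det_add_smul_eq {m : ℕ} (X : Matrix (Fin m) (Fin m) ℝ) (τ y n : Fin m → ℝ)
    (hX : ∀ i, ∑ j, X i j * n j = 0) (hy : ∑ j, y j * n j ≠ 0) (z : ℂ) :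
    Matrix.det (Matrix.of fun i j => (X i j : ℂ) + τ i * z * y j) =
      z * (Matrix.det (Matrix.of fun i j => X i j + τ i * y j) : ℝ) := by
  set d : ℝ := ∑ j, y j * n j with hd
  have hdc : (d : ℂ) ≠ 0 := by exact_mod_cast hy
  have h : (Matrix.of fun i j => (X i j : ℂ) + τ i * z * y j) =
      (Matrix.of fun i j => X i j + τ i * y j).map Complex.ofRealHom *
        (1 + Matrix.replicateCol Unit (fun j => (n j : ℂ)) *
          Matrix.replicateRow Unit (fun j => (z - 1) / d * (y j : ℂ))) := by
    ext i k
    have h1 : ∑ j, ((X i j : ℂ) + τ i * y j) * n j = τ i * d := by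
      have : ∑ j, (X i j + τ i * y j) * n j = τ i * d := by
        simp only [add_mul, Finset.sum_add_distrib, hX, hd, Finset.mul_sum, zero_add, mul_assoc]
      exact_mod_cast this
    have h2 : ∑ j, ((X i j : ℂ) + τ i * y j) * (n j * ((z - 1) / d * y k)) =
        (∑ j, ((X i j : ℂ) + τ i * y j) * n j) * ((z - 1) / d * y k) := by
      rw [Finset.sum_mul]
      exact Finset.sum_congr rfl fun j _ => by ring
    rw [mul_add, Matrix.mul_one, Matrix.add_apply, Matrix.mul_apply]
    simp only [Matrix.of_apply, Matrix.map_apply, Matrix.mul_apply, Matrix.replicateCol_apply,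
      Matrix.replicateRow_apply, Finset.univ_unique, Finset.sum_singleton,
      Complex.ofRealHom_eq_coe, Complex.ofReal_add, Complex.ofReal_mul]
    rw [h2, h1]
    field_simp
    ring
  rw [h, Matrix.det_mul, Matrix.det_one_add_replicateCol_mul_replicateRow,
    ← RingHom.mapMatrix_apply, ← RingHom.map_det]
  have h3 : (1 : ℂ) + (fun j => (z - 1) / (d : ℂ) * (y j : ℂ)) ⬝ᵥ (fun j => (n j : ℂ)) = z := by
    have h4 : (fun j => (z - 1) / (d : ℂ) * (y j : ℂ)) ⬝ᵥ (fun j => (n j : ℂ)) =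
        (z - 1) / d * ((∑ j, y j * n j : ℝ) : ℂ) := by
      simp only [dotProduct, Complex.ofReal_sum, Complex.ofReal_mul, Finset.mul_sum]
      exact Finset.sum_congr rfl fun j _ => by ring
    rw [h4, ← hd]
    field_simp
    ring
  rw [h3, mul_comm]
  rfl

/-! ### Dynamics of an evolution -/

theorem sgn_mul_self {m : ℕ} (a : ℕ) (j : Fin m) : sgn a j * sgn a j = 1 := by
  unfold sgn; split_ifs <;> norm_num

theorem sgn_eq_or {m : ℕ} (a : ℕ) (j : Fin m) : sgn a j = 1 ∨ sgn a j = -1 := by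
  unfold sgn
  split_ifs
  · exact Or.inl rfl
  · exact Or.inr rfl

theorem hasDerivAt_Qpoly {m a : ℕ} (α : Fin m → ℝ) {u : ℝ} (h : ∀ j, 0 < α j + sgn a j * u) :
    HasDerivAt (Qpoly a α) (Qpoly a α u * ∑ j, sgn a j / (α j + sgn a j * u)) u := by
  have h1 : ∀ j ∈ Finset.univ, HasDerivAt (fun u => α j + sgn a j * u) (sgn a j) u := fun j _ => by
    simpa using ((hasDerivAt_id u).const_mul (sgn a j)).const_add (α j)
  have h2 := HasDerivAt.fun_finsetProd h1
  refine h2.congr_deriv ?_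
  rw [Finset.mul_sum]
  refine Finset.sum_congr rfl fun j _ => ?_
  rw [Qpoly, ← Finset.prod_erase_mul _ _ (Finset.mem_univ j), smul_eq_mul, mul_assoc,
    mul_div_assoc', mul_div_cancel_left₀ _ (h j).ne']

theorem Qpoly_pos {m a : ℕ} {α : Fin m → ℝ} {u : ℝ} (h : ∀ j, 0 < α j + sgn a j * u) :
    0 < Qpoly a α u := Finset.prod_pos fun j _ => h j

theorem contDiff_Qpoly {m a : ℕ} (α : Fin m → ℝ) {n : ℕ∞ω} : ContDiff ℝ n (Qpoly a α) := by
  unfold Qpoly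
  fun_prop

namespace CaseDEvolution

variable {m a : ℕ} (D : CaseDEvolution m a)

/-- The total phase `θ = θ_1 + ⋯ + θ_m`. -/
def phase (t : ℝ) : ℝ := ∑ j, D.θ j t

/-- The squared modulus `α_j ± u` of `w_j`. -/
def rad (j : Fin m) (t : ℝ) : ℝ := D.α j + sgn a j * D.u t

/-- `v = Q(u)^{1/2} cos θ`, half of the velocity of `u`. -/
def vel (t : ℝ) : ℝ := √(Qpoly a D.α (D.u t)) * Real.cos (D.phase t)

/-- The conserved quantity `A = Q(u)^{1/2} sin θ`, as a function of time. -/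
def area (t : ℝ) : ℝ := √(Qpoly a D.α (D.u t)) * Real.sin (D.phase t)

theorem rad_pos (j : Fin m) (t : ℝ) : 0 < D.rad j t := D.u_mem t j

theorem sqrt_Q_pos (t : ℝ) : 0 < √(Qpoly a D.α (D.u t)) :=
  Real.sqrt_pos.2 (Qpoly_pos (D.u_mem t))

theorem hasDerivAt_u (t : ℝ) : HasDerivAt D.u (2 * D.vel t) t := by
  refine (D.deriv_u t).congr_deriv ?_
  rw [vel, phase]; ring

theorem hasDerivAt_θ (j : Fin m) (t : ℝ) :
    HasDerivAt (D.θ j) (-sgn a j * D.area t / D.rad j t) t := D.deriv_θ j t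

theorem hasDerivAt_phase (t : ℝ) :
    HasDerivAt D.phase (-D.area t * ∑ j, sgn a j / D.rad j t) t := by
  have h := HasDerivAt.fun_sum (u := Finset.univ) fun j _ => D.hasDerivAt_θ j t
  refine h.congr_deriv ?_
  rw [Finset.mul_sum]
  exact Finset.sum_congr rfl fun j _ => by ring

theorem hasDerivAt_sqrt_Q (t : ℝ) : HasDerivAt (fun t => √(Qpoly a D.α (D.u t)))
    (Qpoly a D.α (D.u t) * Real.cos (D.phase t) * ∑ j, sgn a j / D.rad j t) t := by
  have h := ((hasDerivAt_Qpoly D.α (D.u_mem t)).comp t (D.hasDerivAt_u t)).sqrt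
    (Qpoly_pos (D.u_mem t)).ne'
  refine h.congr_deriv ?_
  have h0 := (D.sqrt_Q_pos t).ne'
  simp only [Function.comp_apply, vel, rad]
  generalize ∑ j, sgn a j / (D.α j + sgn a j * D.u t) = e
  field_simp

theorem hasDerivAt_area (t : ℝ) : HasDerivAt D.area 0 t := by
  have h := (D.hasDerivAt_sqrt_Q t).mul (D.hasDerivAt_phase t).sin
  refine h.congr_deriv ?_
  rw [area]
  linear_combination (-Real.cos (D.phase t) * Real.sin (D.phase t) * ∑ j, sgn a j / D.rad j t) *
    Real.mul_self_sqrt (Qpoly_pos (D.u_mem t)).le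

theorem hasDerivAt_vel (t : ℝ) :
    HasDerivAt D.vel (Qpoly a D.α (D.u t) * ∑ j, sgn a j / D.rad j t) t := by
  have h := (D.hasDerivAt_sqrt_Q t).mul (D.hasDerivAt_phase t).cos
  refine h.congr_deriv ?_
  rw [area]
  linear_combination (Real.sin (D.phase t) ^ 2 * ∑ j, sgn a j / D.rad j t) *
    Real.mul_self_sqrt (Qpoly_pos (D.u_mem t)).le + (Qpoly a D.α (D.u t) *
      ∑ j, sgn a j / D.rad j t) * Real.sin_sq_add_cos_sq (D.phase t)

/-- The cosine and sine contributions to `d/dt (Q^{1/2} sin θ)` cancel, so `A` is conserved. -/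
theorem area_eq (t : ℝ) : D.area t = D.area 0 :=
  is_const_of_deriv_eq_zero (fun t => (D.hasDerivAt_area t).differentiableAt)
    (fun t => (D.hasDerivAt_area t).deriv) t 0

theorem area_pos (t : ℝ) : 0 < D.area t := by
  rw [area_eq]; exact D.A_pos

theorem sin_phase_pos (t : ℝ) : 0 < Real.sin (D.phase t) :=
  pos_of_mul_pos_right (D.area_pos t) (D.sqrt_Q_pos t).le

theorem continuous_u : Continuous D.u :=
  continuous_iff_continuousAt.2 fun t => (D.deriv_u t).continuousAt

theorem continuous_phase : Continuous D.phase :=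
  continuous_iff_continuousAt.2 fun t => (D.hasDerivAt_phase t).continuousAt

/-- The sine of the total phase never vanishes, so the phase stays between two consecutive
multiples of `π`. -/
theorem abs_phase_sub_lt (r s : ℝ) : |D.phase r - D.phase s| < Real.pi := by
  wlog h : D.phase s ≤ D.phase r generalizing r s
  · rw [abs_sub_comm]; exact this s r (le_of_not_ge h)
  rw [abs_of_nonneg (sub_nonneg.2 h)]
  by_contra! hc
  have hpi := Real.pi_pos
  obtain ⟨t, ht⟩ := mem_range_of_exists_le_of_exists_ge D.continuous_phase
    (c := (⌈D.phase s / Real.pi⌉ : ℤ) * Real.pi)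
    ⟨s, by rw [← div_le_iff₀ hpi]; exact Int.le_ceil _⟩
    ⟨r, by
      have := Int.ceil_lt_add_one (D.phase s / Real.pi)
      have h2 : ((⌈D.phase s / Real.pi⌉ : ℤ) : ℝ) * Real.pi ≤
        (D.phase s / Real.pi + 1) * Real.pi := by gcongr
      rw [add_mul, div_mul_cancel₀ _ hpi.ne'] at h2
      linarith⟩
  have := D.sin_phase_pos t
  rw [ht, Real.sin_int_mul_pi] at this
  exact lt_irrefl _ this

theorem phase_eq_of_sub_eq {r s : ℝ} (l : ℤ) (h : D.phase r - D.phase s = l * Real.pi) :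
    D.phase r = D.phase s := by
  have h1 := D.abs_phase_sub_lt r s
  rw [h, abs_mul, abs_of_pos Real.pi_pos] at h1
  have h2 : |(l : ℝ)| < 1 := by
    by_contra! hc
    nlinarith [Real.pi_pos]
  have h3 : l = 0 := Int.abs_lt_one_iff.1 (by exact_mod_cast h2)
  rw [h3] at h
  simpa [sub_eq_zero] using h

/-- The pair `(u, v)` stays in a ball, since the positivity of `α_j ± u` for both signs bounds `u`
from both sides. -/
theorem exists_bound (ha : 1 ≤ a) (ham : a < m) :
    ∃ R : ℝ, ∀ t, ((D.u t, D.vel t) : ℝ × ℝ) ∈ Metric.closedBall (0 : ℝ × ℝ) R := by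
  obtain ⟨M, hM⟩ : ∃ M : ℝ, ∀ t, D.u t ∈ Set.Icc (-M) M := by
    refine ⟨max (D.α ⟨0, by omega⟩) (D.α ⟨a, ham⟩), fun t => ⟨?_, ?_⟩⟩
    · have h := D.u_mem t ⟨0, by omega⟩
      rw [sgn, if_pos (show 0 < a by omega)] at h
      have := le_max_left (D.α ⟨0, by omega⟩) (D.α ⟨a, ham⟩)
      linarith
    · have h := D.u_mem t ⟨a, ham⟩
      rw [sgn, if_neg (by simp)] at h
      have := le_max_right (D.α ⟨0, by omega⟩) (D.α ⟨a, ham⟩)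
      linarith
  obtain ⟨C, hC⟩ := isCompact_Icc.exists_bound_of_continuousOn (s := Set.Icc (-M) M)
    (f := fun u => √(Qpoly a D.α u))
    ((contDiff_Qpoly (n := 0) D.α).continuous.sqrt.continuousOn)
  refine ⟨max M C, fun t => ?_⟩
  rw [mem_closedBall_zero_iff, Prod.norm_def]
  refine max_le_max ?_ ?_
  · rw [Real.norm_eq_abs, abs_le]; exact hM t
  · refine le_trans ?_ (hC _ (hM t))
    simp only [vel, norm_mul]
    refine mul_le_of_le_one_right (norm_nonneg _) ?_
    rw [Real.norm_eq_abs]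
    exact Real.abs_cos_le_one _

/-- The pair `(u, v)` solves the Hamiltonian system `u' = 2v`, `v' = Q'(u)`, whose solutions are
determined by one value. -/
theorem eq_add_of_eq (ha : 1 ≤ a) (ham : a < m) {s t : ℝ} (hu : D.u t = D.u s)
    (hp : D.phase t = D.phase s) (r : ℝ) :
    D.u (r + (t - s)) = D.u r ∧ D.phase (r + (t - s)) = D.phase r := by
  obtain ⟨R, hR⟩ := D.exists_bound ha ham
  let V : ℝ × ℝ → ℝ × ℝ := fun p => (2 * p.2, deriv (Qpoly a D.α) p.1)
  have hV : ContDiff ℝ 1 V := by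
    have : ContDiff ℝ 1 (deriv (Qpoly a D.α)) :=
      ((contDiff_succ_iff_deriv (n := 1)).1 (contDiff_Qpoly D.α)).2.2
    exact ContDiff.prodMk (by fun_prop) (this.comp contDiff_fst)
  obtain ⟨K, hK⟩ := hV.contDiffOn.exists_lipschitzOnWith one_ne_zero
    (convex_closedBall (0 : ℝ × ℝ) R) (isCompact_closedBall _ _)
  have hsol : ∀ c r, HasDerivAt (fun r => ((D.u (r + c), D.vel (r + c)) : ℝ × ℝ))
      (V (D.u (r + c), D.vel (r + c))) r := by
    intro c r
    refine HasDerivAt.prodMk ((D.hasDerivAt_u _).comp_add_const r c) ?_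
    have := (D.hasDerivAt_vel (r + c)).comp_add_const r c
    refine this.congr_deriv ?_
    exact (hasDerivAt_Qpoly D.α (D.u_mem (r + c))).deriv.symm
  have key := ODE_solution_unique_univ (v := fun _ => V) (s := fun _ => Metric.closedBall 0 R)
    (t₀ := s) (fun _ => hK) (fun r => ⟨hsol (t - s) r, hR _⟩) (fun r => ⟨hsol 0 r, hR _⟩)
    (by simp [vel, hu, hp])
  have h1 := congrFun key r
  simp only [add_zero, Prod.mk.injEq] at h1
  refine ⟨h1.1, ?_⟩
  have hQ := (D.sqrt_Q_pos r).ne'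
  have hc : Real.cos (D.phase (r + (t - s))) = Real.cos (D.phase r) := by
    have := h1.2
    rw [vel, vel, h1.1] at this
    exact mul_left_cancel₀ hQ this
  have hs : Real.sin (D.phase (r + (t - s))) = Real.sin (D.phase r) := by
    have := (D.area_eq (r + (t - s))).trans (D.area_eq r).symm
    rw [area, area, h1.1] at this
    exact mul_left_cancel₀ hQ this
  have h2 : ((D.phase (r + (t - s)) : ℝ) : Real.Angle) = (D.phase r : ℝ) :=
    Real.Angle.cos_sin_inj hc hs
  obtain ⟨k, hk⟩ := Real.Angle.angle_eq_iff_two_pi_dvd_sub.1 h2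
  exact D.phase_eq_of_sub_eq (2 * k) (by rw [hk]; push_cast; ring)

/-- Two times with the same value of `(u, θ)` differ by a multiple of the least period. -/
theorem exists_int_mul_period (ha : 1 ≤ a) (ham : a < m) {T : ℝ} (hT : D.IsPeriod T) {s t : ℝ}
    (hu : D.u t = D.u s) (hp : D.phase t = D.phase s) : ∃ k : ℤ, t - s = k * T := by
  let H : AddSubgroup ℝ :=
    { carrier := {S | ∀ t, D.u (t + S) = D.u t ∧ D.phase (t + S) = D.phase t}
      zero_mem' := fun t => by simp
      add_mem' := fun {x y} hx hy t => by
        rw [← add_assoc, (hy _).1, (hy _).2]; exact hx t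
      neg_mem' := fun {x} hx t => by
        have := hx (t + -x)
        rw [neg_add_cancel_right] at this
        exact ⟨this.1.symm, this.2.symm⟩ }
  have hH : H = AddSubgroup.closure {T} := by
    refine AddSubgroup.cyclic_of_min ?_
    have : {g | g ∈ H ∧ 0 < g} =
        {S : ℝ | 0 < S ∧ ∀ t, D.u (t + S) = D.u t ∧ ∑ j, D.θ j (t + S) = ∑ j, D.θ j t} := by
      ext S; exact and_comm
    rw [this]; exact hT
  have hmem : t - s ∈ H := fun r => D.eq_add_of_eq ha ham hu hp r
  rw [hH, AddSubgroup.mem_closure_singleton] at hmem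
  obtain ⟨k, hk⟩ := hmem
  exact ⟨k, by rw [← hk]; simp⟩

theorem IsPeriod.u_add_int_mul {D : CaseDEvolution m a} {T : ℝ} (hT : D.IsPeriod T) (k : ℤ)
    (t : ℝ) : D.u (t + k * T) = D.u t := by
  have h : Function.Periodic D.u T := fun t => (hT.1.2 t).1
  simpa using h.int_mul k t

theorem θ_add_int_mul {T : ℝ} {β : Fin m → ℝ} (h : ∀ j t, D.θ j (t + T) = D.θ j t + β j)
    (j : Fin m) (k : ℤ) (t : ℝ) : D.θ j (t + k * T) = D.θ j t + k * β j := by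
  have hp : Function.Periodic (fun t => D.θ j (t * T) - t * β j) 1 := fun t => by
    simp only [add_mul, one_mul, h]; ring
  by_cases hT : T = 0
  · have h0 : β j = 0 := by have := h j 0; rw [hT] at this; simpa using this
    simp [hT, h0]
  · have h1 := hp.int_mul k (t / T)
    simp only [mul_one, add_mul, div_mul_cancel₀ t hT] at h1
    linarith

/-- For a periodic evolution there is a least time `S > 0` after which all `w_j` return up to
signs `σ_j`. It is the multiple `n T` of the period, where `n` generates the group of the integers
`k` for which all `k β_j` are multiples of `π`; this group is not zero because the `β_j` are rational
multiples of `π`. -/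
theorem exists_signPeriod (ha : 1 ≤ a) (ham : a < m) {β : Fin m → ℝ}
    (hβ : D.IsPeriodicWithPhases β) :
    ∃ (S : ℝ) (σ : Fin m → ℝ), 0 < S ∧ (∀ j, σ j * σ j = 1) ∧
      (∀ j t, D.w j (t + S) = σ j * D.w j t) ∧
      ∀ t s, D.u t = D.u s → (∀ j, ∃ l : ℤ, D.θ j t - D.θ j s = l * Real.pi) →
        ∃ k : ℤ, t - s = k * S := by
  obtain ⟨⟨T, hT, hθ⟩, hq⟩ := hβ
  let H : AddSubgroup ℤ :=
    { carrier := {k | ∀ j, ∃ l : ℤ, k * β j = l * Real.pi}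
      zero_mem' := fun j => ⟨0, by simp⟩
      add_mem' := fun {x y} hx hy j => by
        obtain ⟨l, hl⟩ := hx j
        obtain ⟨l', hl'⟩ := hy j
        exact ⟨l + l', by push_cast; rw [add_mul, hl, hl', add_mul]⟩
      neg_mem' := fun {x} hx j => by
        obtain ⟨l, hl⟩ := hx j
        exact ⟨-l, by push_cast; rw [neg_mul, hl, neg_mul]⟩ }
  obtain ⟨n, hn⟩ := Int.subgroup_cyclic H
  choose q hq using hq
  have hn0 : n ≠ 0 := by
    rintro rfl
    have hmem : ((∏ j, (q j).den : ℕ) : ℤ) ∈ H := by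
      intro j
      obtain ⟨c, hc⟩ := Finset.dvd_prod_of_mem (fun j => (q j).den) (Finset.mem_univ j)
      refine ⟨(q j).num * c, ?_⟩
      have h1 : ((q j).den : ℝ) * (q j : ℝ) = (q j).num := by
        exact_mod_cast Rat.den_mul_eq_num (q j)
      rw [hc, hq j]
      push_cast
      linear_combination (Real.pi * c) * h1
    rw [hn, AddSubgroup.mem_closure_singleton] at hmem
    obtain ⟨k, hk⟩ := hmem
    simp only [smul_zero] at hk
    have : (∏ j, (q j).den) ≠ 0 := Finset.prod_ne_zero_iff.2 fun j _ => (q j).den_ne_zero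
    exact this (by exact_mod_cast hk.symm)
  have hmemH : |n| ∈ H := by
    have : n ∈ H := by rw [hn]; exact AddSubgroup.mem_closure_singleton_self n
    rcases abs_choice n with h | h <;> rw [h]
    · exact this
    · exact H.neg_mem this
  choose l hl using hmemH
  have hTpos : 0 < T := hT.1.1
  have hSpos : 0 < (|n| : ℤ) * T := mul_pos (by exact_mod_cast abs_pos.2 hn0) hTpos
  refine ⟨(|n| : ℤ) * T, fun j => Real.cos (l j * Real.pi), hSpos, fun j => ?_, fun j t => ?_, ?_⟩
  · have := Real.sin_sq_add_cos_sq (l j * Real.pi)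
    rw [Real.sin_int_mul_pi] at this
    linarith
  · have h1 : Complex.exp (Complex.I * ((l j * Real.pi : ℝ) : ℂ)) =
        (Real.cos (l j * Real.pi) : ℝ) := by
      rw [mul_comm, Complex.exp_mul_I, ← Complex.ofReal_cos, ← Complex.ofReal_sin,
        Real.sin_int_mul_pi]
      simp
    rw [w, w, hT.u_add_int_mul, D.θ_add_int_mul hθ, hl j, ← h1, Complex.ofReal_add, mul_add,
      Complex.exp_add]
    ring
  · intro t s hu hts
    have hp : D.phase t = D.phase s := by
      choose l' hl' using hts
      refine D.phase_eq_of_sub_eq (∑ j, l' j) ?_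
      simp only [phase, ← Finset.sum_sub_distrib, hl']
      push_cast
      rw [Finset.sum_mul]
    obtain ⟨k, hk⟩ := D.exists_int_mul_period ha ham hT hu hp
    have hkH : k ∈ H := fun j => by
      obtain ⟨l', hl'⟩ := hts j
      refine ⟨l', ?_⟩
      have h1 := D.θ_add_int_mul hθ j k s
      rw [← hk, add_sub_cancel] at h1
      rw [← hl', h1, add_sub_cancel_left]
    rw [hn, AddSubgroup.mem_closure_singleton] at hkH
    obtain ⟨c, hc⟩ := hkH
    rcases abs_choice n with h | h
    · exact ⟨c, by rw [hk, h, ← hc]; push_cast [smul_eq_mul]; ring⟩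
    · exact ⟨-c, by rw [hk, h, ← hc]; push_cast [smul_eq_mul]; ring⟩

/-! ### Smoothness and the derivative of `w` -/

/-- Bootstrapping in the evolution equations: `n` derivatives on the right-hand side give `n + 1`
derivatives of the solution. -/
theorem contDiff_aux (n : ℕ) : ContDiff ℝ n D.u ∧ ∀ j, ContDiff ℝ n (D.θ j) := by
  induction n with
  | zero =>
    refine ⟨contDiff_zero.2 D.continuous_u, fun j => contDiff_zero.2 ?_⟩
    exact continuous_iff_continuousAt.2 fun t => (D.deriv_θ j t).continuousAt
  | succ n ih =>
    obtain ⟨hu, hθ⟩ := ih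
    have hQ : ContDiff ℝ n fun t => √(Qpoly a D.α (D.u t)) :=
      ((contDiff_Qpoly D.α).comp hu).sqrt fun t => (Qpoly_pos (D.u_mem t)).ne'
    have hp : ContDiff ℝ n D.phase := by
      unfold phase; exact ContDiff.sum fun j _ => hθ j
    have hr : ∀ j, ContDiff ℝ n (D.rad j) := fun j => by unfold rad; fun_prop
    push_cast
    refine ⟨contDiff_succ_iff_deriv.2 ⟨fun t => (D.deriv_u t).differentiableAt, by simp, ?_⟩,
      fun j => contDiff_succ_iff_deriv.2
        ⟨fun t => (D.deriv_θ j t).differentiableAt, by simp, ?_⟩⟩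
    · rw [funext fun t => (D.hasDerivAt_u t).deriv]
      unfold vel
      exact contDiff_const.mul (hQ.mul hp.cos)
    · rw [funext fun t => (D.hasDerivAt_θ j t).deriv]
      unfold area
      exact (contDiff_const.mul (hQ.mul hp.sin)).div (hr j) fun t => (D.rad_pos j t).ne'

theorem contDiff_u : ContDiff ℝ ∞ D.u := contDiff_infty.2 fun n => (D.contDiff_aux n).1

theorem contDiff_θ (j : Fin m) : ContDiff ℝ ∞ (D.θ j) :=
  contDiff_infty.2 fun n => (D.contDiff_aux n).2 j

theorem contDiff_w (j : Fin m) : ContDiff ℝ ∞ (D.w j) := by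
  have h1 : ContDiff ℝ ∞ fun t => √(D.α j + sgn a j * D.u t) :=
    (contDiff_const.add (contDiff_const.mul D.contDiff_u)).sqrt fun t => (D.u_mem t j).ne'
  unfold w
  exact (contDiff_const.mul (Complex.ofRealCLM.contDiff.comp (D.contDiff_θ j))).cexp.mul
    (Complex.ofRealCLM.contDiff.comp h1)

theorem normSq_w (j : Fin m) (t : ℝ) : Complex.normSq (D.w j t) = D.rad j t := by
  rw [Complex.normSq_eq_norm_sq, w, norm_mul, mul_comm Complex.I, Complex.norm_exp_ofReal_mul_I,
    one_mul, Complex.norm_real, Real.norm_eq_abs, sq_abs, Real.sq_sqrt (D.u_mem t j).le, rad]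

theorem norm_w_sq (j : Fin m) (t : ℝ) : ‖D.w j t‖ ^ 2 = D.rad j t := by
  rw [← normSq_w, Complex.normSq_eq_norm_sq]

theorem w_ne_zero (j : Fin m) (t : ℝ) : D.w j t ≠ 0 := by
  rw [← Complex.normSq_pos, normSq_w]; exact D.rad_pos j t

theorem prod_w (t : ℝ) : ∏ j, D.w j t = D.vel t + D.area t * Complex.I := by
  have h1 : ∏ j, √(D.α j + sgn a j * D.u t) = √(Qpoly a D.α (D.u t)) :=
    (Real.sqrt_prod _ fun j _ => (D.u_mem t j).le).symm
  simp only [w, Finset.prod_mul_distrib]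
  rw [← Complex.exp_sum, ← Finset.mul_sum, ← Complex.ofReal_sum, ← Complex.ofReal_prod, h1,
    mul_comm Complex.I, Complex.exp_mul_I, vel, area, phase]
  push_cast
  ring

/-- The evolution equation `dw_j/dt = ± conj (∏_{k ≠ j} w_k)`, written with `|w_j|² = α_j ± u`. -/
theorem hasDerivAt_w (j : Fin m) (t : ℝ) : HasDerivAt (D.w j)
    (D.w j t * ((starRingEnd ℂ) (∏ k, D.w k t) * (sgn a j / D.rad j t : ℝ))) t := by
  have h1 := ((D.hasDerivAt_θ j t).ofReal_comp.const_mul Complex.I).cexp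
  have h2 : HasDerivAt (fun t => √(D.α j + sgn a j * D.u t))
      (√(D.rad j t) * (sgn a j * D.vel t / D.rad j t)) t := by
    have := (((D.hasDerivAt_u t).const_mul (sgn a j)).const_add (D.α j)).sqrt (D.u_mem t j).ne'
    refine this.congr_deriv ?_
    have h3 : D.α j + sgn a j * D.u t = D.rad j t := rfl
    have h4 := (Real.sqrt_pos.2 (D.rad_pos j t)).ne'
    have h5 := (D.rad_pos j t).ne'
    rw [h3]
    field_simp
    rw [Real.sq_sqrt (D.rad_pos j t).le]
  refine (h1.mul h2.ofReal_comp).congr_deriv ?_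
  have h6 : (D.rad j t : ℂ) ≠ 0 := by exact_mod_cast (D.rad_pos j t).ne'
  have h7 : √(D.α j + sgn a j * D.u t) = √(D.rad j t) := rfl
  rw [prod_w, w, h7]
  simp only [map_add, map_mul, Complex.conj_ofReal, Complex.conj_I]
  push_cast
  field_simp
  ring

end CaseDEvolution

/-! ### Tangent planes -/

/-- The tangent plane of the swept-out quadrics at `(x_j w_j)` is calibrated: here `P v` is a tangent
vector to the quadric at `x` and `τ v` is the time component. Both `Im ⟨·, ·⟩` and `Im Ω` vanish
because the vectors `P v` are orthogonal to the normal vector `(s_j x_j)` of the quadric. -/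
theorem injective_and_isCalibratedPlane {m : ℕ} (hm : 2 ≤ m) {a : ℕ} {E : Type*} [AddCommGroup E]
    [Module ℝ E] (hdim : Module.finrank ℝ E = m) (L : E →ₗ[ℝ] Cm m) (P : E → Fin m → ℝ)
    (τ : E → ℝ) (w : Fin m → ℂ) (hw : ∀ j, w j ≠ 0) (x : Fin m → ℝ) (hx : x ≠ 0)
    (hP : ∀ v, ∑ j, P v j * (sgn a j * x j) = 0)
    (hinj : ∀ v, P v = 0 → τ v = 0 → v = 0)
    (hL : ∀ v j, L v j = w j * ((P v j : ℂ) + τ v * (starRingEnd ℂ) (∏ k, w k) *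
      (sgn a j * x j / Complex.normSq (w j) : ℝ))) :
    Function.Injective L ∧ IsCalibratedPlane (LinearMap.range L) := by
  set c : ℂ := (starRingEnd ℂ) (∏ k, w k) with hc
  have hc0 : c ≠ 0 := by
    rw [hc, Ne, map_eq_zero]
    exact Finset.prod_ne_zero_iff.2 fun j _ => hw j
  set y : Fin m → ℝ := fun j => sgn a j * x j / Complex.normSq (w j) with hy
  have hr : ∀ j, 0 < Complex.normSq (w j) := fun j => Complex.normSq_pos.2 (hw j)
  have hyr : ∀ j, Complex.normSq (w j) * y j = sgn a j * x j := fun j =>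
    mul_div_cancel₀ _ (hr j).ne'
  have hyn : ∑ j, y j * (sgn a j * x j) ≠ 0 := by
    obtain ⟨i, hi⟩ := Function.ne_iff.1 hx
    refine (Finset.sum_pos' (fun j _ => ?_) ⟨i, Finset.mem_univ i, ?_⟩).ne'
    · have : y j * (sgn a j * x j) = x j ^ 2 / Complex.normSq (w j) := by
        simp only [hy]
        rw [div_mul_eq_mul_div]
        congr 1
        linear_combination x j ^ 2 * sgn_mul_self a j
      rw [this]
      exact div_nonneg (sq_nonneg _) (hr j).le
    · have : y i * (sgn a i * x i) = x i ^ 2 / Complex.normSq (w i) := by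
        simp only [hy]
        rw [div_mul_eq_mul_div]
        congr 1
        linear_combination x i ^ 2 * sgn_mul_self a i
      rw [this]
      exact div_pos (sq_pos_of_ne_zero hi) (hr i)
  have hPc : ∀ v, ∑ j, (P v j : ℂ) * (sgn a j * x j : ℝ) = 0 := fun v => by
    have := hP v
    exact_mod_cast this
  have hLinj : Function.Injective L := by
    rw [← LinearMap.ker_eq_bot, LinearMap.ker_eq_bot']
    intro v hv
    have h1 : ∀ j, (P v j : ℂ) + τ v * c * y j = 0 := fun j => by
      have h := hL v j
      rw [hv] at h
      exact (mul_eq_zero.1 h.symm).resolve_left (hw j)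
    have h2 : (τ v : ℂ) * c * (∑ j, y j * (sgn a j * x j) : ℝ) = 0 := by
      have h3 : ∑ j, ((P v j : ℂ) + τ v * c * y j) * (sgn a j * x j : ℝ) = 0 :=
        Finset.sum_eq_zero fun j _ => by rw [h1 j, zero_mul]
      simp only [add_mul, Finset.sum_add_distrib, hPc, zero_add] at h3
      rw [← h3, Complex.ofReal_sum, Finset.mul_sum]
      exact Finset.sum_congr rfl fun j _ => by push_cast; ring
    have h4 : τ v = 0 := by
      have := (mul_eq_zero.1 h2).resolve_right (by exact_mod_cast hyn)
      have := (mul_eq_zero.1 this).resolve_right hc0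
      exact_mod_cast this
    refine hinj v (funext fun j => ?_) h4
    have := h1 j
    rw [h4] at this
    simpa using this
  refine ⟨hLinj, isCalibratedPlane_range hm L hLinj hdim (fun v v' => ?_) fun v => ?_⟩
  · have key : inner ℂ (L v) (L v') = ((∑ j, Complex.normSq (w j) * (P v j * P v' j) +
        τ v * τ v' * Complex.normSq c * ∑ j, Complex.normSq (w j) * y j ^ 2 : ℝ) : ℂ) +
        τ v' * c * (∑ j, (P v j : ℂ) * (sgn a j * x j : ℝ)) +
        τ v * (starRingEnd ℂ) c * (∑ j, (P v' j : ℂ) * (sgn a j * x j : ℝ)) := by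
      rw [PiLp.inner_apply]
      push_cast
      simp only [Finset.mul_sum, ← Finset.sum_add_distrib]
      refine Finset.sum_congr rfl fun j _ => ?_
      have h1 : ((sgn a j : ℂ) * x j) = Complex.normSq (w j) * y j := by
        have := hyr j
        exact_mod_cast this.symm
      rw [h1, RCLike.inner_apply, hL, hL]
      simp only [map_mul, map_add, Complex.conj_ofReal]
      rw [Complex.normSq_eq_conj_mul_self, Complex.normSq_eq_conj_mul_self]
      ring
    rw [key, hPc, hPc, mul_zero, mul_zero, add_zero, add_zero, Complex.ofReal_im]
  · have key : Omega (fun i => L (v i)) = (∏ j, w j) *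
        Matrix.det (Matrix.of fun i j => (P (v i) j : ℂ) + τ (v i) * c * y j) := by
      rw [← Matrix.det_transpose, ← Matrix.det_mul_column, Omega]
      congr 1
      ext i j
      simp [hL, hy]
    rw [key, det_add_smul_eq (fun i => P (v i)) (fun i => τ (v i)) y (fun j => sgn a j * x j)
      (fun i => hP (v i)) hyn, ← mul_assoc, hc, Complex.mul_conj, ← Complex.ofReal_mul,
      Complex.ofReal_im]

section Param

variable {E H X : Type} [NormedAddCommGroup E] [NormedSpace ℝ E] [TopologicalSpace H]
  {I : ModelWithCorners ℝ E H} [TopologicalSpace X] [ChartedSpace H X]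

/-- A level set condition `F ∘ p = c` restricts the differential of `p`. -/
theorem apply_mfderiv_eq_zero {V : Type} [NormedAddCommGroup V] [NormedSpace ℝ V] {p : X → V}
    {F : V → ℝ} {x : X} {F' : V →L[ℝ] ℝ} {c : ℝ} (hF : HasFDerivAt F F' (p x))
    (hp : MDifferentiableAt I 𝓘(ℝ, V) p x) (hc : ∀ y, F (p y) = c) (v : E) :
    F' ((mfderiv I 𝓘(ℝ, V) p x : E →L[ℝ] V) v) = 0 := by
  have h1 := hF.hasMFDerivAt.comp x hp.hasMFDerivAt
  have h2 : F ∘ p = fun _ => c := funext hc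
  rw [h2] at h1
  have h3 := hasMFDerivAt_unique h1 (hasMFDerivAt_const c x)
  exact congrArg (fun A : E →L[ℝ] ℝ => A v) h3

theorem hasFDerivAt_quad {m : ℕ} (a : ℕ) (x : Fin m → ℝ) :
    HasFDerivAt (quad a) (∑ j, (2 * (sgn a j * x j)) •
      (ContinuousLinearMap.proj j : (Fin m → ℝ) →L[ℝ] ℝ)) x := by
  unfold quad
  refine HasFDerivAt.fun_sum fun j _ => ?_
  have h := (((ContinuousLinearMap.proj j : (Fin m → ℝ) →L[ℝ] ℝ).hasFDerivAt (x := x)).pow 2).const_mul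
    (sgn a j)
  refine h.congr_fderiv ?_
  ext v
  simp
  ring

/-- The pair `(p, q)` parametrizes `{x ≠ 0 : quad x = c} × S¹` by a manifold `X`: it is a bijection
and an immersion. The circle stands for time, and is regarded as a subset of `ℂ` for
differentiation. -/
structure IsQuadricParam (I : ModelWithCorners ℝ E H) {m : ℕ} (a : ℕ) (c : ℝ)
    (p : X → Fin m → ℝ) (q : X → Circle) : Prop where
  contMDiff_fst : ContMDiff I 𝓘(ℝ, Fin m → ℝ) ∞ p
  contMDiff_snd : ContMDiff I 𝓘(ℝ, ℂ) ∞ fun x => (q x : ℂ)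
  quad_eq : ∀ x, quad a (p x) = c
  ne_zero : ∀ x, p x ≠ 0
  mfderiv_inj : ∀ (x : X) (v : E), (mfderiv I 𝓘(ℝ, Fin m → ℝ) p x : E →L[ℝ] (Fin m → ℝ)) v = 0 →
    (mfderiv I 𝓘(ℝ, ℂ) (fun x => (q x : ℂ)) x : E →L[ℝ] ℂ) v = 0 → v = 0
  inj : ∀ x y, p x = p y → q x = q y → x = y
  surj : ∀ y z, quad a y = c → y ≠ 0 → ∃ x, p x = y ∧ q x = z
  dense : Dense {x | ∀ j, p x j ≠ 0}

namespace CaseDEvolution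

variable {m a : ℕ} (D : CaseDEvolution m a)

/-- The point `(x_j w_j(t))` of `ℂ^m`. -/
def point (x : Fin m → ℝ) (t : ℝ) : Cm m := WithLp.toLp 2 fun j => (x j : ℂ) * D.w j t

/-- The time in `(-S, S]` at a point of the circle, which is traversed once in time `2S`. -/
def angleTime (S : ℝ) (z : Circle) : ℝ := S / Real.pi * Complex.arg z

/-- The map `(x_j w_j)` from the parameter manifold to `ℂ^m`, with the time read off from the
angular coordinate `q`. -/
def sweep (S : ℝ) (p : X → Fin m → ℝ) (q : X → Circle) (x : X) : Cm m :=
  D.point (p x) (angleTime S (q x))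

@[simp] theorem point_apply (x : Fin m → ℝ) (t : ℝ) (j : Fin m) :
    D.point x t j = (x j : ℂ) * D.w j t := rfl

theorem mem_N {c : ℝ} {z : Cm m} : z ∈ D.N c ↔ ∃ t x, quad a x = c ∧ z = D.point x t := by
  constructor
  · rintro ⟨t, x, hx, h⟩
    exact ⟨t, x, hx, PiLp.ext h⟩
  · rintro ⟨t, x, hx, rfl⟩
    exact ⟨t, x, hx, fun j => rfl⟩

theorem contDiff_point : ContDiff ℝ ∞ fun y : (Fin m → ℝ) × ℝ => D.point y.1 y.2 := by
  rw [contDiff_piLp]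
  intro j
  exact (Complex.ofRealCLM.contDiff.comp ((contDiff_apply ℝ ℝ j).comp contDiff_fst)).mul
    ((D.contDiff_w j).comp contDiff_snd)

theorem point_add_period {S : ℝ} {σ : Fin m → ℝ} (hper : ∀ j t, D.w j (t + S) = σ j * D.w j t)
    (x : Fin m → ℝ) (t : ℝ) : D.point x (t + S) = D.point (fun j => σ j * x j) t := by
  refine PiLp.ext fun j => ?_
  simp only [point_apply, hper]
  push_cast; ring

theorem point_add_two_mul {S : ℝ} {σ : Fin m → ℝ} (hσ : ∀ j, σ j * σ j = 1)
    (hper : ∀ j t, D.w j (t + S) = σ j * D.w j t) (x : Fin m → ℝ) (t : ℝ) (k : ℤ) :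
    D.point x (t + k * (2 * S)) = D.point x t := by
  have h : Function.Periodic (D.point x) (2 * S) := fun t => by
    rw [two_mul, ← add_assoc, D.point_add_period hper, D.point_add_period hper]
    simp only [← mul_assoc, hσ, one_mul]
  exact h.int_mul k t

theorem point_angleTime {S : ℝ} {σ : Fin m → ℝ} (hσ : ∀ j, σ j * σ j = 1)
    (hper : ∀ j t, D.w j (t + S) = σ j * D.w j t) (x : Fin m → ℝ) {φ : ℝ} {z : Circle}
    (hz : Circle.exp φ = z) : D.point x (angleTime S z) = D.point x (S / Real.pi * φ) := by
  have h : Circle.exp φ = Circle.exp (Complex.arg z) := by rw [hz, Circle.exp_arg]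
  obtain ⟨k, hk⟩ := Circle.exp_eq_exp.1 h
  rw [hk, ← D.point_add_two_mul hσ hper x (angleTime S z) k]
  congr 1
  rw [angleTime]
  field_simp [Real.pi_ne_zero]

/-- A smooth choice of the time near a point `z₀` of the circle. It may differ from `angleTime` by
a multiple of `2S`, which does not matter because `w` has the period `2S`. -/
def localTime (S : ℝ) (z₀ : Circle) (ζ : ℂ) : ℝ :=
  S / Real.pi * (Complex.arg z₀ + (Complex.log (ζ / z₀)).im)

theorem point_localTime {S : ℝ} {σ : Fin m → ℝ} (hσ : ∀ j, σ j * σ j = 1)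
    (hper : ∀ j t, D.w j (t + S) = σ j * D.w j t) (x : Fin m → ℝ) (z₀ z : Circle) :
    D.point x (angleTime S z) = D.point x (localTime S z₀ z) := by
  refine D.point_angleTime hσ hper x ?_
  rw [Circle.exp_add, Circle.exp_arg, ← Circle.coe_div, Complex.log_im, Circle.exp_arg]
  exact mul_div_cancel _ _

theorem contDiffAt_localTime (S : ℝ) (z₀ : Circle) : ContDiffAt ℝ ∞ (localTime S z₀) z₀ := by
  have h1 : ContDiffAt ℝ ∞ (fun ζ : ℂ => Complex.log (ζ / z₀)) z₀ := by
    have h2 : ContDiffAt ℂ ∞ Complex.log ((z₀ : ℂ) / z₀) := by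
      rw [div_self z₀.coe_ne_zero]
      exact Complex.contDiffAt_log Complex.one_mem_slitPlane
    exact ContDiffAt.comp (f := fun ζ : ℂ => ζ / z₀) (z₀ : ℂ) (h2.restrict_scalars ℝ)
      (contDiffAt_id.div_const _)
  unfold localTime
  exact contDiffAt_const.mul (contDiffAt_const.add
    (Complex.imCLM.contDiff.contDiffAt.comp (z₀ : ℂ) h1))

theorem hasFDerivAt_localTime (S : ℝ) (z₀ : Circle) : HasFDerivAt (localTime S z₀)
    ((S / Real.pi) • (Complex.imCLM.comp
      ((ContinuousLinearMap.mul ℝ ℂ).flip (z₀ : ℂ)⁻¹))) (z₀ : ℂ) := by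
  have h1 : HasDerivAt (fun ζ : ℂ => Complex.log (ζ / z₀)) ((z₀ : ℂ)⁻¹) (z₀ : ℂ) := by
    have h2 := ((hasDerivAt_id (z₀ : ℂ)).div_const (z₀ : ℂ)).clog
      (by simp [Complex.one_mem_slitPlane])
    exact h2.congr_deriv (by simp)
  have h3 := Complex.imCLM.hasFDerivAt.comp (z₀ : ℂ) (h1.hasFDerivAt.restrictScalars ℝ)
  have h4 := (h3.const_add (Complex.arg z₀)).const_mul (S / Real.pi)
  refine h4.congr_fderiv ?_
  ext v
  simp [mul_comm]

theorem sweep_eq_localTime {X : Type} {S : ℝ} {σ : Fin m → ℝ} (hσ : ∀ j, σ j * σ j = 1)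
    (hper : ∀ j t, D.w j (t + S) = σ j * D.w j t) (p : X → Fin m → ℝ) (q : X → Circle) (x₀ : X) :
    D.sweep S p q = fun x => D.point (p x) (localTime S (q x₀) (q x)) :=
  funext fun x => D.point_localTime hσ hper (p x) (q x₀) (q x)

theorem continuous_sweep {S : ℝ} {σ : Fin m → ℝ} (hσ : ∀ j, σ j * σ j = 1)
    (hper : ∀ j t, D.w j (t + S) = σ j * D.w j t) {p : X → Fin m → ℝ} {q : X → Circle}
    (hp : Continuous p) (hq : Continuous q) : Continuous (D.sweep S p q) := by
  rw [continuous_iff_continuousAt]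
  intro x₀
  rw [D.sweep_eq_localTime hσ hper p q x₀]
  have h1 : ContinuousAt (fun x => localTime S (q x₀) (q x)) x₀ :=
    ContinuousAt.comp (f := fun x => (q x : ℂ)) (g := localTime S (q x₀))
      (contDiffAt_localTime S (q x₀)).continuousAt
      (continuous_subtype_val.comp hq).continuousAt
  exact D.contDiff_point.continuous.continuousAt.comp (hp.continuousAt.prodMk h1)

/-- A parametrized quadric sweeps out a special Lagrangian immersion, since the tangent planes at
`(x_j w_j)` are those of `injective_and_isCalibratedPlane`. -/
theorem isSLImmersion_sweep (hm : 2 ≤ m) (hdim : Module.finrank ℝ E = m) {S : ℝ} (hS : 0 < S)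
    {σ : Fin m → ℝ} (hσ : ∀ j, σ j * σ j = 1) (hper : ∀ j t, D.w j (t + S) = σ j * D.w j t)
    {c : ℝ} {p : X → Fin m → ℝ} {q : X → Circle} (h : IsQuadricParam I a c p q) :
    IsSLImmersion I (D.sweep S p q) := by
  refine ⟨fun x₀ => ?_, fun x₀ => ?_⟩
  · rw [D.sweep_eq_localTime hσ hper p q x₀]
    have h1 : ContMDiffAt I 𝓘(ℝ, ℝ) ∞ (fun x => localTime S (q x₀) (q x)) x₀ :=
      ContMDiffAt.comp (g := localTime S (q x₀)) (f := fun x => (q x : ℂ)) x₀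
        (contDiffAt_localTime S (q x₀)).contMDiffAt (h.contMDiff_snd x₀)
    exact D.contDiff_point.contMDiff.contMDiffAt.comp x₀
      ((h.contMDiff_fst x₀).prodMk_space h1)
  · have hp : MDifferentiableAt I 𝓘(ℝ, Fin m → ℝ) p x₀ :=
      (h.contMDiff_fst x₀).mdifferentiableAt (by simp)
    have hq : MDifferentiableAt I 𝓘(ℝ, ℂ) (fun x => (q x : ℂ)) x₀ :=
      (h.contMDiff_snd x₀).mdifferentiableAt (by simp)
    set P : E →L[ℝ] (Fin m → ℝ) := mfderiv I 𝓘(ℝ, Fin m → ℝ) p x₀ with hPdef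
    set Z : E →L[ℝ] ℂ := mfderiv I 𝓘(ℝ, ℂ) (fun x => (q x : ℂ)) x₀ with hZdef
    set t₀ := localTime S (q x₀) (q x₀)
    have hτ := (hasFDerivAt_localTime S (q x₀)).hasMFDerivAt.comp x₀ hq.hasMFDerivAt
    set τ : E →L[ℝ] ℝ := ((S / Real.pi) • (Complex.imCLM.comp
      ((ContinuousLinearMap.mul ℝ ℂ).flip (q x₀ : ℂ)⁻¹))).comp Z with hτdef
    have hG : HasFDerivAt (fun y : (Fin m → ℝ) × ℝ => D.point y.1 y.2)
        (fderiv ℝ (fun y : (Fin m → ℝ) × ℝ => D.point y.1 y.2) (p x₀, t₀)) (p x₀, t₀) :=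
      (D.contDiff_point.differentiable (by simp) _).hasFDerivAt
    set G := fderiv ℝ (fun y : (Fin m → ℝ) × ℝ => D.point y.1 y.2) (p x₀, t₀)
    have hf : HasMFDerivAt I 𝓘(ℝ, Cm m) (D.sweep S p q) x₀ (G.comp (P.prod τ)) := by
      rw [D.sweep_eq_localTime hσ hper p q x₀]
      exact HasMFDerivAt.comp x₀ (g := fun y : (Fin m → ℝ) × ℝ => D.point y.1 y.2)
        (f := fun x => (p x, localTime S (q x₀) (q x))) hG.hasMFDerivAt
        ⟨hp.hasMFDerivAt.1.prodMk hτ.1, hp.hasMFDerivAt.2.prodMk hτ.2⟩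
    have hdiff : differential I (D.sweep S p q) x₀ = G.comp (P.prod τ) := hf.mfderiv
    rw [hdiff]
    have hcoord : ∀ v j, (G.comp (P.prod τ)) v j = D.w j t₀ * ((P v j : ℂ) + τ v *
        (starRingEnd ℂ) (∏ k, D.w k t₀) * (sgn a j * p x₀ j / Complex.normSq (D.w j t₀) : ℝ)) := by
      intro v j
      have h1 : HasFDerivAt (fun y : (Fin m → ℝ) × ℝ => D.point y.1 y.2 j)
          ((EuclideanSpace.proj j : Cm m →L[ℂ] ℂ).restrictScalars ℝ ∘L G) (p x₀, t₀) :=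
        ((EuclideanSpace.proj j : Cm m →L[ℂ] ℂ).restrictScalars ℝ).hasFDerivAt.comp _ hG
      have h2 : HasFDerivAt (fun y : (Fin m → ℝ) × ℝ => (y.1 j : ℂ))
          (Complex.ofRealCLM ∘L ((ContinuousLinearMap.proj j : (Fin m → ℝ) →L[ℝ] ℝ) ∘L
            ContinuousLinearMap.fst ℝ (Fin m → ℝ) ℝ)) (p x₀, t₀) :=
        (Complex.ofRealCLM ∘L ((ContinuousLinearMap.proj j : (Fin m → ℝ) →L[ℝ] ℝ) ∘L
            ContinuousLinearMap.fst ℝ (Fin m → ℝ) ℝ)).hasFDerivAt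
      have h3 := (D.hasDerivAt_w j t₀).hasFDerivAt.comp (p x₀, t₀)
        (ContinuousLinearMap.snd ℝ (Fin m → ℝ) ℝ).hasFDerivAt
      have h4 := h1.unique (h2.mul h3)
      have h5 := congrArg (fun A : ((Fin m → ℝ) × ℝ) →L[ℝ] ℂ => A (P v, τ v)) h4
      simp only [Function.comp_apply, ContinuousLinearMap.coe_comp,
        add_apply, smul_apply] at h5
      refine h5.trans ?_
      rw [D.normSq_w]
      simp
      ring
    refine injective_and_isCalibratedPlane hm (a := a) hdim
      (G.comp (P.prod τ)).toLinearMap (fun v => P v) (fun v => τ v) (fun j => D.w j t₀)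
      (fun j => D.w_ne_zero j t₀) (p x₀) (h.ne_zero x₀) (fun v => ?_) (fun v hPv hτv => ?_) hcoord
    · have h1 : (∑ j, (2 * (sgn a j * p x₀ j)) •
          (ContinuousLinearMap.proj j : (Fin m → ℝ) →L[ℝ] ℝ)) (P v) = 0 :=
        apply_mfderiv_eq_zero (hasFDerivAt_quad a (p x₀)) hp h.quad_eq v
      have h2 : ∑ j, 2 * (sgn a j * p x₀ j) * P v j = 0 := by simpa [sum_apply] using h1
      have h3 : (2 : ℝ) * ∑ j, P v j * (sgn a j * p x₀ j) = 0 := by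
        rw [← h2, Finset.mul_sum]
        exact Finset.sum_congr rfl fun j _ => by ring
      exact (mul_eq_zero.1 h3).resolve_left two_ne_zero
    · refine h.mfderiv_inj x₀ v hPv ?_
      rw [← hZdef]
      have h1 : ((Z v) * (q x₀ : ℂ)⁻¹).im = 0 := by
        have : (S / Real.pi) * ((Z v) * (q x₀ : ℂ)⁻¹).im = 0 := by
          rw [mul_comm (Z v)]
          simpa [hτdef] using hτv
        exact (mul_eq_zero.1 this).resolve_left (div_pos hS Real.pi_pos).ne'
      have h2 : ((Z v) * (q x₀ : ℂ)⁻¹).re = 0 := by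
        have h3 : HasFDerivAt (fun ζ : ℂ => Complex.normSq ζ)
            ((2 * (q x₀ : ℂ).re) • Complex.reCLM + (2 * (q x₀ : ℂ).im) • Complex.imCLM)
            (q x₀ : ℂ) := by
          have h4 := (Complex.reCLM.hasFDerivAt (x := (q x₀ : ℂ))).pow 2 |>.add
            ((Complex.imCLM.hasFDerivAt (x := (q x₀ : ℂ))).pow 2)
          refine (h4.congr_fderiv ?_).congr_of_eventuallyEq (.of_forall fun ζ => ?_)
          · ext
            simp
          · simp [Complex.normSq_apply, sq]
        have h4 : ((2 * (q x₀ : ℂ).re) • Complex.reCLM +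
            (2 * (q x₀ : ℂ).im) • Complex.imCLM : ℂ →L[ℝ] ℝ) (Z v) = 0 :=
          apply_mfderiv_eq_zero (p := fun x => (q x : ℂ)) (c := 1) h3 hq
            (fun y => Circle.normSq_coe _) v
        have h5 : 2 * (q x₀ : ℂ).re * (Z v).re + 2 * (q x₀ : ℂ).im * (Z v).im = 0 := by
          simpa using h4
        rw [← Circle.coe_inv, Circle.coe_inv_eq_conj, Complex.mul_re, Complex.conj_re,
          Complex.conj_im]
        linarith
      have h5 : (Z v) * (q x₀ : ℂ)⁻¹ = 0 := Complex.ext h2 h1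
      exact (mul_eq_zero.1 h5).resolve_right (inv_ne_zero (q x₀).coe_ne_zero)

end CaseDEvolution

end Param

namespace CaseDEvolution

variable {m a : ℕ} (D : CaseDEvolution m a)

/-! ### Fibres of the parametrization -/

/-- If two generic points agree, then the values of `u` agree, because the quadratic form takes
the same value at `x` and `y`, and the phases `θ_j` agree modulo `π`. -/
theorem eq_of_point_eq {x y : Fin m → ℝ} {t s : ℝ} (hm : 0 < m) (hxy : quad a x = quad a y)
    (hx : ∀ j, x j ≠ 0) (h : D.point x t = D.point y s) :
    D.u t = D.u s ∧ ∀ j, ∃ l : ℤ, D.θ j t - D.θ j s = l * Real.pi := by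
  have hj : ∀ j, (x j : ℂ) * D.w j t = y j * D.w j s := fun j => congrArg (fun z : Cm m => z j) h
  have hsq : ∀ j, x j ^ 2 * D.rad j t = y j ^ 2 * D.rad j s := fun j => by
    have h1 := congrArg Complex.normSq (hj j)
    simpa [Complex.normSq_mul, Complex.normSq_ofReal, normSq_w, sq] using h1
  have hu : D.u t = D.u s := by
    have h1 : (D.u t - D.u s) * ∑ j, x j ^ 2 / D.rad j s = 0 := by
      rw [← sub_eq_zero.2 hxy.symm, quad, quad, ← Finset.sum_sub_distrib, Finset.mul_sum]
      refine Finset.sum_congr rfl fun j _ => ?_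
      have h2 : y j ^ 2 = x j ^ 2 * D.rad j t / D.rad j s := by
        rw [hsq j, mul_div_cancel_right₀ _ (D.rad_pos j s).ne']
      have h3 : D.rad j t = D.rad j s + sgn a j * (D.u t - D.u s) := by simp only [rad]; ring
      have h4 := (D.rad_pos j s).ne'
      rw [h2, h3]
      field_simp
      linear_combination (-(x j ^ 2 * (D.u t - D.u s))) * sgn_mul_self a j
    have h5 : 0 < ∑ j, x j ^ 2 / D.rad j s :=
      Finset.sum_pos (fun j _ => div_pos (sq_pos_of_ne_zero (hx j)) (D.rad_pos j s))
        ⟨⟨0, hm⟩, Finset.mem_univ _⟩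
    exact sub_eq_zero.1 ((mul_eq_zero.1 h1).resolve_right h5.ne')
  refine ⟨hu, fun j => ?_⟩
  have h1 := hj j
  have h0 : ((√(D.rad j s) : ℝ) : ℂ) ≠ 0 := by
    exact_mod_cast (Real.sqrt_pos.2 (D.rad_pos j s)).ne'
  have h3 : (x j : ℂ) * Complex.exp (Complex.I * D.θ j t) =
      y j * Complex.exp (Complex.I * D.θ j s) := by
    refine mul_right_cancel₀ h0 ?_
    rw [w, w, hu] at h1
    rw [mul_assoc, mul_assoc]
    exact h1
  have h4 : (x j : ℂ) * Complex.exp ((D.θ j t - D.θ j s : ℝ) * Complex.I) = y j := by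
    have : ((D.θ j t - D.θ j s : ℝ) : ℂ) * Complex.I =
      Complex.I * D.θ j t - Complex.I * D.θ j s := by push_cast; ring
    rw [this, Complex.exp_sub, ← mul_div_assoc, h3, mul_div_assoc,
      div_self (Complex.exp_ne_zero _), mul_one]
  have h5 := congrArg Complex.im h4
  rw [Complex.im_ofReal_mul, Complex.exp_ofReal_mul_I_im, Complex.ofReal_im] at h5
  obtain ⟨l, hl⟩ := Real.sin_eq_zero_iff.1 ((mul_eq_zero.1 h5).resolve_left (hx j))
  exact ⟨l, hl.symm⟩

/-- Generic points have at most two preimages, which are related by a half turn of the circle and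
the signs `σ_j`. -/
theorem eq_or_eq_of_sweep_eq {X : Type} (hm : 0 < m) {S : ℝ} (hS : 0 < S) {σ : Fin m → ℝ}
    (hσ : ∀ j, σ j * σ j = 1) (hper : ∀ j t, D.w j (t + S) = σ j * D.w j t)
    (hgen : ∀ t s, D.u t = D.u s → (∀ j, ∃ l : ℤ, D.θ j t - D.θ j s = l * Real.pi) →
      ∃ k : ℤ, t - s = k * S)
    {c : ℝ} {p : X → Fin m → ℝ} {q : X → Circle} (hquad : ∀ x, quad a (p x) = c) {x y : X}
    (hx : ∀ j, p x j ≠ 0) (h : D.sweep S p q y = D.sweep S p q x) :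
    (p y = p x ∧ q y = q x) ∨ ((p y = fun j => σ j * p x j) ∧ q y = -q x) := by
  obtain ⟨hu, hθ⟩ := D.eq_of_point_eq hm ((hquad x).trans (hquad y).symm) hx h.symm
  obtain ⟨k, hk⟩ := hgen _ _ hu hθ
  have hπ := Real.pi_pos
  have harg : Complex.arg (q x) = Complex.arg (q y) + k * Real.pi := by
    simp only [angleTime] at hk
    have h1 : S / Real.pi * (Complex.arg (q x) - (Complex.arg (q y) + k * Real.pi)) = 0 := by
      have : S / Real.pi * (k * Real.pi) = k * S := by field_simp
      linarith
    exact sub_eq_zero.1 ((mul_eq_zero.1 h1).resolve_left (div_pos hS hπ).ne')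
  have hcancel : ∀ {x' y' : Fin m → ℝ} {t : ℝ}, D.point y' t = D.point x' t → y' = x' := by
    intro x' y' t h
    funext j
    have h1 : (y' j : ℂ) * D.w j t = x' j * D.w j t := congrArg (fun z : Cm m => z j) h
    exact_mod_cast mul_right_cancel₀ (D.w_ne_zero j t) h1
  have hexp : q x = q y * Circle.exp (k * Real.pi) := by
    rw [← Circle.exp_arg (q x), harg, Circle.exp_add, Circle.exp_arg]
  have h : D.point (p y) (angleTime S (q y)) = D.point (p x) (angleTime S (q x)) := h
  have htime : angleTime S (q x) = angleTime S (q y) + k * S := by linarith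
  rcases Int.even_or_odd' k with ⟨l, rfl | rfl⟩
  · left
    have h1 : Circle.exp ((2 * l : ℤ) * Real.pi) = 1 := Circle.exp_eq_one.2 ⟨l, by push_cast; ring⟩
    have h2 : ((2 * l : ℤ) : ℝ) * S = l * (2 * S) := by push_cast; ring
    rw [htime, h2, D.point_add_two_mul hσ hper] at h
    exact ⟨hcancel h, by rw [hexp, h1, mul_one]⟩
  · right
    have h1 : Circle.exp ((2 * l + 1 : ℤ) * Real.pi) = -1 := by
      have : ((2 * l + 1 : ℤ) : ℝ) * Real.pi = l * (2 * Real.pi) + Real.pi := by push_cast; ring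
      rw [this, Circle.exp_add, Circle.exp_eq_one.2 ⟨l, rfl⟩, one_mul]
      exact Circle.ext (by simp [Circle.coe_exp])
    have h2 : angleTime S (q y) + ((2 * l + 1 : ℤ) : ℝ) * S =
        angleTime S (q y) + l * (2 * S) + S := by push_cast; ring
    rw [htime, h2, D.point_add_period hper, D.point_add_two_mul hσ hper] at h
    exact ⟨hcancel h, by rw [hexp, h1, mul_neg, mul_one, neg_neg]⟩

/-- The parametrization is invariant under a half turn of the circle combined with the signs `σ_j`. -/
theorem sweep_involution {X : Type} {S : ℝ} (hS : 0 < S) {σ : Fin m → ℝ} (hσ : ∀ j, σ j * σ j = 1)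
    (hper : ∀ j t, D.w j (t + S) = σ j * D.w j t) {p : X → Fin m → ℝ} {q : X → Circle} {x y : X}
    (hp : p y = fun j => σ j * p x j) (hq : q y = -q x) :
    D.sweep S p q y = D.sweep S p q x := by
  have h1 : Circle.exp (Complex.arg (q x) + Real.pi) = q y := by
    rw [Circle.exp_add, Circle.exp_arg, hq]
    exact Circle.ext (by simp [Circle.coe_exp])
  have h2 : S / Real.pi * (Complex.arg (q x) + Real.pi) = angleTime S (q x) + S := by
    rw [angleTime]; field_simp [Real.pi_ne_zero]
  rw [sweep, D.point_angleTime hσ hper _ h1, h2, D.point_add_period hper, hp, sweep]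
  simp only [← mul_assoc, hσ, one_mul]

/-! ### Image, properness and closedness -/

theorem point_ne_zero {x : Fin m → ℝ} (hx : x ≠ 0) (t : ℝ) : D.point x t ≠ 0 := by
  obtain ⟨j, hj⟩ := Function.ne_iff.1 hx
  intro h
  have h1 : (x j : ℂ) * D.w j t = 0 := congrArg (fun z : Cm m => z j) h
  exact (mul_ne_zero (by exact_mod_cast hj) (D.w_ne_zero j t)) h1

theorem exists_angleTime {S : ℝ} (hS : 0 < S) {σ : Fin m → ℝ} (hσ : ∀ j, σ j * σ j = 1)
    (hper : ∀ j t, D.w j (t + S) = σ j * D.w j t) (x : Fin m → ℝ) (t : ℝ) :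
    ∃ z : Circle, D.point x (angleTime S z) = D.point x t := by
  refine ⟨Circle.exp (Real.pi / S * t), ?_⟩
  rw [D.point_angleTime hσ hper x rfl]
  congr 1
  field_simp [Real.pi_ne_zero]

theorem range_sweep {X : Type} {S : ℝ} (hS : 0 < S) {σ : Fin m → ℝ} (hσ : ∀ j, σ j * σ j = 1)
    (hper : ∀ j t, D.w j (t + S) = σ j * D.w j t) {c : ℝ} {p : X → Fin m → ℝ} {q : X → Circle}
    (hquad : ∀ x, quad a (p x) = c) (hne : ∀ x, p x ≠ 0)
    (hsurj : ∀ y z, quad a y = c → y ≠ 0 → ∃ x, p x = y ∧ q x = z) :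
    Set.range (D.sweep S p q) = D.N c \ {0} := by
  ext z
  constructor
  · rintro ⟨x, rfl⟩
    exact ⟨D.mem_N.2 ⟨_, _, hquad x, rfl⟩, D.point_ne_zero (hne x) _⟩
  · rintro ⟨hz, hz0⟩
    obtain ⟨t, y, hy, rfl⟩ := D.mem_N.1 hz
    have hy0 : y ≠ 0 := by
      rintro rfl
      exact hz0 (PiLp.ext fun j => by simp)
    obtain ⟨ζ, hζ⟩ := D.exists_angleTime hS hσ hper y t
    obtain ⟨x, rfl, rfl⟩ := hsurj y ζ hy hy0
    exact ⟨x, hζ⟩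

theorem zero_notMem_N {c : ℝ} (hc : c ≠ 0) : (0 : Cm m) ∉ D.N c := by
  intro h
  obtain ⟨t, x, hx, h0⟩ := D.mem_N.1 h
  have : x = 0 := by
    by_contra hne
    exact D.point_ne_zero hne t h0.symm
  rw [this] at hx
  exact hc (by rw [← hx]; simp [quad])

/-- The functions `|w_j|` are bounded below by compactness of the circle. -/
theorem exists_le_norm_w {S : ℝ} {σ : Fin m → ℝ} (hσ : ∀ j, σ j * σ j = 1)
    (hper : ∀ j t, D.w j (t + S) = σ j * D.w j t) :
    ∃ δ : ℝ, 0 < δ ∧ ∀ (z : Circle) j, δ ≤ ‖D.w j (angleTime S z)‖ := by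
  have h1 : ∀ j, ∃ δ : ℝ, 0 < δ ∧ ∀ z : Circle, δ ≤ ‖D.w j (angleTime S z)‖ := by
    intro j
    have hc : Continuous fun z : Circle => ‖D.sweep S (fun _ _ => 1) id z j‖ :=
      ((EuclideanSpace.proj j : Cm m →L[ℂ] ℂ).continuous.comp
        (D.continuous_sweep hσ hper (p := fun _ _ => 1) continuous_const continuous_id)).norm
    obtain ⟨z₀, -, hz₀⟩ := isCompact_univ.exists_isMinOn Set.univ_nonempty hc.continuousOn
    replace hz₀ : ∀ z : Circle, ‖D.sweep S (fun _ _ => 1) id z₀ j‖ ≤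
        ‖D.sweep S (fun _ _ => 1) id z j‖ := fun z => hz₀ (Set.mem_univ z)
    have h2 : ∀ z : Circle, D.sweep S (fun _ _ => 1) id z j = D.w j (angleTime S z) := fun z => by
      simp [sweep]
    simp only [h2] at hz₀
    exact ⟨_, norm_pos_iff.2 (D.w_ne_zero j _), hz₀⟩
  choose δ hδ hle using h1
  by_cases hm : Nonempty (Fin m)
  · refine ⟨Finset.univ.inf' Finset.univ_nonempty δ, ?_, fun z j => ?_⟩
    · rw [Finset.lt_inf'_iff]; exact fun j _ => hδ j
    · exact (Finset.inf'_le _ (Finset.mem_univ j)).trans (hle j z)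
  · exact ⟨1, one_pos, fun z j => (hm ⟨j⟩).elim⟩

theorem isProperMap_sweep {X : Type} [TopologicalSpace X] {S : ℝ} {σ : Fin m → ℝ}
    (hσ : ∀ j, σ j * σ j = 1) (hper : ∀ j t, D.w j (t + S) = σ j * D.w j t)
    {p : X → Fin m → ℝ} {q : X → Circle} (hp : Continuous p) (hq : Continuous q)
    (hK : ∀ R : ℝ, ∃ K : Set X, IsCompact K ∧ {x | ‖p x‖ ≤ R} ⊆ K) :
    IsProperMap (D.sweep S p q) := by
  have hcont := D.continuous_sweep hσ hper hp hq
  refine isProperMap_iff_isCompact_preimage.2 ⟨hcont, fun C hC => ?_⟩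
  obtain ⟨δ, hδ, hle⟩ := D.exists_le_norm_w hσ hper
  obtain ⟨R, hR⟩ := hC.isBounded.exists_norm_le
  obtain ⟨K, hKc, hKs⟩ := hK (|R| / δ)
  refine hKc.of_isClosed_subset (hC.isClosed.preimage hcont) fun x hx => hKs ?_
  rw [Set.mem_ofPred_eq, pi_norm_le_iff_of_nonneg (by positivity)]
  intro j
  rw [le_div_iff₀ hδ]
  have h1 : ‖D.sweep S p q x j‖ ≤ |R| :=
    (PiLp.norm_apply_le _ j).trans ((hR _ hx).trans (le_abs_self R))
  rw [sweep, point_apply, norm_mul, Complex.norm_real] at h1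
  exact (mul_le_mul_of_nonneg_left (hle (q x) j) (norm_nonneg _)).trans h1

/-- The set `N_c` is the image of a closed set under the proper map `(x, z) ↦ (x_j w_j)` on
`ℝ^m × S¹`. -/
theorem isClosed_N {S : ℝ} (hS : 0 < S) {σ : Fin m → ℝ} (hσ : ∀ j, σ j * σ j = 1)
    (hper : ∀ j t, D.w j (t + S) = σ j * D.w j t) (c : ℝ) : IsClosed (D.N c) := by
  have h1 : IsProperMap (D.sweep S (X := (Fin m → ℝ) × Circle) Prod.fst Prod.snd) := by
    refine D.isProperMap_sweep hσ hper continuous_fst continuous_snd fun R =>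
      ⟨Metric.closedBall 0 R ×ˢ Set.univ, (isCompact_closedBall _ _).prod isCompact_univ,
        fun x hx => ⟨by simpa using hx, Set.mem_univ _⟩⟩
  have hq : Continuous (quad (m := m) a) := by unfold quad; fun_prop
  have h2 : D.N c = D.sweep S (X := (Fin m → ℝ) × Circle) Prod.fst Prod.snd ''
      {x | quad a x.1 = c} := by
    ext z
    rw [mem_N]
    constructor
    · rintro ⟨t, x, hx, rfl⟩
      obtain ⟨ζ, hζ⟩ := D.exists_angleTime hS hσ hper x t
      exact ⟨(x, ζ), hx, hζ⟩
    · rintro ⟨⟨x, ζ⟩, hx, rfl⟩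
      exact ⟨_, x, hx, rfl⟩
  rw [h2]
  exact h1.isClosedMap _ (isClosed_eq (hq.comp continuous_fst) continuous_const)

/-! ### The singular point of the cone -/

theorem injective_θ (j : Fin m) : Function.Injective (D.θ j) := by
  rcases sgn_eq_or a j with h | h
  · refine (strictAnti_of_deriv_neg fun t => ?_).injective
    rw [(D.hasDerivAt_θ j t).deriv, h]
    have := div_pos (D.area_pos t) (D.rad_pos j t)
    rw [neg_one_mul, neg_div]
    linarith
  · refine (strictMono_of_deriv_pos fun t => ?_).injective
    rw [(D.hasDerivAt_θ j t).deriv, h]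
    have := div_pos (D.area_pos t) (D.rad_pos j t)
    simpa using this

theorem smul_mem_N_zero {z : Cm m} (hz : z ∈ D.N 0) (r : ℝ) : r • z ∈ D.N 0 := by
  obtain ⟨t, x, hx, rfl⟩ := D.mem_N.1 hz
  refine D.mem_N.2 ⟨t, fun j => r * x j, ?_, PiLp.ext fun j => ?_⟩
  · simp only [quad] at hx ⊢
    rw [← mul_zero (r ^ 2), ← hx, Finset.mul_sum]
    exact Finset.sum_congr rfl fun j _ => by ring
  · simp [mul_assoc]

/-- On `N_0`, if the coordinates of one of the two signs vanish, then so do the others. -/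
theorem eq_zero_of_mem_N_zero {z : Cm m} (hz : z ∈ D.N 0) {ε : ℝ}
    (h : ∀ j, sgn a j = ε → z j = 0) (hε : ε = 1 ∨ ε = -1) : z = 0 := by
  obtain ⟨t, x, hx, rfl⟩ := D.mem_N.1 hz
  have h1 : ∀ j, sgn a j = ε → x j = 0 := fun j hj => by
    have := h j hj
    rw [point_apply] at this
    exact Complex.ofReal_eq_zero.1 ((mul_eq_zero.1 this).resolve_right (D.w_ne_zero j t))
  have h2 : ∀ j, sgn a j * x j ^ 2 = -ε * x j ^ 2 := fun j => by
    by_cases hj : sgn a j = ε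
    · rw [h1 j hj]; ring
    · congr 1
      rcases sgn_eq_or a j with hs | hs <;> rcases hε with he | he <;> rw [hs, he] at hj ⊢ <;>
        first | exact absurd rfl hj | norm_num
  have h3 : ∑ j, x j ^ 2 = 0 := by
    simp only [quad, h2, ← Finset.mul_sum] at hx
    refine (mul_eq_zero.1 hx).resolve_left ?_
    rcases hε with he | he <;> rw [he] <;> norm_num
  have h4 : ∀ j, x j = 0 := fun j => by
    have := (Finset.sum_eq_zero_iff_of_nonneg fun i _ => sq_nonneg (x i)).1 h3 j (Finset.mem_univ j)
    exact pow_eq_zero_iff two_ne_zero |>.1 this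
  exact PiLp.ext fun j => by simp [h4]

theorem card_sgn_eq (ham : a < m) : Fintype.card {j : Fin m // sgn a j = 1} = a ∧
    Fintype.card {j : Fin m // sgn a j = -1} = m - a := by
  have h1 : Fintype.card {j : Fin m // sgn a j = 1} = a := by
    have e : {j : Fin m // sgn a j = 1} ≃ Fin a :=
      { toFun := fun j => ⟨j.1, by
          by_contra h
          have := j.2
          rw [sgn, if_neg h] at this
          norm_num at this⟩
        invFun := fun i => ⟨⟨i, by omega⟩, by simp [sgn]⟩
        left_inv := fun j => rfl
        right_inv := fun i => rfl }
    rw [Fintype.card_congr e, Fintype.card_fin]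
  refine ⟨h1, ?_⟩
  have h2 := Fintype.card_subtype_compl (fun j : Fin m => sgn a j = 1)
  rw [h1, Fintype.card_fin] at h2
  rw [← h2]
  refine Fintype.card_congr (Equiv.subtypeEquivRight fun j => ?_)
  unfold sgn; split_ifs <;> norm_num

/-- `N_0` contains no real linear subspace of dimension `m`. Such a subspace would project
injectively to the coordinates of either sign, so these are equal in number and the first
projection is onto. But `θ_1` is injective, so that `N_0` meets the vectors with `z_1 = 1` in
points where `z_2` has only countably many arguments. -/
theorem not_injective_of_forall_mem_N_zero (hm : 3 ≤ m) (ha : 1 ≤ a) (ham : a < m)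
    (L : EuclideanSpace ℝ (Fin m) →ₗ[ℝ] Cm m) (hL : ∀ v, L v ∈ D.N 0) :
    ¬ Function.Injective L := by
  intro hinj
  let pr : ∀ ε : ℝ, Cm m →ₗ[ℝ] ({j : Fin m // sgn a j = ε} → ℂ) := fun ε =>
    { toFun := fun z j => z j
      map_add' := fun x y => rfl
      map_smul' := fun r x => rfl }
  have hpr : ∀ ε : ℝ, ε = 1 ∨ ε = -1 → Function.Injective ((pr ε).comp L) := by
    intro ε hε
    rw [← LinearMap.ker_eq_bot, LinearMap.ker_eq_bot']
    intro v hv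
    refine hinj ?_
    rw [map_zero]
    exact D.eq_zero_of_mem_N_zero (hL v) (fun j hj => congrFun hv ⟨j, hj⟩) hε
  have hrank : ∀ ε : ℝ, Module.finrank ℝ ({j : Fin m // sgn a j = ε} → ℂ) =
      Fintype.card {j : Fin m // sgn a j = ε} * 2 := fun ε => by
    rw [Module.finrank_pi_fintype]
    simp [Complex.finrank_real_complex]
  obtain ⟨hc1, hc2⟩ := card_sgn_eq (m := m) ham
  have h1 := LinearMap.finrank_le_finrank_of_injective (hpr 1 (Or.inl rfl))
  have h2 := LinearMap.finrank_le_finrank_of_injective (hpr (-1) (Or.inr rfl))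
  rw [hrank, finrank_euclideanSpace_fin] at h1 h2
  rw [hc1] at h1
  rw [hc2] at h2
  have hsurj : Function.Surjective ((pr 1).comp L) := by
    refine (LinearMap.injective_iff_surjective_of_finrank_eq_finrank ?_).1 (hpr 1 (Or.inl rfl))
    rw [hrank, finrank_euclideanSpace_fin, hc1]
    omega
  let j₁ : Fin m := ⟨0, by omega⟩
  let j₂ : Fin m := ⟨1, by omega⟩
  have hj₁ : sgn a j₁ = 1 := if_pos (by show 0 < a; omega)
  have hj₂ : sgn a j₂ = 1 := if_pos (by show 1 < a; omega)
  have hne : j₁ ≠ j₂ := by simp [j₁, j₂]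
  have hex : ∀ φ : ℝ, ∃ t, (∃ l : ℤ, D.θ j₁ t = l * Real.pi) ∧
      ∃ l : ℤ, D.θ j₂ t - φ = l * Real.pi := by
    intro φ
    obtain ⟨v, hv⟩ := hsurj fun j => if j.1 = j₁ then 1 else Complex.exp (φ * Complex.I)
    obtain ⟨t, x, hx, hz⟩ := D.mem_N.1 (hL v)
    have hv1 : L v j₁ = 1 := (congrFun hv ⟨j₁, hj₁⟩).trans (if_pos rfl)
    have hv2 : L v j₂ = Complex.exp (φ * Complex.I) :=
      (congrFun hv ⟨j₂, hj₂⟩).trans (if_neg hne.symm)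
    have key : ∀ (j : Fin m) (ψ : ℝ), L v j = Complex.exp (ψ * Complex.I) →
        ∃ l : ℤ, D.θ j t - ψ = l * Real.pi := by
      intro j ψ hj
      rw [hz, point_apply, w] at hj
      set r : ℝ := x j * √(D.α j + sgn a j * D.u t) with hr
      have h4 : (r : ℂ) * Complex.exp ((D.θ j t - ψ : ℝ) * Complex.I) = 1 := by
        have : ((D.θ j t - ψ : ℝ) : ℂ) * Complex.I =
          Complex.I * D.θ j t - ψ * Complex.I := by push_cast; ring
        rw [this, Complex.exp_sub, ← hj, hr, ← mul_div_assoc, div_eq_one_iff_eq]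
        · push_cast; ring
        · rw [hj]; exact Complex.exp_ne_zero _
      have hr0 : r ≠ 0 := by
        intro h; rw [h] at h4; simp at h4
      have h5 := congrArg Complex.im h4
      rw [Complex.im_ofReal_mul, Complex.exp_ofReal_mul_I_im, Complex.one_im] at h5
      obtain ⟨l, hl⟩ := Real.sin_eq_zero_iff.1 ((mul_eq_zero.1 h5).resolve_left hr0)
      exact ⟨l, hl.symm⟩
    refine ⟨t, ?_, key j₂ φ hv2⟩
    obtain ⟨l, hl⟩ := key j₁ 0 (by simp [hv1])
    exact ⟨l, by rw [← hl, sub_zero]⟩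
  choose t ht1 ht2 using hex
  choose l₁ hl₁ using ht1
  choose l₂ hl₂ using ht2
  have hinj2 : Function.Injective fun φ : ℝ => (l₁ φ, l₂ φ) := by
    intro φ ψ h
    simp only [Prod.mk.injEq] at h
    have ht : t φ = t ψ := D.injective_θ j₁ (by rw [hl₁, hl₁, h.1])
    have e1 := hl₂ φ
    have e2 := hl₂ ψ
    rw [ht, h.2] at e1
    linarith
  exact Cardinal.not_countable_real (Set.countable_univ_iff.2 hinj2.countable)

/-- The derivative at `0` of a disc in the closed cone `N_0` takes values in `N_0`, which contains no
linear subspace of dimension `m`. -/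
theorem isSingularAtZero_N_zero (hm : 3 ≤ m) (ha : 1 ≤ a) (ham : a < m)
    (hclosed : IsClosed (D.N 0)) : IsSingularAtZero (D.N 0) := by
  refine ⟨D.mem_N.2 ⟨0, 0, by simp [quad], PiLp.ext fun j => by simp⟩, ?_⟩
  intro f hf hf0 hN
  have hd : HasFDerivAt f (fderiv ℝ f 0) 0 := (hf.differentiableAt (by simp)).hasFDerivAt
  refine D.not_injective_of_forall_mem_N_zero hm ha ham (fderiv ℝ f 0).toLinearMap fun v => ?_
  have hline : HasDerivAt (fun s : ℝ => f (s • v)) (fderiv ℝ f 0 v) 0 := by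
    have h1 : HasDerivAt (fun s : ℝ => s • v) v 0 := by
      simpa using (hasDerivAt_id (0 : ℝ)).smul_const v
    exact HasFDerivAt.comp_hasDerivAt_of_eq (0 : ℝ) hd h1 (by simp)
  have hlim := hline.tendsto_slope_zero
  refine hclosed.mem_of_tendsto hlim ?_
  have hc : Filter.Tendsto (fun s : ℝ => s • v) (nhds 0) (nhds 0) := by
    have : Continuous fun s : ℝ => s • v := by fun_prop
    simpa using this.tendsto 0
  filter_upwards [nhdsWithin_le_nhds (hc.eventually hN)] with s hs
  simp only [zero_add, zero_smul, hf0, sub_zero]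
  exact D.smul_mem_N_zero hs _

end CaseDEvolution

/-! ### Parametrizations of the quadrics -/

theorem contMDiff_circle_coe : ContMDiff (𝓡 1) 𝓘(ℝ, ℂ) ∞ fun z : Circle => (z : ℂ) :=
  haveI : Fact (Module.finrank ℝ ℂ = 1 + 1) := finrank_real_complex_fact'
  contMDiff_coe_sphere (E := ℂ) (n := 1)

theorem mfderiv_circle_coe_injective (z : Circle) : Function.Injective
    (mfderiv (𝓡 1) 𝓘(ℝ, ℂ) (fun z : Circle => (z : ℂ)) z :
      EuclideanSpace ℝ (Fin 1) →L[ℝ] ℂ) :=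
  haveI : Fact (Module.finrank ℝ ℂ = 1 + 1) := finrank_real_complex_fact'
  injective_mvfderiv_subtypeVal_sphere (E := ℂ) (n := 1) z

theorem contMDiff_circle_neg : ContMDiff (𝓡 1) (𝓡 1) ∞ fun z : Circle => -z :=
  haveI : Fact (Module.finrank ℝ ℂ = 1 + 1) := finrank_real_complex_fact'
  contMDiff_neg_sphere (E := ℂ) (n := 1)

theorem contMDiff_sph_coe (n : ℕ) :
    ContMDiff (𝓡 n) 𝓘(ℝ, EuclideanSpace ℝ (Fin (n + 1))) ∞
      fun x : Sph n => (x : EuclideanSpace ℝ (Fin (n + 1))) :=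
  haveI : Fact (Module.finrank ℝ (EuclideanSpace ℝ (Fin (n + 1))) = n + 1) :=
    ⟨finrank_euclideanSpace_fin⟩
  contMDiff_coe_sphere

theorem mfderiv_sph_coe_injective (n : ℕ) (x : Sph n) : Function.Injective
    (mfderiv (𝓡 n) 𝓘(ℝ, EuclideanSpace ℝ (Fin (n + 1)))
      (fun x : Sph n => (x : EuclideanSpace ℝ (Fin (n + 1)))) x :
      EuclideanSpace ℝ (Fin n) →L[ℝ] EuclideanSpace ℝ (Fin (n + 1))) :=
  haveI : Fact (Module.finrank ℝ (EuclideanSpace ℝ (Fin (n + 1))) = n + 1) :=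
    ⟨finrank_euclideanSpace_fin⟩
  injective_mvfderiv_subtypeVal_sphere x

/-- The diagonal linear map with entries `σ_j`. -/
def signMap {k : ℕ} (σ : Fin k → ℝ) : EuclideanSpace ℝ (Fin k) →L[ℝ] EuclideanSpace ℝ (Fin k) :=
  LinearMap.toContinuousLinearMap
    { toFun := fun x => WithLp.toLp 2 fun j => σ j * x j
      map_add' := fun x y => PiLp.ext fun j => by simp [mul_add]
      map_smul' := fun r x => PiLp.ext fun j => by simp [mul_left_comm] }

@[simp] theorem signMap_apply {k : ℕ} (σ : Fin k → ℝ) (x : EuclideanSpace ℝ (Fin k)) (j : Fin k) :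
    signMap σ x j = σ j * x j := rfl

theorem signMap_signMap {k : ℕ} {σ : Fin k → ℝ} (hσ : ∀ j, σ j * σ j = 1)
    (x : EuclideanSpace ℝ (Fin k)) : signMap σ (signMap σ x) = x :=
  PiLp.ext fun j => by simp [← mul_assoc, hσ]

theorem norm_signMap {k : ℕ} {σ : Fin k → ℝ} (hσ : ∀ j, σ j * σ j = 1)
    (x : EuclideanSpace ℝ (Fin k)) : ‖signMap σ x‖ = ‖x‖ := by
  rw [EuclideanSpace.norm_eq, EuclideanSpace.norm_eq]
  congr 1
  refine Finset.sum_congr rfl fun j _ => ?_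
  rw [signMap_apply, norm_mul, mul_pow, Real.norm_eq_abs, sq_abs, sq, hσ, one_mul]

/-- The action of diagonal signs on the sphere. -/
def signSph {n : ℕ} (σ : Fin (n + 1) → ℝ) (hσ : ∀ j, σ j * σ j = 1) : Sph n → Sph n :=
  Set.codRestrict (fun x : Sph n => signMap σ x) (Metric.sphere 0 1) fun x => by
    rw [mem_sphere_zero_iff_norm, norm_signMap hσ, norm_eq_of_mem_sphere]

theorem coe_signSph {n : ℕ} {σ : Fin (n + 1) → ℝ} (hσ : ∀ j, σ j * σ j = 1) (x : Sph n) :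
    (signSph σ hσ x : EuclideanSpace ℝ (Fin (n + 1))) = signMap σ x := rfl

theorem contMDiff_signSph {n : ℕ} {σ : Fin (n + 1) → ℝ} (hσ : ∀ j, σ j * σ j = 1) :
    ContMDiff (𝓡 n) (𝓡 n) ∞ (signSph σ hσ) :=
  haveI : Fact (Module.finrank ℝ (EuclideanSpace ℝ (Fin (n + 1))) = n + 1) :=
    ⟨finrank_euclideanSpace_fin⟩
  ContMDiff.codRestrict_sphere ((signMap σ).contDiff.contMDiff.comp (contMDiff_sph_coe n)) _

theorem signSph_signSph {n : ℕ} {σ : Fin (n + 1) → ℝ} (hσ : ∀ j, σ j * σ j = 1) (x : Sph n) :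
    signSph σ hσ (signSph σ hσ x) = x :=
  Subtype.ext (by rw [coe_signSph, coe_signSph, signMap_signMap hσ])

/-! ### Generic points -/

/-- Every vector is a limit of vectors without zero coordinates, along the segment towards the
indicator of its zero coordinates. -/
theorem dense_euclidean_ne_zero (k : ℕ) :
    Dense {x : EuclideanSpace ℝ (Fin k) | ∀ j, x j ≠ 0} := by
  intro x
  set v : EuclideanSpace ℝ (Fin k) := WithLp.toLp 2 fun j => if x j = 0 then 1 else 0 with hv
  have h : Filter.Tendsto (fun ε : ℝ => x + ε • v) (nhdsWithin 0 {0}ᶜ) (nhds x) := by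
    have : Continuous fun ε : ℝ => x + ε • v := by fun_prop
    have h := this.tendsto 0
    rw [zero_smul, add_zero] at h
    exact h.mono_left nhdsWithin_le_nhds
  refine mem_closure_of_tendsto h ?_
  filter_upwards [self_mem_nhdsWithin] with ε hε j
  by_cases hj : x j = 0
  · simpa [hv, hj] using hε
  · simp [hv, hj]

/-- Normalizing an approximation by vectors without zero coordinates gives one on the sphere. -/
theorem dense_sphere_ne_zero (n : ℕ) :
    Dense {x : Sph n | ∀ j, (x : EuclideanSpace ℝ (Fin (n + 1))) j ≠ 0} := by
  intro x
  have hx : ∀ ε > 0, ∃ y : EuclideanSpace ℝ (Fin (n + 1)), dist y x < ε ∧ ∀ j, y j ≠ 0 :=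
    fun ε hε => by
      obtain ⟨y, hy, hd⟩ := Metric.dense_iff.1 (dense_euclidean_ne_zero (n + 1)) x ε hε
      exact ⟨y, hy, hd⟩
  have hpos : ∀ k : ℕ, (0 : ℝ) < 1 / (k + 1) := fun k => by positivity
  choose y hyd hy using fun k : ℕ => hx (1 / (k + 1)) (hpos k)
  have hlim : Filter.Tendsto y Filter.atTop (nhds x) := by
    rw [tendsto_iff_dist_tendsto_zero]
    exact squeeze_zero (fun _ => dist_nonneg) (fun k => (hyd k).le)
      tendsto_one_div_add_atTop_nhds_zero_nat
  have hne : ∀ k, y k ≠ 0 := fun k h => hy k 0 (by rw [h]; rfl)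
  have hx1 : ‖(x : EuclideanSpace ℝ (Fin (n + 1)))‖ = 1 := norm_eq_of_mem_sphere x
  have hlim2 : Filter.Tendsto (fun k => ‖y k‖⁻¹ • y k) Filter.atTop (nhds x) := by
    have := (hlim.norm.inv₀ (by rw [hx1]; exact one_ne_zero)).smul hlim
    rwa [hx1, inv_one, one_smul] at this
  refine mem_closure_of_tendsto (f := fun k : ℕ => (⟨‖y k‖⁻¹ • y k, by
    rw [mem_sphere_zero_iff_norm, norm_smul, norm_inv, norm_norm,
      inv_mul_cancel₀ (norm_ne_zero_iff.2 (hne k))]⟩ : Sph n))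
    (tendsto_subtype_rng.2 hlim2) (.of_forall fun k j => ?_)
  exact mul_ne_zero (inv_ne_zero (norm_ne_zero_iff.2 (hne k))) (hy k j)

/-! ### Splitting of the coordinates -/

/-- The vector with coordinates `x` for the positive and `y` for the negative squares. -/
def join {k l : ℕ} (x : EuclideanSpace ℝ (Fin k)) (y : EuclideanSpace ℝ (Fin l)) :
    Fin (k + l) → ℝ := Fin.append x y

/-- The coordinates with positive squares. -/
def posPart {k l : ℕ} (x : Fin (k + l) → ℝ) : EuclideanSpace ℝ (Fin k) :=
  WithLp.toLp 2 fun i => x (Fin.castAdd l i)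

/-- The coordinates with negative squares. -/
def negPart {k l : ℕ} (x : Fin (k + l) → ℝ) : EuclideanSpace ℝ (Fin l) :=
  WithLp.toLp 2 fun i => x (Fin.natAdd k i)

section Split

variable {k l : ℕ}

@[simp] theorem join_castAdd (x : EuclideanSpace ℝ (Fin k)) (y : EuclideanSpace ℝ (Fin l))
    (i : Fin k) : join x y (Fin.castAdd l i) = x i := Fin.append_left _ _ i

@[simp] theorem join_natAdd (x : EuclideanSpace ℝ (Fin k)) (y : EuclideanSpace ℝ (Fin l))
    (i : Fin l) : join x y (Fin.natAdd k i) = y i := Fin.append_right _ _ i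

@[simp] theorem posPart_join (x : EuclideanSpace ℝ (Fin k)) (y : EuclideanSpace ℝ (Fin l)) :
    posPart (join x y) = x := PiLp.ext fun i => join_castAdd x y i

@[simp] theorem negPart_join (x : EuclideanSpace ℝ (Fin k)) (y : EuclideanSpace ℝ (Fin l)) :
    negPart (join x y) = y := PiLp.ext fun i => join_natAdd x y i

theorem join_posPart_negPart (x : Fin (k + l) → ℝ) : join (posPart x) (negPart x) = x := by
  funext j
  refine Fin.addCases (fun i => ?_) (fun i => ?_) j <;> simp [posPart, negPart]

theorem sgn_castAdd (i : Fin k) : sgn k (Fin.castAdd l i) = 1 := if_pos (by simp)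

theorem sgn_natAdd (i : Fin l) : sgn k (Fin.natAdd k i) = -1 := if_neg (by simp)

theorem quad_join (x : EuclideanSpace ℝ (Fin k)) (y : EuclideanSpace ℝ (Fin l)) :
    quad k (join x y) = ‖x‖ ^ 2 - ‖y‖ ^ 2 := by
  rw [quad, Fin.sum_univ_add, EuclideanSpace.real_norm_sq_eq, EuclideanSpace.real_norm_sq_eq]
  simp [sgn_castAdd, sgn_natAdd, sub_eq_add_neg]

theorem quad_eq_norm_sub (x : Fin (k + l) → ℝ) :
    quad k x = ‖posPart x‖ ^ 2 - ‖negPart x‖ ^ 2 := by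
  rw [← quad_join, join_posPart_negPart]

theorem contDiff_join : ContDiff ℝ ∞
    fun x : EuclideanSpace ℝ (Fin k) × EuclideanSpace ℝ (Fin l) => join x.1 x.2 := by
  rw [contDiff_pi]
  intro j
  refine Fin.addCases (fun i => ?_) (fun i => ?_) j
  · simp only [join_castAdd]
    fun_prop
  · simp only [join_natAdd]
    fun_prop

theorem contDiff_posPart : ContDiff ℝ ∞ (posPart : (Fin (k + l) → ℝ) → _) := by
  rw [contDiff_piLp]
  exact fun i => contDiff_apply ℝ ℝ _

theorem contDiff_negPart : ContDiff ℝ ∞ (negPart : (Fin (k + l) → ℝ) → _) := by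
  rw [contDiff_piLp]
  exact fun i => contDiff_apply ℝ ℝ _

theorem join_ne_zero_iff (x : EuclideanSpace ℝ (Fin k)) (y : EuclideanSpace ℝ (Fin l)) :
    (∀ j, join x y j ≠ 0) ↔ (∀ i, x i ≠ 0) ∧ ∀ i, y i ≠ 0 := by
  constructor
  · intro h
    exact ⟨fun i => by simpa using h (Fin.castAdd l i), fun i => by simpa using h (Fin.natAdd k i)⟩
  · rintro ⟨h1, h2⟩ j
    refine Fin.addCases (fun i => ?_) (fun i => ?_) j
    · simpa using h1 i
    · simpa using h2 i

theorem join_signMap (σ : Fin (k + l) → ℝ) (x : EuclideanSpace ℝ (Fin k))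
    (y : EuclideanSpace ℝ (Fin l)) :
    join (signMap (fun i => σ (Fin.castAdd l i)) x) (signMap (fun i => σ (Fin.natAdd k i)) y) =
      fun j => σ j * join x y j := by
  funext j
  refine Fin.addCases (fun i => ?_) (fun i => ?_) j <;> simp

theorem norm_posPart_le (x : Fin (k + l) → ℝ) : ‖posPart x‖ ≤ √k * ‖x‖ := by
  rw [EuclideanSpace.norm_eq]
  refine Real.sqrt_le_iff.2 ⟨by positivity, ?_⟩
  rw [mul_pow, Real.sq_sqrt (Nat.cast_nonneg k)]
  refine (Finset.sum_le_card_nsmul _ _ (‖x‖ ^ 2) fun i _ => ?_).trans (by simp)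
  exact pow_le_pow_left₀ (norm_nonneg _) (norm_le_pi_norm x _) 2

theorem norm_negPart_le (x : Fin (k + l) → ℝ) : ‖negPart x‖ ≤ √l * ‖x‖ := by
  rw [EuclideanSpace.norm_eq]
  refine Real.sqrt_le_iff.2 ⟨by positivity, ?_⟩
  rw [mul_pow, Real.sq_sqrt (Nat.cast_nonneg l)]
  refine (Finset.sum_le_card_nsmul _ _ (‖x‖ ^ 2) fun i _ => ?_).trans (by simp)
  exact pow_le_pow_left₀ (norm_nonneg _) (norm_le_pi_norm x _) 2

end Split

/-! ### Differentials on products -/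

section Prod

variable {E H X : Type} [NormedAddCommGroup E] [NormedSpace ℝ E] [TopologicalSpace H]
  {I : ModelWithCorners ℝ E H} [TopologicalSpace X] [ChartedSpace H X]
  {E' H' Y : Type} [NormedAddCommGroup E'] [NormedSpace ℝ E'] [TopologicalSpace H']
  {I' : ModelWithCorners ℝ E' H'} [TopologicalSpace Y] [ChartedSpace H' Y]
  {V W : Type} [NormedAddCommGroup V] [NormedSpace ℝ V] [NormedAddCommGroup W] [NormedSpace ℝ W]

/-- A function of `p` that is smooth has differential zero on the kernel of the differential
of `p`. -/
theorem mfderiv_eq_zero_of_comp {p : X → V} {g : X → W} {h : V → W} {x : X} (hg : ∀ y, g y = h (p y))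
    (hh : DifferentiableAt ℝ h (p x)) (hp : MDifferentiableAt I 𝓘(ℝ, V) p x) {v : E}
    (hv : (mfderiv I 𝓘(ℝ, V) p x : E →L[ℝ] V) v = 0) :
    (mfderiv I 𝓘(ℝ, W) g x : E →L[ℝ] W) v = 0 := by
  have h1 := hh.hasFDerivAt.hasMFDerivAt.comp x hp.hasMFDerivAt
  have h2 : h ∘ p = g := (funext hg).symm
  rw [h2] at h1
  rw [h1.mfderiv]
  exact (congrArg (fderiv ℝ h (p x)) hv).trans (map_zero _)

theorem mfderiv_comp_fst {g : X → V} {x : X × Y} (hg : MDifferentiableAt I 𝓘(ℝ, V) g x.1)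
    (v : E × E') : (mfderiv (I.prod I') 𝓘(ℝ, V) (fun y : X × Y => g y.1) x : E × E' →L[ℝ] V) v =
      (mfderiv I 𝓘(ℝ, V) g x.1 : E →L[ℝ] V) v.1 := by
  have h := hg.hasMFDerivAt.comp x (hasMFDerivAt_fst (I := I) (I' := I') x)
  have h1 : mfderiv (I.prod I') 𝓘(ℝ, V) (fun y : X × Y => g y.1) x = _ := h.mfderiv
  rw [h1]
  rfl

theorem mfderiv_comp_snd {g : Y → V} {x : X × Y} (hg : MDifferentiableAt I' 𝓘(ℝ, V) g x.2)
    (v : E × E') : (mfderiv (I.prod I') 𝓘(ℝ, V) (fun y : X × Y => g y.2) x : E × E' →L[ℝ] V) v =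
      (mfderiv I' 𝓘(ℝ, V) g x.2 : E' →L[ℝ] V) v.2 := by
  have h := hg.hasMFDerivAt.comp x (hasMFDerivAt_snd (I := I) (I' := I') x)
  have h1 : mfderiv (I.prod I') 𝓘(ℝ, V) (fun y : X × Y => g y.2) x = _ := h.mfderiv
  rw [h1]
  rfl

end Prod

/-! ### The three types of quadrics -/

/-- For `c > 0`, the positive part of `x` is determined by its direction in a sphere, while the
negative part is arbitrary. -/
theorem isQuadricParam_pos (n l : ℕ) {c : ℝ} (hc : 0 < c) :
    IsQuadricParam ((𝓡 n).prod ((𝓡 l).prod (𝓡 1))) (n + 1) c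
      (fun x : Sph n × EuclideanSpace ℝ (Fin l) × Circle =>
        join (√(c + ‖x.2.1‖ ^ 2) • (x.1 : EuclideanSpace ℝ (Fin (n + 1)))) x.2.1)
      (fun x => x.2.2) := by
  have hpos : ∀ y : EuclideanSpace ℝ (Fin l), 0 < c + ‖y‖ ^ 2 := fun y => by positivity
  have hsm : ContDiff ℝ ∞ fun y : EuclideanSpace ℝ (Fin l) => √(c + ‖y‖ ^ 2) :=
    (contDiff_const.add (contDiff_norm_sq ℝ)).sqrt fun y => (hpos y).ne'
  have hp : ContMDiff ((𝓡 n).prod ((𝓡 l).prod (𝓡 1))) 𝓘(ℝ, Fin (n + 1 + l) → ℝ) ∞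
      (fun x : Sph n × EuclideanSpace ℝ (Fin l) × Circle =>
        join (√(c + ‖x.2.1‖ ^ 2) • (x.1 : EuclideanSpace ℝ (Fin (n + 1)))) x.2.1) := by
    have h1 : ContMDiff ((𝓡 n).prod ((𝓡 l).prod (𝓡 1))) 𝓘(ℝ, EuclideanSpace ℝ (Fin l)) ∞
        (fun x : Sph n × EuclideanSpace ℝ (Fin l) × Circle => x.2.1) :=
      contMDiff_fst.comp contMDiff_snd
    exact contDiff_join.contMDiff.comp (((hsm.contMDiff.comp h1).smul
      ((contMDiff_sph_coe n).comp contMDiff_fst)).prodMk_space h1)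
  have hrec1 : ∀ x : Sph n × EuclideanSpace ℝ (Fin l) × Circle, x.2.1 =
      negPart (join (√(c + ‖x.2.1‖ ^ 2) • (x.1 : EuclideanSpace ℝ (Fin (n + 1)))) x.2.1) :=
    fun x => (negPart_join _ _).symm
  have hrec2 : ∀ x : Sph n × EuclideanSpace ℝ (Fin l) × Circle,
      (x.1 : EuclideanSpace ℝ (Fin (n + 1))) = (fun z : Fin (n + 1 + l) → ℝ =>
        (√(c + ‖negPart z‖ ^ 2))⁻¹ • posPart z)
        (join (√(c + ‖x.2.1‖ ^ 2) • (x.1 : EuclideanSpace ℝ (Fin (n + 1)))) x.2.1) := fun x => by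
    simp only [negPart_join, posPart_join, smul_smul]
    rw [inv_mul_cancel₀ (Real.sqrt_pos.2 (hpos _)).ne', one_smul]
  refine ⟨hp, contMDiff_circle_coe.comp (contMDiff_snd.comp contMDiff_snd), fun x => ?_,
    fun x h => ?_, fun x v hv1 hv2 => ?_, fun x y h1 h2 => ?_, fun y z hy hy0 => ?_, ?_⟩
  · rw [quad_join, norm_smul, mul_pow, Real.norm_eq_abs, sq_abs, Real.sq_sqrt (hpos _).le,
      norm_eq_of_mem_sphere]
    ring
  · have h1 := congrArg (quad (n + 1)) h
    rw [quad_join, norm_smul, mul_pow, Real.norm_eq_abs, sq_abs, Real.sq_sqrt (hpos _).le,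
      norm_eq_of_mem_sphere] at h1
    simp [quad] at h1
    exact hc.ne' h1
  · have hpd := (hp x).mdifferentiableAt (by simp)
    have e1 := mfderiv_eq_zero_of_comp hrec1 (contDiff_negPart.differentiable (by simp) _) hpd hv1
    have e2 := mfderiv_eq_zero_of_comp (h := fun z : Fin (n + 1 + l) → ℝ =>
      (√(c + ‖negPart z‖ ^ 2))⁻¹ • posPart z) hrec2 ((((hsm.comp contDiff_negPart).inv
      fun z => (Real.sqrt_pos.2 (hpos _)).ne').smul contDiff_posPart).differentiable
        (by simp) _) hpd hv1
    rw [mfderiv_comp_fst (g := fun x : Sph n => (x : EuclideanSpace ℝ (Fin (n + 1))))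
      ((contMDiff_sph_coe n _).mdifferentiableAt (by simp))] at e2
    rw [mfderiv_comp_snd (g := fun y : EuclideanSpace ℝ (Fin l) × Circle => y.1)
      mdifferentiableAt_fst, mfderiv_fst] at e1
    rw [mfderiv_comp_snd (g := fun y : EuclideanSpace ℝ (Fin l) × Circle => (y.2 : ℂ))
      (((contMDiff_circle_coe _).comp _ contMDiffAt_snd).mdifferentiableAt (by simp)),
      mfderiv_comp_snd (g := fun y : Circle => (y : ℂ))
      ((contMDiff_circle_coe _).mdifferentiableAt (by simp))] at hv2
    have f1 : v.1 = 0 := mfderiv_sph_coe_injective n _ (e2.trans (map_zero _).symm)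
    have f2 : v.2.2 = 0 := mfderiv_circle_coe_injective _ (hv2.trans (map_zero _).symm)
    exact Prod.ext f1 (Prod.ext e1 f2)
  · refine Prod.ext (Subtype.ext ?_) (Prod.ext ?_ h2)
    · rw [hrec2 x, hrec2 y, h1]
    · rw [hrec1 x, hrec1 y, h1]
  · rw [quad_eq_norm_sub] at hy
    have h1 : ‖posPart y‖ = √(c + ‖negPart y‖ ^ 2) := by
      rw [← hy, sub_add_cancel, Real.sqrt_sq (norm_nonneg _)]
    have h2 := (Real.sqrt_pos.2 (hpos (negPart y))).ne'
    refine ⟨(⟨(√(c + ‖negPart y‖ ^ 2))⁻¹ • posPart y, ?_⟩, negPart y, z), ?_, rfl⟩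
    · rw [mem_sphere_zero_iff_norm, norm_smul, h1, norm_inv, Real.norm_eq_abs,
        abs_of_nonneg (Real.sqrt_nonneg _), inv_mul_cancel₀ h2]
    · simp only [smul_smul, mul_inv_cancel₀ h2, one_smul, join_posPart_negPart]
  · have h1 := (dense_sphere_ne_zero n).prod
      ((dense_euclidean_ne_zero l).prod (dense_univ (X := Circle)))
    refine h1.mono ?_
    rintro x ⟨hx1, hx2, -⟩
    refine (join_ne_zero_iff _ _).2 ⟨fun i => ?_, hx2⟩
    exact mul_ne_zero (Real.sqrt_pos.2 (hpos _)).ne' (hx1 i)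

/-- For `c < 0`, the negative part of `x` is determined by its direction in a sphere, while the
positive part is arbitrary. -/
theorem isQuadricParam_neg (k n : ℕ) {c : ℝ} (hc : c < 0) :
    IsQuadricParam ((𝓡 k).prod ((𝓡 n).prod (𝓡 1))) k c
      (fun x : EuclideanSpace ℝ (Fin k) × Sph n × Circle =>
        join x.1 (√(-c + ‖x.1‖ ^ 2) • (x.2.1 : EuclideanSpace ℝ (Fin (n + 1)))))
      (fun x => x.2.2) := by
  have hpos : ∀ y : EuclideanSpace ℝ (Fin k), 0 < -c + ‖y‖ ^ 2 := fun y => by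
    have := neg_pos.2 hc
    positivity
  have hsm : ContDiff ℝ ∞ fun y : EuclideanSpace ℝ (Fin k) => √(-c + ‖y‖ ^ 2) :=
    (contDiff_const.add (contDiff_norm_sq ℝ)).sqrt fun y => (hpos y).ne'
  have hp : ContMDiff ((𝓡 k).prod ((𝓡 n).prod (𝓡 1))) 𝓘(ℝ, Fin (k + (n + 1)) → ℝ) ∞
      (fun x : EuclideanSpace ℝ (Fin k) × Sph n × Circle =>
        join x.1 (√(-c + ‖x.1‖ ^ 2) • (x.2.1 : EuclideanSpace ℝ (Fin (n + 1))))) := by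
    have h1 : ContMDiff ((𝓡 k).prod ((𝓡 n).prod (𝓡 1))) 𝓘(ℝ, EuclideanSpace ℝ (Fin k)) ∞
        (fun x : EuclideanSpace ℝ (Fin k) × Sph n × Circle => x.1) := contMDiff_fst
    exact contDiff_join.contMDiff.comp (h1.prodMk_space ((hsm.contMDiff.comp h1).smul
      ((contMDiff_sph_coe n).comp (contMDiff_fst.comp contMDiff_snd))))
  have hrec1 : ∀ x : EuclideanSpace ℝ (Fin k) × Sph n × Circle, x.1 =
      posPart (join x.1 (√(-c + ‖x.1‖ ^ 2) • (x.2.1 : EuclideanSpace ℝ (Fin (n + 1))))) :=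
    fun x => (posPart_join _ _).symm
  have hrec2 : ∀ x : EuclideanSpace ℝ (Fin k) × Sph n × Circle,
      (x.2.1 : EuclideanSpace ℝ (Fin (n + 1))) = (fun z : Fin (k + (n + 1)) → ℝ =>
        (√(-c + ‖posPart z‖ ^ 2))⁻¹ • negPart z)
        (join x.1 (√(-c + ‖x.1‖ ^ 2) • (x.2.1 : EuclideanSpace ℝ (Fin (n + 1))))) := fun x => by
    simp only [negPart_join, posPart_join, smul_smul]
    rw [inv_mul_cancel₀ (Real.sqrt_pos.2 (hpos _)).ne', one_smul]
  refine ⟨hp, contMDiff_circle_coe.comp (contMDiff_snd.comp contMDiff_snd), fun x => ?_,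
    fun x h => ?_, fun x v hv1 hv2 => ?_, fun x y h1 h2 => ?_, fun y z hy hy0 => ?_, ?_⟩
  · rw [quad_join, norm_smul, mul_pow, Real.norm_eq_abs, sq_abs, Real.sq_sqrt (hpos _).le,
      norm_eq_of_mem_sphere]
    ring
  · have h1 := congrArg (quad k) h
    rw [quad_join, norm_smul, mul_pow, Real.norm_eq_abs, sq_abs, Real.sq_sqrt (hpos _).le,
      norm_eq_of_mem_sphere] at h1
    simp [quad] at h1
    exact hc.ne h1
  · have hpd := (hp x).mdifferentiableAt (by simp)
    have e1 := mfderiv_eq_zero_of_comp hrec1 (contDiff_posPart.differentiable (by simp) _) hpd hv1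
    have e2 := mfderiv_eq_zero_of_comp (h := fun z : Fin (k + (n + 1)) → ℝ =>
      (√(-c + ‖posPart z‖ ^ 2))⁻¹ • negPart z) hrec2 ((((hsm.comp contDiff_posPart).inv
      fun z => (Real.sqrt_pos.2 (hpos _)).ne').smul contDiff_negPart).differentiable
        (by simp) _) hpd hv1
    rw [mfderiv_comp_snd (g := fun y : Sph n × Circle =>
        (y.1 : EuclideanSpace ℝ (Fin (n + 1))))
      (((contMDiff_sph_coe n _).comp _ contMDiffAt_fst).mdifferentiableAt (by simp)),
      mfderiv_comp_fst (g := fun x : Sph n => (x : EuclideanSpace ℝ (Fin (n + 1))))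
      ((contMDiff_sph_coe n _).mdifferentiableAt (by simp))] at e2
    rw [mfderiv_fst] at e1
    rw [mfderiv_comp_snd (g := fun y : Sph n × Circle => (y.2 : ℂ))
      (((contMDiff_circle_coe _).comp _ contMDiffAt_snd).mdifferentiableAt (by simp)),
      mfderiv_comp_snd (g := fun y : Circle => (y : ℂ))
      ((contMDiff_circle_coe _).mdifferentiableAt (by simp))] at hv2
    have f1 : v.2.1 = 0 := mfderiv_sph_coe_injective n _ (e2.trans (map_zero _).symm)
    have f2 : v.2.2 = 0 := mfderiv_circle_coe_injective _ (hv2.trans (map_zero _).symm)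
    exact Prod.ext e1 (Prod.ext f1 f2)
  · refine Prod.ext ?_ (Prod.ext (Subtype.ext ?_) h2)
    · rw [hrec1 x, hrec1 y, h1]
    · rw [hrec2 x, hrec2 y, h1]
  · rw [quad_eq_norm_sub] at hy
    have h1 : ‖negPart y‖ = √(-c + ‖posPart y‖ ^ 2) := by
      rw [← hy, neg_sub, sub_add_cancel, Real.sqrt_sq (norm_nonneg _)]
    have h2 := (Real.sqrt_pos.2 (hpos (posPart y))).ne'
    refine ⟨(posPart y, ⟨(√(-c + ‖posPart y‖ ^ 2))⁻¹ • negPart y, ?_⟩, z), ?_, rfl⟩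
    · rw [mem_sphere_zero_iff_norm, norm_smul, h1, norm_inv, Real.norm_eq_abs,
        abs_of_nonneg (Real.sqrt_nonneg _), inv_mul_cancel₀ h2]
    · simp only [smul_smul, mul_inv_cancel₀ h2, one_smul, join_posPart_negPart]
  · have h1 := (dense_euclidean_ne_zero k).prod
      ((dense_sphere_ne_zero n).prod (dense_univ (X := Circle)))
    refine h1.mono ?_
    rintro x ⟨hx1, hx2, -⟩
    refine (join_ne_zero_iff _ _).2 ⟨hx1, fun i => ?_⟩
    exact mul_ne_zero (Real.sqrt_pos.2 (hpos _)).ne' (hx2 i)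

/-- For `c = 0`, both parts of `x` have the same length `e^s`, and arbitrary directions. -/
theorem isQuadricParam_zero (k n : ℕ) :
    IsQuadricParam (((𝓡 k).prod ((𝓡 n).prod (𝓡 1))).prod 𝓘(ℝ, ℝ)) (k + 1) 0
      (fun x : (Sph k × Sph n × Circle) × ℝ =>
        join (Real.exp x.2 • (x.1.1 : EuclideanSpace ℝ (Fin (k + 1))))
          (Real.exp x.2 • (x.1.2.1 : EuclideanSpace ℝ (Fin (n + 1)))))
      (fun x => x.1.2.2) := by
  set p : (Sph k × Sph n × Circle) × ℝ → Fin (k + 1 + (n + 1)) → ℝ := fun x =>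
    join (Real.exp x.2 • (x.1.1 : EuclideanSpace ℝ (Fin (k + 1))))
      (Real.exp x.2 • (x.1.2.1 : EuclideanSpace ℝ (Fin (n + 1)))) with hpdef
  have hp : ContMDiff (((𝓡 k).prod ((𝓡 n).prod (𝓡 1))).prod 𝓘(ℝ, ℝ))
      𝓘(ℝ, Fin (k + 1 + (n + 1)) → ℝ) ∞ p := by
    have h1 : ContMDiff (((𝓡 k).prod ((𝓡 n).prod (𝓡 1))).prod 𝓘(ℝ, ℝ)) 𝓘(ℝ, ℝ) ∞
        (fun x : (Sph k × Sph n × Circle) × ℝ => Real.exp x.2) :=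
      Real.contDiff_exp.contMDiff.comp contMDiff_snd
    exact contDiff_join.contMDiff.comp ((h1.smul
      ((contMDiff_sph_coe k).comp (contMDiff_fst.comp contMDiff_fst))).prodMk_space (h1.smul
      ((contMDiff_sph_coe n).comp (contMDiff_fst.comp (contMDiff_snd.comp contMDiff_fst)))))
  have hn1 : ∀ x, ‖posPart (p x)‖ = Real.exp x.2 := fun x => by
    rw [hpdef, posPart_join, norm_smul, norm_eq_of_mem_sphere, mul_one, Real.norm_eq_abs,
      Real.abs_exp]
  have hn2 : ∀ x, ‖negPart (p x)‖ = Real.exp x.2 := fun x => by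
    rw [hpdef, negPart_join, norm_smul, norm_eq_of_mem_sphere, mul_one, Real.norm_eq_abs,
      Real.abs_exp]
  have hne1 : ∀ x, posPart (p x) ≠ 0 := fun x => by
    rw [← norm_pos_iff, hn1]; exact Real.exp_pos _
  have hrec0 : ∀ x, x.2 = (fun z => Real.log ‖posPart z‖) (p x) := fun x => by
    simp only [hn1, Real.log_exp]
  have hrec1 : ∀ x, (x.1.1 : EuclideanSpace ℝ (Fin (k + 1))) =
      (fun z => ‖posPart z‖⁻¹ • posPart z) (p x) := fun x => by
    simp only [hn1]
    simp only [hpdef, posPart_join, smul_smul]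
    rw [inv_mul_cancel₀ (Real.exp_pos _).ne', one_smul]
  have hrec2 : ∀ x, (x.1.2.1 : EuclideanSpace ℝ (Fin (n + 1))) =
      (fun z => ‖posPart z‖⁻¹ • negPart z) (p x) := fun x => by
    simp only [hn1]
    simp only [hpdef, negPart_join, smul_smul]
    rw [inv_mul_cancel₀ (Real.exp_pos _).ne', one_smul]
  refine ⟨hp, contMDiff_circle_coe.comp (contMDiff_snd.comp (contMDiff_snd.comp contMDiff_fst)),
    fun x => ?_, fun x h => ?_, fun x v hv1 hv2 => ?_, fun x y h1 h2 => ?_,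
    fun y z hy hy0 => ?_, ?_⟩
  · rw [quad_eq_norm_sub, hn1, hn2, sub_self]
  · refine hne1 x ?_
    rw [h]
    rfl
  · have hpd := (hp x).mdifferentiableAt (by simp)
    have hnorm : DifferentiableAt ℝ (fun z : Fin (k + 1 + (n + 1)) → ℝ => ‖posPart z‖) (p x) :=
      (contDiff_posPart.differentiable (by simp) _).norm ℝ (hne1 x)
    have hn0 : ‖posPart (p x)‖ ≠ 0 := norm_ne_zero_iff.2 (hne1 x)
    have e0 := mfderiv_eq_zero_of_comp (p := p) (h := fun z => Real.log ‖posPart z‖) hrec0 (hnorm.log hn0) hpd hv1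
    have e1 := mfderiv_eq_zero_of_comp (p := p) (h := fun z => ‖posPart z‖⁻¹ • posPart z) hrec1
      ((hnorm.inv hn0).smul (contDiff_posPart.differentiable (by simp) _)) hpd hv1
    have e2 := mfderiv_eq_zero_of_comp (p := p) (h := fun z => ‖posPart z‖⁻¹ • negPart z) hrec2
      ((hnorm.inv hn0).smul (contDiff_negPart.differentiable (by simp) _)) hpd hv1
    rw [mfderiv_snd] at e0
    rw [mfderiv_comp_fst (g := fun y : Sph k × Sph n × Circle =>
        (y.1 : EuclideanSpace ℝ (Fin (k + 1))))
      (((contMDiff_sph_coe k _).comp _ contMDiffAt_fst).mdifferentiableAt (by simp)),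
      mfderiv_comp_fst (g := fun x : Sph k => (x : EuclideanSpace ℝ (Fin (k + 1))))
      ((contMDiff_sph_coe k _).mdifferentiableAt (by simp))] at e1
    rw [mfderiv_comp_fst (g := fun y : Sph k × Sph n × Circle =>
        (y.2.1 : EuclideanSpace ℝ (Fin (n + 1))))
      (((contMDiff_sph_coe n _).comp _
        (contMDiffAt_fst.comp _ contMDiffAt_snd)).mdifferentiableAt (by simp)),
      mfderiv_comp_snd (g := fun y : Sph n × Circle =>
        (y.1 : EuclideanSpace ℝ (Fin (n + 1))))
      (((contMDiff_sph_coe n _).comp _ contMDiffAt_fst).mdifferentiableAt (by simp)),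
      mfderiv_comp_fst (g := fun x : Sph n => (x : EuclideanSpace ℝ (Fin (n + 1))))
      ((contMDiff_sph_coe n _).mdifferentiableAt (by simp))] at e2
    rw [mfderiv_comp_fst (g := fun y : Sph k × Sph n × Circle => (y.2.2 : ℂ))
      (((contMDiff_circle_coe _).comp _
        (contMDiffAt_snd.comp _ contMDiffAt_snd)).mdifferentiableAt (by simp)),
      mfderiv_comp_snd (g := fun y : Sph n × Circle => (y.2 : ℂ))
      (((contMDiff_circle_coe _).comp _ contMDiffAt_snd).mdifferentiableAt (by simp)),
      mfderiv_comp_snd (g := fun y : Circle => (y : ℂ))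
      ((contMDiff_circle_coe _).mdifferentiableAt (by simp))] at hv2
    have f1 : v.1.1 = 0 := mfderiv_sph_coe_injective k _ (e1.trans (map_zero _).symm)
    have f2 : v.1.2.1 = 0 := mfderiv_sph_coe_injective n _ (e2.trans (map_zero _).symm)
    have f3 : v.1.2.2 = 0 := mfderiv_circle_coe_injective _ (hv2.trans (map_zero _).symm)
    exact Prod.ext (Prod.ext f1 (Prod.ext f2 f3)) e0
  · refine Prod.ext (Prod.ext (Subtype.ext ?_) (Prod.ext (Subtype.ext ?_) h2)) ?_
    · rw [hrec1 x, hrec1 y, h1]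
    · rw [hrec2 x, hrec2 y, h1]
    · rw [hrec0 x, hrec0 y, h1]
  · rw [quad_eq_norm_sub] at hy
    have h1 : ‖negPart y‖ = ‖posPart y‖ := by
      rw [← sq_eq_sq₀ (norm_nonneg _) (norm_nonneg _)]
      linarith
    have h2 : 0 < ‖posPart y‖ := by
      rw [norm_pos_iff]
      intro h
      refine hy0 ?_
      have h' : negPart y = 0 := by rw [← norm_eq_zero, h1, h, norm_zero]
      rw [← join_posPart_negPart y, h, h']
      funext j
      refine Fin.addCases (fun i => ?_) (fun i => ?_) j <;> simp
    refine ⟨((⟨‖posPart y‖⁻¹ • posPart y, ?_⟩, ⟨‖posPart y‖⁻¹ • negPart y, ?_⟩, z),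
      Real.log ‖posPart y‖), ?_, rfl⟩
    · rw [mem_sphere_zero_iff_norm, norm_smul, norm_inv, norm_norm, inv_mul_cancel₀ h2.ne']
    · rw [mem_sphere_zero_iff_norm, norm_smul, norm_inv, norm_norm, h1, inv_mul_cancel₀ h2.ne']
    · simp only [hpdef, Real.exp_log h2, smul_smul, mul_inv_cancel₀ h2.ne', one_smul,
        join_posPart_negPart]
  · have h1 := ((dense_sphere_ne_zero k).prod
      ((dense_sphere_ne_zero n).prod (dense_univ (X := Circle)))).prod (dense_univ (X := ℝ))
    refine h1.mono ?_
    rintro x ⟨⟨hx1, hx2, -⟩, -⟩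
    refine (join_ne_zero_iff _ _).2 ⟨fun i => ?_, fun i => ?_⟩
    · exact mul_ne_zero (Real.exp_pos _).ne' (hx1 i)
    · exact mul_ne_zero (Real.exp_pos _).ne' (hx2 i)

/-! ### Periodic families -/

namespace CaseDEvolution

theorem isGenericallyInjectiveMod_sweep {m a : ℕ} (D : CaseDEvolution m a) {E H X : Type}
    [NormedAddCommGroup E] [NormedSpace ℝ E] [TopologicalSpace H] {I : ModelWithCorners ℝ E H}
    [TopologicalSpace X] [ChartedSpace H X] (hm : 0 < m)
    {S : ℝ} (hS : 0 < S) {σ : Fin m → ℝ} (hσ : ∀ j, σ j * σ j = 1)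
    (hper : ∀ j t, D.w j (t + S) = σ j * D.w j t)
    (hgen : ∀ t s, D.u t = D.u s → (∀ j, ∃ l : ℤ, D.θ j t - D.θ j s = l * Real.pi) →
      ∃ k : ℤ, t - s = k * S)
    {c : ℝ} {p : X → Fin m → ℝ} {q : X → Circle} (h : IsQuadricParam I a c p q) {τ : X → X}
    (hp : ∀ x, p (τ x) = fun j => σ j * p x j) (hq : ∀ x, q (τ x) = -q x) :
    IsGenericallyInjectiveMod τ (D.sweep S p q) := by
  refine ⟨fun x => D.sweep_involution hS hσ hper (hp x) (hq x), h.dense.mono fun x hx y hxy => ?_⟩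
  rcases D.eq_or_eq_of_sweep_eq hm hS hσ hper hgen h.quad_eq hx hxy with ⟨h1, h2⟩ | ⟨h1, h2⟩
  · exact Or.inl (h.inj _ _ h1 h2)
  · exact Or.inr (h.inj _ _ (h1.trans (hp x).symm) (h2.trans (hq x).symm))

/-- A quadric at a level `c ≠ 0` with bounded parameters over bounded sets sweeps out a closed
immersed submanifold, provided that every diagonal sign change lifts to a free involution covering
the half turn of the circle. -/
theorem isClosedImmersedSL_of_param {m a : ℕ} (D : CaseDEvolution m a) {E H X : Type}
    [NormedAddCommGroup E] [NormedSpace ℝ E] [TopologicalSpace H] {I : ModelWithCorners ℝ E H}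
    [TopologicalSpace X] [ChartedSpace H X] (hm : 3 ≤ m) (ha : 1 ≤ a) (ham : a < m)
    {β : Fin m → ℝ} (hβ : D.IsPeriodicWithPhases β) (hdim : Module.finrank ℝ E = m)
    {c : ℝ} (hc : c ≠ 0) {p : X → Fin m → ℝ} {q : X → Circle} (h : IsQuadricParam I a c p q)
    (hq : Continuous q)
    (hK : ∀ R : ℝ, ∃ K : Set X, IsCompact K ∧ {x | ‖p x‖ ≤ R} ⊆ K)
    (hτ : ∀ σ : Fin m → ℝ, (∀ j, σ j * σ j = 1) → ∃ τ : X → X, IsFreeInvolution I τ ∧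
      ∀ x, (p (τ x) = fun j => σ j * p x j) ∧ q (τ x) = -q x) :
    IsClosedImmersedSL I X (D.N c) := by
  obtain ⟨S, σ, hS, hσ, hper, hgen⟩ := D.exists_signPeriod ha ham hβ
  obtain ⟨τ, hτ1, hτ2⟩ := hτ σ hσ
  refine ⟨D.isClosed_N hS hσ hper c, D.sweep S p q,
    D.isSLImmersion_sweep (by omega) hdim hS hσ hper h,
    D.isProperMap_sweep hσ hper h.contMDiff_fst.continuous hq hK, ?_, Or.inr ⟨τ, hτ1,
      D.isGenericallyInjectiveMod_sweep (by omega) hS hσ hper hgen h (fun x => (hτ2 x).1)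
        fun x => (hτ2 x).2⟩⟩
  rw [D.range_sweep hS hσ hper h.quad_eq h.ne_zero h.surj,
    Set.sdiff_singleton_eq_self (D.zero_notMem_N hc)]

theorem isClosedImmersedSL_pos {n l : ℕ} (D : CaseDEvolution (n + 1 + l) (n + 1))
    (hm : 3 ≤ n + 1 + l) (hl : 1 ≤ l) {β : Fin (n + 1 + l) → ℝ} (hβ : D.IsPeriodicWithPhases β)
    {c : ℝ} (hc : 0 < c) :
    IsClosedImmersedSL ((𝓡 n).prod ((𝓡 l).prod (𝓡 1)))
      (Sph n × EuclideanSpace ℝ (Fin l) × Circle) (D.N c) := by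
  refine D.isClosedImmersedSL_of_param hm (by omega) (by omega) hβ ?_ hc.ne'
    (isQuadricParam_pos n l hc) (continuous_snd.comp continuous_snd) (fun R => ?_)
    fun σ hσ => ?_
  · simp only [Module.finrank_prod, finrank_euclideanSpace_fin]
    omega
  · refine ⟨Set.univ ×ˢ (Metric.closedBall 0 (√l * R) ×ˢ Set.univ),
      isCompact_univ.prod ((isCompact_closedBall _ _).prod isCompact_univ), fun x hx => ?_⟩
    refine ⟨Set.mem_univ _, ?_, Set.mem_univ _⟩
    rw [mem_closedBall_zero_iff]
    have h1 := norm_negPart_le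
      (join (√(c + ‖x.2.1‖ ^ 2) • (x.1 : EuclideanSpace ℝ (Fin (n + 1)))) x.2.1)
    rw [negPart_join] at h1
    exact h1.trans (mul_le_mul_of_nonneg_left hx (Real.sqrt_nonneg _))
  · have hσ1 : ∀ i, σ (Fin.castAdd l i) * σ (Fin.castAdd l i) = 1 := fun i => hσ _
    have hσ2 : ∀ i, σ (Fin.natAdd (n + 1) i) * σ (Fin.natAdd (n + 1) i) = 1 := fun i => hσ _
    refine ⟨Prod.map (signSph _ hσ1) (Prod.map (signMap fun i => σ (Fin.natAdd (n + 1) i))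
      fun z => -z), ⟨(contMDiff_signSph hσ1).prodMap
        ((signMap _).contDiff.contMDiff.prodMap contMDiff_circle_neg), fun x => ?_, fun x hx => ?_⟩,
      fun x => ⟨?_, rfl⟩⟩
    · simp only [Prod.map_apply', signSph_signSph, signMap_signMap hσ2,
        neg_neg]
    · exact Circle.neg_ne_self _ (congrArg (fun y => y.2.2) hx)
    · rw [← join_signMap]
      simp only [Prod.map_fst, Prod.map_snd, coe_signSph, norm_signMap hσ2, map_smul]

theorem isClosedImmersedSL_neg {k n : ℕ} (D : CaseDEvolution (k + (n + 1)) k)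
    (hm : 3 ≤ k + (n + 1)) (hk : 1 ≤ k) {β : Fin (k + (n + 1)) → ℝ}
    (hβ : D.IsPeriodicWithPhases β) {c : ℝ} (hc : c < 0) :
    IsClosedImmersedSL ((𝓡 k).prod ((𝓡 n).prod (𝓡 1)))
      (EuclideanSpace ℝ (Fin k) × Sph n × Circle) (D.N c) := by
  refine D.isClosedImmersedSL_of_param hm (by omega) (by omega) hβ ?_ hc.ne
    (isQuadricParam_neg k n hc) (continuous_snd.comp continuous_snd) (fun R => ?_)
    fun σ hσ => ?_
  · simp only [Module.finrank_prod, finrank_euclideanSpace_fin]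
  · refine ⟨Metric.closedBall 0 (√k * R) ×ˢ (Set.univ ×ˢ Set.univ),
      (isCompact_closedBall _ _).prod (isCompact_univ.prod isCompact_univ), fun x hx => ?_⟩
    refine ⟨?_, Set.mem_univ _, Set.mem_univ _⟩
    rw [mem_closedBall_zero_iff]
    have h1 := norm_posPart_le
      (join x.1 (√(-c + ‖x.1‖ ^ 2) • (x.2.1 : EuclideanSpace ℝ (Fin (n + 1)))))
    rw [posPart_join] at h1
    exact h1.trans (mul_le_mul_of_nonneg_left hx (Real.sqrt_nonneg _))
  · have hσ1 : ∀ i, σ (Fin.castAdd (n + 1) i) * σ (Fin.castAdd (n + 1) i) = 1 := fun i => hσ _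
    have hσ2 : ∀ i, σ (Fin.natAdd k i) * σ (Fin.natAdd k i) = 1 := fun i => hσ _
    refine ⟨Prod.map (signMap fun i => σ (Fin.castAdd (n + 1) i)) (Prod.map (signSph _ hσ2)
      fun z => -z), ⟨(signMap _).contDiff.contMDiff.prodMap
        ((contMDiff_signSph hσ2).prodMap contMDiff_circle_neg), fun x => ?_, fun x hx => ?_⟩,
      fun x => ⟨?_, rfl⟩⟩
    · simp only [Prod.map_apply', signSph_signSph, signMap_signMap hσ1,
        neg_neg]
    · exact Circle.neg_ne_self _ (congrArg (fun y => y.2.2) hx)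
    · rw [← join_signMap]
      simp only [Prod.map_fst, Prod.map_snd, coe_signSph, norm_signMap hσ1, map_smul]

theorem isClosedImmersedSLCone_zero {k n : ℕ} (D : CaseDEvolution (k + 1 + (n + 1)) (k + 1))
    (hm : 3 ≤ k + 1 + (n + 1)) {β : Fin (k + 1 + (n + 1)) → ℝ}
    (hβ : D.IsPeriodicWithPhases β) :
    IsClosedImmersedSLCone ((𝓡 k).prod ((𝓡 n).prod (𝓡 1)))
      (Sph k × Sph n × Circle) (D.N 0) := by
  obtain ⟨S, σ, hS, hσ, hper, hgen⟩ := D.exists_signPeriod (by omega) (by omega) hβ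
  have hclosed := D.isClosed_N hS hσ hper 0
  have hpar := isQuadricParam_zero k n
  set p : (Sph k × Sph n × Circle) × ℝ → Fin (k + 1 + (n + 1)) → ℝ := fun x =>
    join (Real.exp x.2 • (x.1.1 : EuclideanSpace ℝ (Fin (k + 1))))
      (Real.exp x.2 • (x.1.2.1 : EuclideanSpace ℝ (Fin (n + 1)))) with hpdef
  set q : (Sph k × Sph n × Circle) × ℝ → Circle := fun x => x.1.2.2 with hqdef
  let g : Sph k × Sph n × Circle → Cm (k + 1 + (n + 1)) := fun x =>
    D.point (join (x.1 : EuclideanSpace ℝ (Fin (k + 1)))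
      (x.2.1 : EuclideanSpace ℝ (Fin (n + 1)))) (angleTime S x.2.2)
  have hg : coneMap g = D.sweep S p q := by
    funext x
    refine PiLp.ext fun j => ?_
    have h1 : p x j = Real.exp x.2 * join (x.1.1 : EuclideanSpace ℝ (Fin (k + 1)))
        (x.1.2.1 : EuclideanSpace ℝ (Fin (n + 1))) j := by
      refine Fin.addCases (fun i => ?_) (fun i => ?_) j <;> simp [hpdef]
    simp only [coneMap, sweep, PiLp.smul_apply, g, point_apply, h1, hqdef]
    rw [Complex.real_smul]
    push_cast
    ring
  refine ⟨hclosed, fun r _ z hz => D.smul_mem_N_zero hz r,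
    D.isSingularAtZero_N_zero hm (by omega) (by omega) hclosed, g, ?_, ?_, Or.inr ?_⟩
  · rw [hg]
    refine D.isSLImmersion_sweep (by omega) ?_ hS hσ hper hpar
    simp only [Module.finrank_prod, finrank_euclideanSpace_fin, Module.finrank_self]
    omega
  · rw [hg, D.range_sweep hS hσ hper hpar.quad_eq hpar.ne_zero hpar.surj]
  · have hσ1 : ∀ i, σ (Fin.castAdd (n + 1) i) * σ (Fin.castAdd (n + 1) i) = 1 := fun i => hσ _
    have hσ2 : ∀ i, σ (Fin.natAdd (k + 1) i) * σ (Fin.natAdd (k + 1) i) = 1 := fun i => hσ _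
    refine ⟨Prod.map (signSph _ hσ1) (Prod.map (signSph _ hσ2) fun z => -z),
      ⟨(contMDiff_signSph hσ1).prodMap ((contMDiff_signSph hσ2).prodMap contMDiff_circle_neg),
        fun x => ?_, fun x hx => ?_⟩, ?_⟩
    · simp only [Prod.map_apply', signSph_signSph, neg_neg]
    · exact Circle.neg_ne_self _ (congrArg (fun y => y.2.2) hx)
    · rw [hg]
      refine D.isGenericallyInjectiveMod_sweep (by omega) hS hσ hper hgen hpar (fun x => ?_)
        fun x => rfl
      simp only [hpdef]
      rw [← join_signMap]
      simp only [Prod.map_fst, Prod.map_snd, coe_signSph, map_smul, id]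

end CaseDEvolution

/-! ### The profile of a symmetric evolution -/

/-- The polynomial `Q` for `α_j = a` (`j ≤ a`) and `α_j = b` (`j > a`), where `m = a + b`. -/
def prof (a b : ℕ) (u : ℝ) : ℝ := (a + u) ^ a * (b - u) ^ b

/-- The symmetric parameters `α_j = a` for `j ≤ a` and `α_j = b` for `j > a`. -/
def symAlpha (a b : ℕ) : Fin (a + b) → ℝ := Fin.append (fun _ => (a : ℝ)) fun _ => (b : ℝ)

@[simp] theorem symAlpha_castAdd (a b : ℕ) (i : Fin a) : symAlpha a b (Fin.castAdd b i) = a :=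
  Fin.append_left _ _ i

@[simp] theorem symAlpha_natAdd (a b : ℕ) (i : Fin b) : symAlpha a b (Fin.natAdd a i) = b :=
  Fin.append_right _ _ i

theorem Qpoly_symAlpha (a b : ℕ) (u : ℝ) : Qpoly a (symAlpha a b) u = prof a b u := by
  rw [Qpoly, Fin.prod_univ_add, prof]
  simp [sgn_castAdd, sgn_natAdd, sub_eq_add_neg]

theorem forall_symAlpha_pos_iff {a b : ℕ} (ha : 1 ≤ a) (hb : 1 ≤ b) {u : ℝ} :
    (∀ j, 0 < symAlpha a b j + sgn a j * u) ↔ u ∈ Set.Ioo (-(a : ℝ)) b := by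
  constructor
  · intro h
    have h1 := h (Fin.castAdd b ⟨0, ha⟩)
    have h2 := h (Fin.natAdd a ⟨0, hb⟩)
    rw [symAlpha_castAdd, sgn_castAdd] at h1
    rw [symAlpha_natAdd, sgn_natAdd] at h2
    exact ⟨by linarith, by linarith⟩
  · rintro ⟨h1, h2⟩ j
    refine Fin.addCases (fun i => ?_) (fun i => ?_) j
    · rw [symAlpha_castAdd, sgn_castAdd]; linarith
    · rw [symAlpha_natAdd, sgn_natAdd]; linarith

section Profile

variable {a b : ℕ}

theorem prof_pos {u : ℝ} (hu : u ∈ Set.Ioo (-(a : ℝ)) b) : 0 < prof a b u :=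
  mul_pos (pow_pos (by linarith [hu.1]) _) (pow_pos (by linarith [hu.2]) _)

theorem zero_mem_Ioo (ha : 1 ≤ a) (hb : 1 ≤ b) : (0 : ℝ) ∈ Set.Ioo (-(a : ℝ)) b := by
  have h1 : (1 : ℝ) ≤ a := by exact_mod_cast ha
  have h2 : (1 : ℝ) ≤ b := by exact_mod_cast hb
  exact ⟨by linarith, by linarith⟩

theorem hasDerivAt_prof (ha : 1 ≤ a) (hb : 1 ≤ b) {u : ℝ} (hu : u ∈ Set.Ioo (-(a : ℝ)) b) :
    HasDerivAt (prof a b) (prof a b u * (a / (a + u) - b / (b - u))) u := by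
  have h := hasDerivAt_Qpoly (a := a) (symAlpha a b) ((forall_symAlpha_pos_iff ha hb).2 hu)
  rw [funext (Qpoly_symAlpha a b)] at h
  refine h.congr_deriv ?_
  rw [Fin.sum_univ_add]
  simp [sgn_castAdd, sgn_natAdd, sub_eq_add_neg, div_eq_mul_inv]

theorem sub_div_eq {u : ℝ} (hu : u ∈ Set.Ioo (-(a : ℝ)) b) :
    (a : ℝ) / (a + u) - b / (b - u) = -u * ((a + b) / ((a + u) * (b - u))) := by
  have h1 : (a : ℝ) + u ≠ 0 := by linarith [hu.1]
  have h2 : (b : ℝ) - u ≠ 0 := by linarith [hu.2]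
  field_simp
  ring

/-- The function `Q` has its unique maximum at `0`, by `1 + x < e^x`. -/
theorem prof_lt (ha : 1 ≤ a) (hb : 1 ≤ b) {u : ℝ} (hu : u ∈ Set.Ioo (-(a : ℝ)) b) (h0 : u ≠ 0) :
    prof a b u < prof a b 0 := by
  have ha' : (0 : ℝ) < a := by exact_mod_cast ha
  have hb' : (0 : ℝ) < b := by exact_mod_cast hb
  have h1 : (a : ℝ) + u < a * Real.exp (u / a) := by
    have := Real.add_one_lt_exp (x := u / a) (by positivity)
    calc (a : ℝ) + u = a * (u / a + 1) := by field_simp; ring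
      _ < _ := by gcongr
  have h2 : (b : ℝ) - u < b * Real.exp (-u / b) := by
    have := Real.add_one_lt_exp (x := -u / b) (div_ne_zero (neg_ne_zero.2 h0) hb'.ne')
    calc (b : ℝ) - u = b * (-u / b + 1) := by field_simp; ring
      _ < _ := by gcongr
  have h3 : ((a : ℝ) + u) ^ a < (a * Real.exp (u / a)) ^ a :=
    pow_lt_pow_left₀ h1 (by linarith [hu.1]) (by omega)
  have h4 : ((b : ℝ) - u) ^ b < (b * Real.exp (-u / b)) ^ b :=
    pow_lt_pow_left₀ h2 (by linarith [hu.2]) (by omega)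
  have h5 : (a * Real.exp (u / a)) ^ a * (b * Real.exp (-u / b)) ^ b = prof a b 0 := by
    rw [mul_pow, mul_pow, ← Real.exp_nat_mul, ← Real.exp_nat_mul, mul_div_cancel₀ _ ha'.ne',
      mul_div_cancel₀ _ hb'.ne', prof, add_zero, sub_zero]
    have : Real.exp u * Real.exp (-u) = 1 := by rw [← Real.exp_add]; simp
    linear_combination ((a : ℝ) ^ a * (b : ℝ) ^ b) * this
  rw [← h5, prof]
  exact mul_lt_mul'' h3 h4 (pow_nonneg (by linarith [hu.1]) _) (pow_nonneg (by linarith [hu.2]) _)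

/-- As `Q` has a critical point at `0`, the polynomial `Q(0) - Q(u)` is divisible by `u²`. -/
theorem exists_prof_eq (ha : 1 ≤ a) (hb : 1 ≤ b) :
    ∃ k : Polynomial ℝ, ∀ u, prof a b u = prof a b 0 - u ^ 2 * k.eval u := by
  let P : Polynomial ℝ := (.C (a : ℝ) + .X) ^ a * (.C (b : ℝ) - .X) ^ b
  have hP : ∀ u, P.eval u = prof a b u := fun u => by simp [P, prof]
  have hd : P.derivative.eval 0 = 0 := by
    have h1 := P.hasDerivAt 0
    have h2 := hasDerivAt_prof ha hb (zero_mem_Ioo ha hb)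
    rw [← funext hP] at h2
    rw [h1.unique h2, sub_div_eq (zero_mem_Ioo ha hb)]
    simp
  have hdvd : Polynomial.X ^ 2 ∣ Polynomial.C (prof a b 0) - P := by
    rw [Polynomial.X_pow_dvd_iff]
    intro d hd2
    interval_cases d
    · rw [Polynomial.coeff_zero_eq_eval_zero]
      simp [hP]
    · have : P.derivative.coeff 0 = P.coeff 1 := by rw [Polynomial.coeff_derivative]; simp
      rw [Polynomial.coeff_sub, Polynomial.coeff_C, if_neg one_ne_zero, ← this,
        Polynomial.coeff_zero_eq_eval_zero, hd, sub_zero]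
  obtain ⟨k, hk⟩ := hdvd
  refine ⟨k, fun u => ?_⟩
  have := congrArg (Polynomial.eval u) hk
  simp only [Polynomial.eval_sub, Polynomial.eval_C, hP, Polynomial.eval_mul, Polynomial.eval_pow,
    Polynomial.eval_X] at this
  linarith

theorem quot_deriv_eq (ha : 1 ≤ a) (hb : 1 ≤ b) {k : Polynomial ℝ}
    (hk : ∀ u, prof a b u = prof a b 0 - u ^ 2 * k.eval u) {u : ℝ}
    (hu : u ∈ Set.Ioo (-(a : ℝ)) b) :
    2 * k.eval u + u * k.derivative.eval u = prof a b u * ((a + b) / ((a + u) * (b - u))) := by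
  have hne : ∀ u ∈ Set.Ioo (-(a : ℝ)) b, u ≠ 0 → 2 * k.eval u + u * k.derivative.eval u =
      prof a b u * ((a + b) / ((a + u) * (b - u))) := by
    intro u hu h0
    have h1 := hasDerivAt_prof ha hb hu
    have h2 := (((hasDerivAt_id u).pow 2).mul (k.hasDerivAt u)).const_sub (prof a b 0)
    have h3 : HasDerivAt (prof a b) _ u := h2.congr_of_eventuallyEq (.of_forall fun u => hk u)
    have h4 := h1.unique h3
    rw [sub_div_eq hu] at h4
    simp only [Pi.pow_apply, id] at h4
    refine mul_left_cancel₀ (neg_ne_zero.2 h0) ?_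
    push_cast at h4
    linear_combination -h4
  by_cases h0 : u = 0
  · subst h0
    have hp : Continuous (prof a b) := by unfold prof; fun_prop
    have hc1 : ContinuousAt (fun u : ℝ => 2 * k.eval u + u * k.derivative.eval u) 0 := by
      fun_prop
    have hc2 : ContinuousAt (fun u : ℝ => prof a b u * ((a + b) / ((a + u) * (b - u)))) 0 := by
      have h1 : (a : ℝ) + 0 ≠ 0 := by linarith [hu.1]
      have h2 : (b : ℝ) - 0 ≠ 0 := by linarith [hu.2]
      refine hp.continuousAt.mul (ContinuousAt.div (by fun_prop) (by fun_prop) ?_)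
      exact mul_ne_zero h1 h2
    have h1 := hc1.tendsto.mono_left (nhdsWithin_le_nhds (s := {0}ᶜ))
    have h2 := hc2.tendsto.mono_left (nhdsWithin_le_nhds (s := {0}ᶜ))
    refine tendsto_nhds_unique (h1.congr' ?_) h2
    filter_upwards [self_mem_nhdsWithin, nhdsWithin_le_nhds (isOpen_Ioo.mem_nhds hu)] with x hx hx'
    exact hne x hx' hx
  · exact hne u hu h0

/-- `G` is an inverse of the function `± (Q(0) - Q)^{1/2}` (with the sign of its argument), and
`DG` is the derivative of `G`. -/
structure IsProfileInverse (a b : ℕ) (G DG : ℝ → ℝ) : Prop where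
  mem : ∀ y ∈ Set.Ioo (-√(prof a b 0)) (√(prof a b 0)), G y ∈ Set.Ioo (-(a : ℝ)) b
  prof_eq : ∀ y ∈ Set.Ioo (-√(prof a b 0)) (√(prof a b 0)), prof a b (G y) = prof a b 0 - y ^ 2
  hasDerivAt : ∀ y ∈ Set.Ioo (-√(prof a b 0)) (√(prof a b 0)), HasDerivAt G (DG y) y
  continuousOn : ContinuousOn DG (Set.Ioo (-√(prof a b 0)) (√(prof a b 0)))
  pos : ∀ y ∈ Set.Ioo (-√(prof a b 0)) (√(prof a b 0)), 0 < DG y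
  map_zero : G 0 = 0
  deriv_zero : DG 0 = √(2 * a * b / ((a + b) * prof a b 0))

/-- If `Q(u) = Q(0) - u² k(u)`, then `k > 0` by `prof_lt`, and `u k(u)^{1/2}` is strictly increasing
with nonvanishing derivative, so it has a differentiable inverse `G`. -/
theorem exists_profileInverse (ha : 1 ≤ a) (hb : 1 ≤ b) :
    ∃ G DG, IsProfileInverse a b G DG := by
  obtain ⟨k, hk⟩ := exists_prof_eq ha hb
  set Q₀ := prof a b 0 with hQ₀
  have ha' : (0 : ℝ) < a := by exact_mod_cast ha
  have hb' : (0 : ℝ) < b := by exact_mod_cast hb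
  have hQpos : 0 < Q₀ := prof_pos (zero_mem_Ioo ha hb)
  have hfac : ∀ u ∈ Set.Ioo (-(a : ℝ)) b, 0 < ((a : ℝ) + b) / ((a + u) * (b - u)) := fun u hu =>
    div_pos (by positivity) (mul_pos (by linarith [hu.1]) (by linarith [hu.2]))
  have hk0 : 2 * k.eval 0 = Q₀ * ((a + b) / (a * b)) := by
    have := quot_deriv_eq ha hb hk (zero_mem_Ioo ha hb)
    simpa using this
  have hkpos : ∀ u ∈ Set.Ioo (-(a : ℝ)) b, 0 < k.eval u := by
    intro u hu
    by_cases h0 : u = 0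
    · subst h0
      have : 0 < 2 * k.eval 0 := by rw [hk0]; positivity
      linarith
    · have h1 := prof_lt ha hb hu h0
      rw [hk u] at h1
      have : 0 < u ^ 2 * k.eval u := by linarith
      exact pos_of_mul_pos_right this (sq_nonneg u)
  let g : ℝ → ℝ := fun u => u * √(k.eval u)
  let g' : ℝ → ℝ := fun u => prof a b u * ((a + b) / ((a + u) * (b - u))) / (2 * √(k.eval u))
  have hg' : ∀ u ∈ Set.Ioo (-(a : ℝ)) b, HasDerivAt g (g' u) u := by
    intro u hu
    have hs := (Real.sqrt_pos.2 (hkpos u hu)).ne'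
    refine ((hasDerivAt_id u).mul ((k.hasDerivAt u).sqrt (hkpos u hu).ne')).congr_deriv ?_
    simp only [g', id]
    rw [← quot_deriv_eq ha hb hk hu]
    field_simp
    rw [Real.sq_sqrt (hkpos u hu).le]
    ring
  have hg'pos : ∀ u ∈ Set.Ioo (-(a : ℝ)) b, 0 < g' u := fun u hu =>
    div_pos (mul_pos (prof_pos hu) (hfac u hu)) (mul_pos two_pos (Real.sqrt_pos.2 (hkpos u hu)))
  have hgc : Continuous g := continuous_id.mul k.continuous.sqrt
  have hgmono : StrictMonoOn g (Set.Ioo (-(a : ℝ)) b) :=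
    strictMonoOn_of_deriv_pos (convex_Ioo _ _) hgc.continuousOn fun u hu => by
      rw [interior_Ioo] at hu
      rw [(hg' u hu).deriv]
      exact hg'pos u hu
  have hga : g (-a) = -√Q₀ := by
    have h1 := hk (-a)
    have h2 : prof a b (-a) = 0 := by simp [prof, Nat.one_le_iff_ne_zero.1 ha]
    have h3 : Q₀ = (a : ℝ) ^ 2 * k.eval (-a : ℝ) := by rw [h2] at h1; linarith
    simp only [g]
    rw [h3, Real.sqrt_mul (sq_nonneg _), Real.sqrt_sq ha'.le, neg_mul]
  have hgb : g b = √Q₀ := by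
    have h1 := hk b
    have h2 : prof a b b = 0 := by simp [prof, Nat.one_le_iff_ne_zero.1 hb]
    have h3 : Q₀ = (b : ℝ) ^ 2 * k.eval (b : ℝ) := by rw [h2] at h1; linarith
    simp only [g]
    rw [h3, Real.sqrt_mul (sq_nonneg _), Real.sqrt_sq hb'.le]
  have hsurj : ∀ y ∈ Set.Ioo (-√Q₀) (√Q₀), ∃ u ∈ Set.Ioo (-(a : ℝ)) b, g u = y := by
    intro y hy
    rw [← hga, ← hgb] at hy
    exact intermediate_value_Ioo (by linarith) hgc.continuousOn hy
  have hsq : ∀ u ∈ Set.Ioo (-(a : ℝ)) b, g u ^ 2 = Q₀ - prof a b u := fun u hu => by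
    simp only [g]
    rw [mul_pow, Real.sq_sqrt (hkpos u hu).le, hk u]
    ring
  have hgmem : ∀ u ∈ Set.Ioo (-(a : ℝ)) b, g u ∈ Set.Ioo (-√Q₀) (√Q₀) := fun u hu => by
    rw [Set.mem_Ioo, ← abs_lt]
    refine Real.lt_sqrt_of_sq_lt ?_
    rw [sq_abs, hsq u hu]
    linarith [prof_pos hu]
  let G : ℝ → ℝ := Function.invFunOn g (Set.Ioo (-(a : ℝ)) b)
  have hGmem : ∀ y ∈ Set.Ioo (-√Q₀) (√Q₀), G y ∈ Set.Ioo (-(a : ℝ)) b := fun y hy =>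
    Function.invFunOn_mem (hsurj y hy)
  have hgG : ∀ y ∈ Set.Ioo (-√Q₀) (√Q₀), g (G y) = y := fun y hy =>
    Function.invFunOn_eq (hsurj y hy)
  have hGg : ∀ u ∈ Set.Ioo (-(a : ℝ)) b, G (g u) = u := fun u hu =>
    hgmono.injOn (hGmem _ (hgmem u hu)) hu (hgG _ (hgmem u hu))
  have hGmono : StrictMonoOn G (Set.Ioo (-√Q₀) (√Q₀)) := by
    intro x hx y hy hxy
    rw [← hgmono.lt_iff_lt (hGmem x hx) (hGmem y hy), hgG x hx, hgG y hy]
    exact hxy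
  have hGc : ∀ y ∈ Set.Ioo (-√Q₀) (√Q₀), ContinuousAt G y := by
    intro y hy
    refine hGmono.continuousAt_of_image_mem_nhds (isOpen_Ioo.mem_nhds hy) ?_
    refine Filter.mem_of_superset (isOpen_Ioo.mem_nhds (hGmem y hy)) fun u hu => ?_
    exact ⟨g u, hgmem u hu, hGg u hu⟩
  have hG0 : G 0 = 0 := by
    have h0 : g 0 = 0 := by simp [g]
    have := hGg 0 (zero_mem_Ioo ha hb)
    rwa [h0] at this
  refine ⟨G, fun y => (g' (G y))⁻¹, hGmem, fun y hy => ?_, fun y hy => ?_, fun y hy => ?_,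
    fun y hy => inv_pos.2 (hg'pos _ (hGmem y hy)), hG0, ?_⟩
  · have := hsq _ (hGmem y hy)
    rw [hgG y hy] at this
    linarith
  · exact HasDerivAt.of_local_left_inverse (hGc y hy) (hg' _ (hGmem y hy))
      (hg'pos _ (hGmem y hy)).ne' (Filter.eventually_of_mem (isOpen_Ioo.mem_nhds hy) hgG)
  · have hu := hGmem y hy
    have h1 : (a : ℝ) + G y ≠ 0 := by linarith [hu.1]
    have h2 : (b : ℝ) - G y ≠ 0 := by linarith [hu.2]
    have h3 := (Real.sqrt_pos.2 (hkpos _ hu)).ne'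
    have hp : Continuous (prof a b) := by unfold prof; fun_prop
    have hc : ContinuousAt g' (G y) := by
      refine ContinuousAt.div (hp.continuousAt.mul (ContinuousAt.div (by fun_prop) (by fun_prop)
        (mul_ne_zero h1 h2))) ?_ (mul_ne_zero two_ne_zero h3)
      exact (continuous_const.mul k.continuous.sqrt).continuousAt
    exact ((ContinuousAt.comp (g := g') hc (hGc y hy)).inv₀ (hg'pos _ hu).ne').continuousWithinAt
  · simp only [hG0, g']
    have hk0' : k.eval 0 = Q₀ * (a + b) / (2 * (a * b)) := by
      field_simp at hk0 ⊢
      linarith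
    have h3 := hkpos 0 (zero_mem_Ioo ha hb)
    rw [← hQ₀, add_zero, sub_zero, inv_div]
    refine ((Real.sqrt_eq_iff_mul_self_eq_of_pos (by positivity)).2 ?_).symm
    rw [← sq, div_pow, mul_pow, Real.sq_sqrt h3.le, hk0']
    field_simp

/-- The derivative of `log Q(G(y)) = log (Q(0) - y²)`. -/
theorem IsProfileInverse.deriv_mul {G DG : ℝ → ℝ} (h : IsProfileInverse a b G DG) (ha : 1 ≤ a)
    (hb : 1 ≤ b) {y : ℝ} (hy : y ∈ Set.Ioo (-√(prof a b 0)) (√(prof a b 0))) :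
    DG y * (a / (a + G y) - b / (b - G y)) = -2 * y / (prof a b 0 - y ^ 2) := by
  have h1 := (hasDerivAt_prof ha hb (h.mem y hy)).comp y (h.hasDerivAt y hy)
  have h2 : HasDerivAt (fun y : ℝ => prof a b 0 - y ^ 2) (-(2 * y)) y := by
    simpa using ((hasDerivAt_id y).pow 2).const_sub (prof a b 0)
  have h3 : prof a b ∘ G =ᶠ[nhds y] fun y => prof a b 0 - y ^ 2 :=
    Filter.eventually_of_mem (isOpen_Ioo.mem_nhds hy) h.prof_eq
  have h4 := h1.unique (h2.congr_of_eventuallyEq h3)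
  have h5 := prof_pos (h.mem y hy)
  rw [h.prof_eq y hy] at h4 h5
  rw [eq_div_iff h5.ne']
  linear_combination h4

theorem IsProfileInverse.strictMonoOn {G DG : ℝ → ℝ} (h : IsProfileInverse a b G DG) :
    StrictMonoOn G (Set.Ioo (-√(prof a b 0)) (√(prof a b 0))) :=
  strictMonoOn_of_deriv_pos (convex_Ioo _ _)
    (fun y hy => (h.hasDerivAt y hy).continuousAt.continuousWithinAt) fun y hy => by
      rw [interior_Ioo] at hy
      rw [(h.hasDerivAt y hy).deriv]
      exact h.pos y hy

end Profile

/-! ### Symmetric evolutions -/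

theorem hasDerivAt_primitive {f : ℝ → ℝ} (hf : Continuous f) (x : ℝ) :
    HasDerivAt (fun x => ∫ s in (0 : ℝ)..x, f s) (f x) x :=
  (hf.integral_hasStrictDerivAt 0 x).hasDerivAt

theorem primitive_add_period {f : ℝ → ℝ} (hf : Continuous f) {P : ℝ} (hP : Function.Periodic f P)
    (x : ℝ) : ∫ s in (0 : ℝ)..(x + P), f s = (∫ s in (0 : ℝ)..x, f s) + ∫ s in (0 : ℝ)..P, f s := by
  have h1 := hP.intervalIntegral_add_eq x 0
  rw [zero_add] at h1
  rw [← h1, intervalIntegral.integral_add_adjacent_intervals (hf.intervalIntegrable _ _)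
    (hf.intervalIntegrable _ _)]

/-- A positive periodic density defines a reparametrization of the line. -/
theorem exists_reparam {f : ℝ → ℝ} (hf : Continuous f) (hpos : ∀ x, 0 < f x) {P : ℝ} (hP0 : 0 < P)
    (hP : Function.Periodic f P) :
    ∃ φ : ℝ → ℝ, StrictMono φ ∧ Function.Surjective φ ∧ φ 0 = 0 ∧
      (∀ t, HasDerivAt φ (f (φ t))⁻¹ t) ∧
      ∀ t, φ (t + ∫ s in (0 : ℝ)..P, f s) = φ t + P := by
  set τ : ℝ → ℝ := fun x => ∫ s in (0 : ℝ)..x, f s with hτ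
  have hd : ∀ x, HasDerivAt τ (f x) x := hasDerivAt_primitive hf
  have hmono : StrictMono τ := strictMono_of_deriv_pos fun x => by
    rw [(hd x).deriv]; exact hpos x
  have hcont : Continuous τ := continuous_iff_continuousAt.2 fun x => (hd x).continuousAt
  obtain ⟨δ, hδ, hle⟩ : ∃ δ, 0 < δ ∧ ∀ x, δ ≤ f x := by
    obtain ⟨δ, ⟨x, hx⟩, hδ⟩ := (hP.compact_of_continuous hP0.ne' hf).exists_isLeast
      (Set.range_nonempty f)
    exact ⟨δ, hx ▸ hpos x, fun y => hδ ⟨y, rfl⟩⟩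
  have hmono2 : Monotone fun x => τ x - δ * x := by
    refine monotone_of_deriv_nonneg (fun x => ?_) fun x => ?_
    · exact ((hd x).sub ((hasDerivAt_id x).const_mul δ)).differentiableAt
    · have := ((hd x).sub ((hasDerivAt_id x).const_mul δ)).deriv
      refine le_of_le_of_eq ?_ this.symm
      have := hle x
      linarith
  have h0 : τ 0 = 0 := intervalIntegral.integral_same
  have hsurj : Function.Surjective τ := by
    refine hcont.surjective ?_ ?_
    · refine Filter.tendsto_atTop_mono' _ ?_ (Filter.tendsto_id.const_mul_atTop hδ)
      filter_upwards [Filter.eventually_ge_atTop 0] with x hx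
      have := hmono2 hx
      simp only [h0, mul_zero, sub_zero] at this
      simp only [id]
      linarith
    · refine Filter.tendsto_atBot_mono' _ ?_ (Filter.tendsto_id.const_mul_atBot hδ)
      filter_upwards [Filter.eventually_le_atBot 0] with x hx
      have := hmono2 hx
      simp only [h0, mul_zero, sub_zero] at this
      simp only [id]
      linarith
  let e := StrictMono.orderIsoOfSurjective τ hmono hsurj
  have he : ∀ t, τ (e.symm t) = t := fun t => e.apply_symm_apply t
  have he' : ∀ x, e.symm (τ x) = x := fun x => e.symm_apply_apply x
  refine ⟨e.symm, e.symm.strictMono, e.symm.surjective, ?_, fun t => ?_, fun t => ?_⟩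
  · rw [← h0, he', h0]
  · exact HasDerivAt.of_local_left_inverse e.symm.continuous.continuousAt (hd _) (hpos _).ne'
      (.of_forall he)
  · rw [← he' (e.symm t + P)]
    congr 1
    simp only [hτ]
    rw [primitive_add_period hf hP]
    congr 1
    exact (he t).symm

section Evolution

variable {a b : ℕ} {G DG : ℝ → ℝ}

/-- The density of time with respect to the angle `φ`, where `u = G(R sin φ)`. As `u' = 2v` with
`v² = Q(u) - A² = (R cos φ)²`, it is half of the derivative of `G`. -/
def dens (DG : ℝ → ℝ) (R φ : ℝ) : ℝ := DG (R * Real.sin φ) / 2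

/-- The period of `u` as a function of the amplitude `R`. -/
def symPeriod (DG : ℝ → ℝ) (R : ℝ) : ℝ := ∫ φ in (0 : ℝ)..(2 * Real.pi), dens DG R φ

/-- The decrease of `θ_1 + ⋯ + θ_a` over a period. -/
def turn (a b : ℕ) (G DG : ℝ → ℝ) (R : ℝ) : ℝ := ∫ φ in (0 : ℝ)..(2 * Real.pi),
  a * (√(prof a b 0 - R ^ 2) / (a + G (R * Real.sin φ)) * dens DG R φ)

theorem abs_mul_sin_le {R : ℝ} (hR : 0 ≤ R) (φ : ℝ) : |R * Real.sin φ| ≤ R := by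
  rw [abs_mul, abs_of_nonneg hR]
  exact mul_le_of_le_one_right hR (Real.abs_sin_le_one φ)

theorem mul_sin_mem {R K : ℝ} (hR : R ∈ Set.Ico 0 K) (φ : ℝ) :
    R * Real.sin φ ∈ Set.Ioo (-K) K := by
  rw [Set.mem_Ioo, ← abs_lt]
  exact (abs_mul_sin_le hR.1 φ).trans_lt hR.2

theorem sq_lt_of_mem_Ico {R K : ℝ} (hR : R ∈ Set.Ico 0 √K) : R ^ 2 < K :=
  (Real.lt_sqrt hR.1).1 hR.2

theorem IsProfileInverse.continuous_dens (h : IsProfileInverse a b G DG) {R : ℝ}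
    (hR : R ∈ Set.Ico 0 (√(prof a b 0))) : Continuous (dens DG R) := by
  unfold dens
  exact (h.continuousOn.comp_continuous (by fun_prop) (mul_sin_mem hR)).div_const 2

theorem IsProfileInverse.dens_pos (h : IsProfileInverse a b G DG) {R : ℝ}
    (hR : R ∈ Set.Ico 0 (√(prof a b 0))) (φ : ℝ) : 0 < dens DG R φ :=
  half_pos (h.pos _ (mul_sin_mem hR φ))

theorem IsProfileInverse.continuousOn_G (h : IsProfileInverse a b G DG) :
    ContinuousOn G (Set.Ioo (-√(prof a b 0)) (√(prof a b 0))) :=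
  fun y hy => (h.hasDerivAt y hy).continuousAt.continuousWithinAt

theorem IsProfileInverse.continuous_comp (h : IsProfileInverse a b G DG) {R : ℝ}
    (hR : R ∈ Set.Ico 0 (√(prof a b 0))) : Continuous fun φ => G (R * Real.sin φ) :=
  h.continuousOn_G.comp_continuous (by fun_prop) (mul_sin_mem hR)

theorem dens_periodic (R : ℝ) : Function.Periodic (dens DG R) (2 * Real.pi) := fun φ => by
  simp [dens]

theorem sum_sgn_div {u A : ℝ} :
    ∑ j, sgn a j * (A / (symAlpha a b j + sgn a j * u)) =
      A * (a / (a + u) - b / (b - u)) := by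
  rw [Fin.sum_univ_add]
  simp only [sgn_castAdd, sgn_natAdd, symAlpha_castAdd, symAlpha_natAdd, Finset.sum_const,
    Finset.card_univ, Fintype.card_fin, nsmul_eq_mul, neg_mul, one_mul, ← sub_eq_add_neg]
  ring

/-- For every amplitude `R` there is a symmetric evolution, `u = G(R sin φ)`. Its phase is
`θ = π/2 - arctan(R cos φ / A)`, and `θ_j` is obtained by integration. -/
theorem exists_symmetric_evolution (h : IsProfileInverse a b G DG) (ha : 1 ≤ a) (hb : 1 ≤ b)
    {R : ℝ} (hR0 : 0 < R) (hR : R < √(prof a b 0)) :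
    ∃ D : CaseDEvolution (a + b) a, D.α = symAlpha a b ∧
      D.HasPhases (fun j => -sgn a j * turn a b G DG R / symAlpha a b j) ∧
      IsLeast (Set.range D.u) (G (-R)) ∧ IsGreatest (Set.range D.u) (G R) := by
  have hRm : R ∈ Set.Ico 0 (√(prof a b 0)) := ⟨hR0.le, hR⟩
  have hπ := Real.pi_pos
  have ha' : (0 : ℝ) < a := by exact_mod_cast ha
  have hb' : (0 : ℝ) < b := by exact_mod_cast hb
  set Q₀ := prof a b 0 with hQ₀
  set A : ℝ := √(Q₀ - R ^ 2) with hA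
  have hA2 : A ^ 2 = Q₀ - R ^ 2 := Real.sq_sqrt (by linarith [sq_lt_of_mem_Ico hRm])
  have hApos : 0 < A := Real.sqrt_pos.2 (by linarith [sq_lt_of_mem_Ico hRm])
  have hmem : ∀ φ, G (R * Real.sin φ) ∈ Set.Ioo (-(a : ℝ)) b := fun φ =>
    h.mem _ (mul_sin_mem hRm φ)
  have hrad : ∀ φ j, 0 < symAlpha a b j + sgn a j * G (R * Real.sin φ) := fun φ =>
    (forall_symAlpha_pos_iff ha hb).2 (hmem φ)
  obtain ⟨φ, hφmono, hφsurj, hφ0, hφd, hφT⟩ := exists_reparam (h.continuous_dens hRm)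
    (h.dens_pos hRm) Real.two_pi_pos (dens_periodic R)
  set T : ℝ := ∫ s in (0 : ℝ)..(2 * Real.pi), dens DG R s with hT
  -- the integrated angles
  let f : Fin (a + b) → ℝ → ℝ := fun j s =>
    A / (symAlpha a b j + sgn a j * G (R * Real.sin s)) * dens DG R s
  have hfc : ∀ j, Continuous (f j) := fun j =>
    (continuous_const.div (continuous_const.add (continuous_const.mul (h.continuous_comp hRm)))
      fun s => (hrad s j).ne').mul (h.continuous_dens hRm)
  have hfp : ∀ j, Function.Periodic (f j) (2 * Real.pi) := fun j s => by simp [f, dens]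
  let Θ : Fin (a + b) → ℝ → ℝ := fun j x => ∫ s in (0 : ℝ)..x, f j s
  have hΘd : ∀ j x, HasDerivAt (Θ j) (f j x) x := fun j => hasDerivAt_primitive (hfc j)
  let c₀ : ℝ := (Real.pi / 2 - Real.arctan (R / A)) / (a + b)
  have hden : ∀ x, A ^ 2 + R ^ 2 * Real.cos x ^ 2 = Q₀ - (R * Real.sin x) ^ 2 := fun x => by
    rw [hA2]
    linear_combination R ^ 2 * Real.sin_sq_add_cos_sq x
  have hphase : ∀ x, ∑ j, (c₀ - sgn a j * Θ j x) =
      Real.pi / 2 - Real.arctan (R * Real.cos x / A) := by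
    have hd1 : ∀ x, HasDerivAt (fun x => ∑ j, (c₀ - sgn a j * Θ j x))
        (A * (R * Real.sin x) / (Q₀ - (R * Real.sin x) ^ 2)) x := by
      intro x
      have h1 := HasDerivAt.fun_sum (u := Finset.univ) fun j _ =>
        ((hΘd j x).const_mul (sgn a j)).const_sub c₀
      refine h1.congr_deriv ?_
      have h2 : ∀ j, -(sgn a j * f j x) = -(sgn a j *
          (A / (symAlpha a b j + sgn a j * G (R * Real.sin x)))) * dens DG R x := fun j => by
        simp only [f]; ring
      simp only [h2, ← Finset.sum_mul, Finset.sum_neg_distrib]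
      rw [sum_sgn_div]
      have h3 := h.deriv_mul ha hb (mul_sin_mem hRm x)
      simp only [dens]
      linear_combination (-A / 2) * h3
    have hd2 : ∀ x, HasDerivAt (fun x => Real.pi / 2 - Real.arctan (R * Real.cos x / A))
        (A * (R * Real.sin x) / (Q₀ - (R * Real.sin x) ^ 2)) x := by
      intro x
      have h1 := ((((Real.hasDerivAt_cos x).const_mul R).div_const A).arctan).const_sub
        (Real.pi / 2)
      refine h1.congr_deriv ?_
      have h4 : 0 < A ^ 2 + R ^ 2 * Real.cos x ^ 2 := by positivity
      rw [← hden]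
      field_simp
    intro x
    have h1 := is_const_of_deriv_eq_zero (fun x => ((hd1 x).sub (hd2 x)).differentiableAt)
      (fun x => by rw [((hd1 x).sub (hd2 x)).deriv, sub_self]) x 0
    have h2 : ∑ j, (c₀ - sgn a j * Θ j 0) = Real.pi / 2 - Real.arctan (R * Real.cos 0 / A) := by
      have h3 : ∀ j, Θ j 0 = 0 := fun j => intervalIntegral.integral_same
      have h4 : ((a : ℝ) + b) ≠ 0 := by positivity
      simp only [h3, mul_zero, sub_zero, Finset.sum_const, Finset.card_univ, Fintype.card_fin,
        nsmul_eq_mul, Real.cos_zero, mul_one, c₀, Nat.cast_add]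
      field_simp
    simp only [Pi.sub_apply] at h1
    linarith
  have hsqrtQ : ∀ x, √(Qpoly a (symAlpha a b) (G (R * Real.sin x))) =
      A * √(1 + (R * Real.cos x / A) ^ 2) := fun x => by
    rw [Qpoly_symAlpha, h.prof_eq _ (mul_sin_mem hRm x), ← hQ₀, ← hden, ← Real.sqrt_sq hApos.le,
      ← Real.sqrt_mul (sq_nonneg _), Real.sqrt_sq hApos.le]
    congr 1
    field_simp
  have hsin : ∀ x, √(Qpoly a (symAlpha a b) (G (R * Real.sin x))) *
      Real.sin (∑ j, (c₀ - sgn a j * Θ j x)) = A := fun x => by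
    rw [hphase, Real.sin_pi_div_two_sub, Real.cos_arctan, hsqrtQ]
    have : 0 < √(1 + (R * Real.cos x / A) ^ 2) := Real.sqrt_pos.2 (by positivity)
    field_simp
  have hcos : ∀ x, √(Qpoly a (symAlpha a b) (G (R * Real.sin x))) *
      Real.cos (∑ j, (c₀ - sgn a j * Θ j x)) = R * Real.cos x := fun x => by
    rw [hphase, Real.cos_pi_div_two_sub, Real.sin_arctan, hsqrtQ]
    have : 0 < √(1 + (R * Real.cos x / A) ^ 2) := Real.sqrt_pos.2 (by positivity)
    field_simp
  let D : CaseDEvolution (a + b) a :=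
    { α := symAlpha a b
      u := fun t => G (R * Real.sin (φ t))
      θ := fun j t => c₀ - sgn a j * Θ j (φ t)
      α_pos := fun j => by
        have := (forall_symAlpha_pos_iff ha hb).2 (zero_mem_Ioo ha hb) j
        simpa using this
      balance := by
        have := sum_sgn_div (a := a) (b := b) (u := 0) (A := 1)
        simp only [mul_zero, add_zero, sub_zero, div_self ha'.ne', div_self hb'.ne', sub_self,
          mul_one_div] at this
        exact this
      u_mem := fun t j => hrad (φ t) j
      deriv_u := fun t => by
        have h1 := (h.hasDerivAt _ (mul_sin_mem hRm (φ t))).comp t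
          (((hφd t).sin).const_mul R)
        refine h1.congr_deriv ?_
        have h2 := (h.pos _ (mul_sin_mem hRm (φ t))).ne'
        rw [mul_assoc 2, hcos]
        simp only [dens]
        field_simp
      deriv_θ := fun j t => by
        have h1 := (((hΘd j (φ t)).comp t (hφd t)).const_mul (sgn a j)).const_sub c₀
        refine h1.congr_deriv ?_
        have h2 := (h.dens_pos hRm (φ t)).ne'
        rw [hsin]
        simp only [f]
        field_simp
      A_pos := by rw [hsin]; exact hApos
      A_lt := by
        have h1 : ∏ j, symAlpha a b j = Q₀ := by
          rw [hQ₀, ← Qpoly_symAlpha, Qpoly]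
          simp
        rw [hsin, h1]
        exact Real.sqrt_lt_sqrt (by linarith [sq_lt_of_mem_Ico hRm])
          (by linarith [pow_pos hR0 2]) }
  have hTpos : 0 < T := intervalIntegral.intervalIntegral_pos_of_pos
    ((h.continuous_dens hRm).intervalIntegrable _ _) (h.dens_pos hRm) Real.two_pi_pos
  have hDphase : ∀ t, ∑ j, D.θ j t = Real.pi / 2 - Real.arctan (R * Real.cos (φ t) / A) :=
    fun t => hphase (φ t)
  have hperiod : D.IsPeriod T := by
    refine ⟨⟨hTpos, fun t => ⟨?_, ?_⟩⟩, fun S hS => ?_⟩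
    · simp only [D, hφT, Real.sin_add_two_pi]
    · rw [hDphase, hDphase, hφT, Real.cos_add_two_pi]
    · obtain ⟨hS0, hS⟩ := hS
      have h1 := (hS 0).2
      rw [hDphase, hDphase, zero_add, hφ0, Real.cos_zero, sub_right_inj] at h1
      have h2 := Real.arctan_injective h1
      have h3 : Real.cos (φ S) = 1 := by
        field_simp at h2
        exact h2
      obtain ⟨n, hn⟩ := (Real.cos_eq_one_iff _).1 h3
      have h4 : 0 < φ S := by rw [← hφ0]; exact hφmono hS0
      have h5 : (1 : ℝ) ≤ n := by
        rw [← hn] at h4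
        have : (0 : ℝ) < n := pos_of_mul_pos_left h4 Real.two_pi_pos.le
        exact_mod_cast this
      have h6 : φ T ≤ φ S := by
        have := hφT 0
        rw [zero_add, hφ0, zero_add] at this
        rw [this, ← hn]
        exact le_mul_of_one_le_left Real.two_pi_pos.le h5
      exact hφmono.le_iff_le.1 h6
  have hturn1 : ∀ i : Fin a, a * Θ (Fin.castAdd b i) (2 * Real.pi) = turn a b G DG R := fun i => by
    rw [turn, intervalIntegral.integral_const_mul]
    congr 1
    refine intervalIntegral.integral_congr fun s _ => ?_
    simp only [f, symAlpha_castAdd, sgn_castAdd, one_mul, hA]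
    rfl
  have hturn2 : ∀ i : Fin b, b * Θ (Fin.natAdd a i) (2 * Real.pi) = turn a b G DG R := fun i => by
    have h1 := (hphase (2 * Real.pi)).trans
      ((by rw [Real.cos_two_pi, Real.cos_zero] : _ = _).trans (hphase 0).symm)
    have h3 : ∀ j, Θ j 0 = 0 := fun j => intervalIntegral.integral_same
    have h4 : ∀ i', Θ (Fin.natAdd a i') (2 * Real.pi) = Θ (Fin.natAdd a i) (2 * Real.pi) :=
      fun i' => intervalIntegral.integral_congr fun s _ => by
        simp only [f, symAlpha_natAdd, sgn_natAdd]
    have h5 : ∀ i', Θ (Fin.castAdd b i') (2 * Real.pi) = turn a b G DG R / a := fun i' => by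
      rw [← hturn1 i']; field_simp
    simp only [h3, mul_zero, sub_zero, Finset.sum_sub_distrib] at h1
    rw [sub_eq_self, Fin.sum_univ_add] at h1
    simp only [sgn_castAdd, sgn_natAdd, h4, h5, Finset.sum_const, Finset.card_univ,
      Fintype.card_fin, nsmul_eq_mul, one_mul] at h1
    rw [mul_div_cancel₀ _ ha'.ne'] at h1
    linarith
  refine ⟨D, rfl, ⟨T, hperiod, fun j t => ?_⟩, ⟨?_, ?_⟩, ⟨?_, ?_⟩⟩
  · have h1 : Θ j (φ (t + T)) = Θ j (φ t) + Θ j (2 * Real.pi) := by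
      rw [hφT]; exact primitive_add_period (hfc j) (hfp j) _
    have h2 : symAlpha a b j * Θ j (2 * Real.pi) = turn a b G DG R := by
      refine Fin.addCases (fun i => ?_) (fun i => ?_) j
      · rw [symAlpha_castAdd]; exact hturn1 i
      · rw [symAlpha_natAdd]; exact hturn2 i
    have h3 : symAlpha a b j ≠ 0 := (D.α_pos j).ne'
    simp only [D, h1]
    rw [← h2]
    field_simp
    ring
  · obtain ⟨t, ht⟩ := hφsurj (-(Real.pi / 2))
    exact ⟨t, by simp [D, ht]⟩
  · rintro _ ⟨t, rfl⟩
    refine h.strictMonoOn.monotoneOn ?_ (mul_sin_mem hRm (φ t)) ?_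
    · exact ⟨by linarith, by linarith⟩
    · exact (abs_le.1 (abs_mul_sin_le hR0.le (φ t))).1
  · obtain ⟨t, ht⟩ := hφsurj (Real.pi / 2)
    exact ⟨t, by simp [D, ht]⟩
  · rintro _ ⟨t, rfl⟩
    refine h.strictMonoOn.monotoneOn (mul_sin_mem hRm (φ t)) ?_ ?_
    · exact ⟨by linarith, by linarith⟩
    · exact (abs_le.1 (abs_mul_sin_le hR0.le (φ t))).2

end Evolution

/-! ### The increment of the phases as a function of the amplitude -/

section Turn

variable {a b : ℕ} {G DG : ℝ → ℝ}

/-- In the limit of amplitude `0`, `u` is constant and the increment is given by the frequency of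
small oscillations. -/
theorem turn_zero (h : IsProfileInverse a b G DG) (ha : 1 ≤ a) (hb : 1 ≤ b) :
    turn a b G DG 0 = Real.pi * √(2 * a * b / (a + b)) := by
  have ha' : (0 : ℝ) < a := by exact_mod_cast ha
  have hb' : (0 : ℝ) < b := by exact_mod_cast hb
  have hQ : 0 < prof a b 0 := prof_pos (zero_mem_Ioo ha hb)
  have h1 : √(prof a b 0) * √(2 * a * b / ((a + b) * prof a b 0)) = √(2 * a * b / (a + b)) := by
    rw [← Real.sqrt_mul hQ.le]
    congr 1
    field_simp
  simp only [turn, dens, zero_mul, h.map_zero, h.deriv_zero, add_zero,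
    intervalIntegral.integral_const, sub_zero, smul_eq_mul, ne_eq, OfNat.ofNat_ne_zero,
    not_false_eq_true, zero_pow]
  rw [← h1]
  field_simp

theorem pi_lt_turn_zero (h : IsProfileInverse a b G DG) (ha : 1 ≤ a) (hb : 1 ≤ b)
    (hab : 3 ≤ a + b) : Real.pi < turn a b G DG 0 := by
  rw [turn_zero h ha hb]
  refine lt_mul_of_one_lt_right Real.pi_pos ?_
  rw [Real.lt_sqrt zero_le_one, one_pow, one_lt_div (by positivity)]
  have ha' : (1 : ℝ) ≤ a := by exact_mod_cast ha
  have hb' : (1 : ℝ) ≤ b := by exact_mod_cast hb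
  have hab' : (3 : ℝ) ≤ a + b := by exact_mod_cast hab
  nlinarith [mul_nonneg (sub_nonneg.2 ha') (sub_nonneg.2 hb')]

theorem continuousOn_turn (h : IsProfileInverse a b G DG) :
    ContinuousOn (turn a b G DG) (Set.Ico 0 (√(prof a b 0))) := by
  rw [continuousOn_iff_continuous_domRestrict]
  have hmem : ∀ x : Set.Ico 0 (√(prof a b 0)) × ℝ, (x.1 : ℝ) * Real.sin x.2 ∈
      Set.Ioo (-√(prof a b 0)) (√(prof a b 0)) := fun x => mul_sin_mem x.1.2 x.2
  have hy : Continuous fun x : Set.Ico 0 (√(prof a b 0)) × ℝ => (x.1 : ℝ) * Real.sin x.2 := by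
    fun_prop
  have h1 := h.continuousOn_G.comp_continuous hy hmem
  have h2 := h.continuousOn.comp_continuous hy hmem
  refine intervalIntegral.continuous_parametric_intervalIntegral_of_continuous'
    (f := fun (R : Set.Ico 0 (√(prof a b 0))) φ =>
      a * (√(prof a b 0 - (R : ℝ) ^ 2) / (a + G (R * Real.sin φ)) * dens DG R φ)) ?_ _ _
  refine continuous_const.mul ((Continuous.div ?_ (continuous_const.add h1) fun x => ?_).mul
    (h2.div_const 2))
  · fun_prop
  · have := (h.mem _ (hmem x)).1
    exact (by linarith : (0 : ℝ) < a + G ((x.1 : ℝ) * Real.sin x.2)).ne'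

/-- An upper bound for the increment. For `u ≥ 0` the integrand is at most `A` times the density of
time, because `a / (a + u) ≤ 1`. For `u ≤ 0` the same holds with `b / (b - u)`, and the difference of
the two integrands is the derivative of the phase, which changes by less than `π`. -/
theorem turn_le (h : IsProfileInverse a b G DG) (ha : 1 ≤ a) (hb : 1 ≤ b) {R : ℝ}
    (hR : R ∈ Set.Ico 0 (√(prof a b 0))) :
    turn a b G DG R ≤ √(prof a b 0 - R ^ 2) * symPeriod DG R + Real.pi := by
  set Q₀ := prof a b 0 with hQ₀
  set A : ℝ := √(Q₀ - R ^ 2) with hA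
  have hA2 : A ^ 2 = Q₀ - R ^ 2 := Real.sq_sqrt (by linarith [sq_lt_of_mem_Ico hR])
  have hApos : 0 < A := Real.sqrt_pos.2 (by linarith [sq_lt_of_mem_Ico hR])
  have hπ := Real.pi_pos
  have ha' : (0 : ℝ) < a := by exact_mod_cast ha
  have hb' : (0 : ℝ) < b := by exact_mod_cast hb
  have h0mem : (0 : ℝ) ∈ Set.Ioo (-√Q₀) (√Q₀) := by
    have := Real.sqrt_pos.2 (prof_pos (zero_mem_Ioo ha hb) : 0 < prof a b 0)
    exact ⟨by linarith, this⟩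
  have hden : ∀ x, A ^ 2 + R ^ 2 * Real.cos x ^ 2 = Q₀ - (R * Real.sin x) ^ 2 := fun x => by
    rw [hA2]
    linear_combination R ^ 2 * Real.sin_sq_add_cos_sq x
  have hdpos : ∀ x, 0 < A ^ 2 + R ^ 2 * Real.cos x ^ 2 := fun x => by positivity
  have hcd := h.continuous_dens hR
  set F : ℝ → ℝ := fun φ => a * (A / (a + G (R * Real.sin φ)) * dens DG R φ) with hF
  have hFc : Continuous F := continuous_const.mul ((continuous_const.div
    (continuous_const.add (h.continuous_comp hR)) fun x => by
      have := (h.mem _ (mul_sin_mem hR x)).1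
      exact (by linarith : (0 : ℝ) < a + G (R * Real.sin x)).ne').mul hcd)
  let K : ℝ → ℝ := fun φ => -(A * (R * Real.sin φ) / (A ^ 2 + R ^ 2 * Real.cos φ ^ 2))
  have hKc : Continuous K := (Continuous.div (by fun_prop) (by fun_prop)
    fun x => (hdpos x).ne').neg
  have e1 : ∫ φ in (0 : ℝ)..Real.pi, F φ ≤ ∫ φ in (0 : ℝ)..Real.pi, A * dens DG R φ := by
    refine intervalIntegral.integral_mono_on hπ.le (hFc.intervalIntegrable _ _)
      ((continuous_const.mul hcd).intervalIntegrable _ _) fun x hx => ?_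
    have hy : 0 ≤ G (R * Real.sin x) := by
      rw [← h.map_zero]
      exact h.strictMonoOn.monotoneOn h0mem (mul_sin_mem hR x)
        (mul_nonneg hR.1 (Real.sin_nonneg_of_nonneg_of_le_pi hx.1 hx.2))
    have hd := (h.dens_pos hR x).le
    have h1 : (a : ℝ) * (A / (a + G (R * Real.sin x))) ≤ A := by
      rw [← mul_div_assoc, div_le_iff₀ (by linarith)]
      nlinarith
    calc F x = (a : ℝ) * (A / (a + G (R * Real.sin x))) * dens DG R x := by simp only [hF]; ring
      _ ≤ A * dens DG R x := by gcongr
  -- for `u ≤ 0`, trade `a / (a + u)` for `b / (b - u)` at the cost of the phase derivative `K`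
  have e2 : ∫ φ in Real.pi..(2 * Real.pi), F φ ≤
      ∫ φ in Real.pi..(2 * Real.pi), (A * dens DG R φ + K φ) := by
    refine intervalIntegral.integral_mono_on (by linarith) (hFc.intervalIntegrable _ _)
      (((continuous_const.mul hcd).add hKc).intervalIntegrable _ _) fun x hx => ?_
    have hsin : Real.sin x ≤ 0 := by
      have := Real.sin_nonneg_of_nonneg_of_le_pi (x := x - Real.pi) (by linarith [hx.1])
        (by linarith [hx.2])
      rw [Real.sin_sub_pi] at this
      linarith
    have hy : G (R * Real.sin x) ≤ 0 := by
      rw [← h.map_zero]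
      exact h.strictMonoOn.monotoneOn (mul_sin_mem hR x) h0mem
        (mul_nonpos_of_nonneg_of_nonpos hR.1 hsin)
    have hd := (h.dens_pos hR x).le
    have h1 : (b : ℝ) * (A / (b - G (R * Real.sin x))) ≤ A := by
      rw [← mul_div_assoc, div_le_iff₀ (by linarith)]
      nlinarith
    have h2 := h.deriv_mul ha hb (mul_sin_mem hR x)
    rw [← hQ₀, ← hden x] at h2
    calc F x = (b : ℝ) * (A / (b - G (R * Real.sin x))) * dens DG R x + K x := by
          simp only [hF, K, dens]
          linear_combination (A / 2) * h2
      _ ≤ A * dens DG R x + K x := by gcongr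
  have e3 : ∫ φ in Real.pi..(2 * Real.pi), K φ ≤ Real.pi := by
    have hd : ∀ x ∈ Set.uIcc Real.pi (2 * Real.pi),
        HasDerivAt (fun x => Real.arctan (R * Real.cos x / A)) (K x) x := by
      intro x _
      refine ((((Real.hasDerivAt_cos x).const_mul R).div_const A).arctan).congr_deriv ?_
      have := hdpos x
      simp only [K]
      field_simp
    rw [intervalIntegral.integral_eq_sub_of_hasDerivAt hd (hKc.intervalIntegrable _ _),
      Real.cos_two_pi, Real.cos_pi, mul_neg, neg_div, Real.arctan_neg]
    have := Real.arctan_lt_pi_div_two (R * 1 / A)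
    linarith
  have e4 : ∫ φ in Real.pi..(2 * Real.pi), (A * dens DG R φ + K φ) =
      (∫ φ in Real.pi..(2 * Real.pi), A * dens DG R φ) + ∫ φ in Real.pi..(2 * Real.pi), K φ :=
    intervalIntegral.integral_add ((continuous_const.mul hcd).intervalIntegrable _ _)
      (hKc.intervalIntegrable _ _)
  have e5 : turn a b G DG R = (∫ φ in (0 : ℝ)..Real.pi, F φ) +
      ∫ φ in Real.pi..(2 * Real.pi), F φ :=
    (intervalIntegral.integral_add_adjacent_intervals (hFc.intervalIntegrable _ _)
      (hFc.intervalIntegrable _ _)).symm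
  have e6 : A * symPeriod DG R = (∫ φ in (0 : ℝ)..Real.pi, A * dens DG R φ) +
      ∫ φ in Real.pi..(2 * Real.pi), A * dens DG R φ := by
    have hAc : Continuous fun φ => A * dens DG R φ := continuous_const.mul hcd
    rw [intervalIntegral.integral_add_adjacent_intervals (hAc.intervalIntegrable _ _)
      (hAc.intervalIntegrable _ _), symPeriod, intervalIntegral.integral_const_mul]
  linarith

/-- A function of `sin φ` has twice the integral over a half turn. -/
theorem integral_sin_eq {f : ℝ → ℝ} (hf : Continuous fun φ => f (Real.sin φ)) :
    ∫ φ in (0 : ℝ)..(2 * Real.pi), f (Real.sin φ) =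
      2 * ∫ φ in (-(Real.pi / 2))..(Real.pi / 2), f (Real.sin φ) := by
  have hp : Function.Periodic (fun φ => f (Real.sin φ)) (2 * Real.pi) := fun φ => by simp
  have h1 := hp.intervalIntegral_add_eq 0 (-(Real.pi / 2))
  rw [zero_add] at h1
  have h2 : ∫ φ in (Real.pi / 2)..(-(Real.pi / 2) + 2 * Real.pi), f (Real.sin φ) =
      ∫ φ in (-(Real.pi / 2))..(Real.pi / 2), f (Real.sin φ) := by
    have h3 := intervalIntegral.integral_comp_sub_left (a := -(Real.pi / 2)) (b := Real.pi / 2)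
      (fun φ => f (Real.sin φ)) Real.pi
    simp only [Real.sin_pi_sub] at h3
    rw [h3]
    congr 1 <;> ring
  rw [h1, ← intervalIntegral.integral_add_adjacent_intervals (b := Real.pi / 2)
    (hf.intervalIntegrable _ _) (hf.intervalIntegrable _ _), h2]
  ring

/-- Logarithmic concavity of `Q` between the maximum at `0` and a point `e`, weakened by
`1 + x ≤ e^x`. -/
theorem le_prof_mul (ha : 1 ≤ a) (hb : 1 ≤ b) {e s : ℝ} (he : e ∈ Set.Ioo (-(a : ℝ)) b)
    (hs0 : 0 ≤ s) (hs1 : s ≤ 1) :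
    prof a b e * (1 + (1 - s) * Real.log (prof a b 0 / prof a b e)) ≤ prof a b (s * e) := by
  have ha' : (0 : ℝ) < a := by exact_mod_cast ha
  have hb' : (0 : ℝ) < b := by exact_mod_cast hb
  have h0 := zero_mem_Ioo ha hb
  have hse : s * e ∈ Set.Ioo (-(a : ℝ)) b := by
    have := (convex_Ioo (-(a : ℝ)) b) he h0 hs0 (sub_nonneg.2 hs1) (by ring)
    simpa using this
  have hlog : ∀ u ∈ Set.Ioo (-(a : ℝ)) b,
      Real.log (prof a b u) = a * Real.log (a + u) + b * Real.log (b - u) := fun u hu => by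
    have h1 : (a : ℝ) + u ≠ 0 := by linarith [hu.1]
    have h2 : (b : ℝ) - u ≠ 0 := by linarith [hu.2]
    rw [prof, Real.log_mul (pow_ne_zero _ h1) (pow_ne_zero _ h2), Real.log_pow, Real.log_pow]
  have hc := strictConcaveOn_log_Ioi.concaveOn.2
  have h1 : s * Real.log (a + e) + (1 - s) * Real.log (a + 0) ≤ Real.log (a + s * e) := by
    have := hc (x := (a : ℝ) + e) (by rw [Set.mem_Ioi]; linarith [he.1]) (y := (a : ℝ) + 0)
      (by rw [Set.mem_Ioi]; linarith) hs0 (sub_nonneg.2 hs1) (by ring)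
    simp only [smul_eq_mul] at this
    refine this.trans_eq ?_
    congr 1
    ring
  have h2 : s * Real.log (b - e) + (1 - s) * Real.log (b - 0) ≤ Real.log (b - s * e) := by
    have := hc (x := (b : ℝ) - e) (by rw [Set.mem_Ioi]; linarith [he.2]) (y := (b : ℝ) - 0)
      (by rw [Set.mem_Ioi]; linarith) hs0 (sub_nonneg.2 hs1) (by ring)
    simp only [smul_eq_mul] at this
    refine this.trans_eq ?_
    congr 1
    ring
  have hpe := prof_pos he
  have hp0 := prof_pos h0
  have hps := prof_pos hse
  set Λ := Real.log (prof a b 0 / prof a b e) with hΛ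
  have h3 : Real.log (prof a b e) + (1 - s) * Λ ≤ Real.log (prof a b (s * e)) := by
    rw [hΛ, Real.log_div hp0.ne' hpe.ne', hlog _ he, hlog _ h0, hlog _ hse]
    have h4 := mul_le_mul_of_nonneg_left h1 ha'.le
    have h5 := mul_le_mul_of_nonneg_left h2 hb'.le
    linarith
  have h4 := Real.exp_le_exp.2 h3
  rw [Real.exp_add, Real.exp_log hpe, Real.exp_log hps] at h4
  refine le_trans (mul_le_mul_of_nonneg_left ?_ hpe.le) h4
  linarith [Real.add_one_le_exp ((1 - s) * Λ)]

/-- A lower bound for the square `Q(u) - A²` of half of the velocity of `u` between the turning points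
`x` and `y`. The factor `log (Q(0) / A²)` tends to infinity as `A` tends to `0`. -/
theorem mul_le_prof_sub (ha : 1 ≤ a) (hb : 1 ≤ b) {x y u : ℝ} (hx : x ∈ Set.Ioo (-(a : ℝ)) 0)
    (hy : y ∈ Set.Ioo (0 : ℝ) b) (hxy : prof a b x = prof a b y) (hu : u ∈ Set.Icc x y) :
    Real.log (prof a b 0 / prof a b y) * prof a b y * ((u - x) * (y - u)) ≤
      (a + b) ^ 2 * (prof a b u - prof a b y) := by
  have hxI : x ∈ Set.Ioo (-(a : ℝ)) b := ⟨hx.1, hx.2.trans (by linarith [hy.1, hy.2])⟩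
  have hyI : y ∈ Set.Ioo (-(a : ℝ)) b := ⟨by linarith [hx.1, hx.2, hy.1], hy.2⟩
  have hpy := prof_pos hyI
  have hΛ : 0 ≤ Real.log (prof a b 0 / prof a b y) :=
    Real.log_nonneg ((one_le_div hpy).2 (prof_lt ha hb hyI hy.1.ne').le)
  set Λ := Real.log (prof a b 0 / prof a b y) with hΛdef
  have key : ∀ s : ℝ, (u - x) * (y - u) ≤ (a + b) ^ 2 * (1 - s) →
      prof a b y * (1 + (1 - s) * Λ) ≤ prof a b u →
      Λ * prof a b y * ((u - x) * (y - u)) ≤ (a + b) ^ 2 * (prof a b u - prof a b y) := by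
    intro s h1 h2
    have h3 := mul_le_mul_of_nonneg_left h1 (mul_nonneg hΛ hpy.le)
    have h4 := mul_le_mul_of_nonneg_left h2 (sq_nonneg ((a : ℝ) + b))
    linarith
  have hu1 : 0 ≤ u - x := by linarith [hu.1]
  have hu2 : 0 ≤ y - u := by linarith [hu.2]
  rcases le_total u 0 with h0 | h0
  · have hs0 : 0 ≤ u / x := div_nonneg_of_nonpos h0 hx.2.le
    have hs1 : u / x ≤ 1 := (div_le_one_of_neg hx.2).2 hu.1
    have hsx : u / x * x = u := div_mul_cancel₀ _ hx.2.ne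
    refine key (u / x) ?_ ?_
    · have h1 : u - x = (1 - u / x) * (-x) := by linear_combination -hsx
      have h2 : (-x) * (y - u) ≤ (a + b) ^ 2 := by
        nlinarith [hx.1, hx.2, hy.1, hy.2]
      rw [h1, mul_assoc, mul_comm (((a : ℝ) + b) ^ 2)]
      exact mul_le_mul_of_nonneg_left h2 (sub_nonneg.2 hs1)
    · have := le_prof_mul ha hb hxI hs0 hs1
      rw [hsx, hxy] at this
      exact this
  · have hs0 : 0 ≤ u / y := div_nonneg h0 hy.1.le
    have hs1 : u / y ≤ 1 := (div_le_one hy.1).2 hu.2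
    have hsy : u / y * y = u := div_mul_cancel₀ _ hy.1.ne'
    refine key (u / y) ?_ ?_
    · have h1 : y - u = (1 - u / y) * y := by linear_combination hsy
      have h2 : (u - x) * y ≤ (a + b) ^ 2 := by
        nlinarith [hx.1, hx.2, hy.1, hy.2]
      calc (u - x) * (y - u) = (1 - u / y) * ((u - x) * y) := by rw [h1]; ring
        _ ≤ (1 - u / y) * (a + b) ^ 2 := mul_le_mul_of_nonneg_left h2 (sub_nonneg.2 hs1)
        _ = _ := mul_comm _ _
    · have := le_prof_mul ha hb hyI hs0 hs1
      rw [hsy] at this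
      exact this

/-- The estimate `mul_le_prof_sub` bounds the density of time by a multiple of the derivative of
`arcsin ((2u - x - y) / (y - x))`, which increases by `π` between the turning points `x` and `y`. -/
theorem area_mul_period_le (h : IsProfileInverse a b G DG) (ha : 1 ≤ a) (hb : 1 ≤ b) {R : ℝ}
    (hR0 : 0 < R) (hR : R < √(prof a b 0)) :
    √(prof a b 0 - R ^ 2) * symPeriod DG R ≤
      (a + b) * Real.pi / √(Real.log (prof a b 0 / (prof a b 0 - R ^ 2))) := by
  have hRm : R ∈ Set.Ico 0 (√(prof a b 0)) := ⟨hR0.le, hR⟩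
  have hπ := Real.pi_pos
  set Q₀ := prof a b 0 with hQ₀
  set A : ℝ := √(Q₀ - R ^ 2) with hA
  have hA2 : A ^ 2 = Q₀ - R ^ 2 := Real.sq_sqrt (by linarith [sq_lt_of_mem_Ico hRm])
  have hApos : 0 < A := Real.sqrt_pos.2 (by linarith [sq_lt_of_mem_Ico hRm])
  have ha' : (0 : ℝ) < a := by exact_mod_cast ha
  have hb' : (0 : ℝ) < b := by exact_mod_cast hb
  set Λ := Real.log (Q₀ / (Q₀ - R ^ 2)) with hΛ
  have hΛpos : 0 < Λ := by
    refine Real.log_pos ((one_lt_div ?_).2 ?_)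
    · rw [← hA2]; positivity
    · linarith [pow_pos hR0 2]
  have hsΛ : 0 < √Λ := Real.sqrt_pos.2 hΛpos
  have hmemR : R ∈ Set.Ioo (-√Q₀) (√Q₀) := ⟨by linarith, hR⟩
  have hmemR' : -R ∈ Set.Ioo (-√Q₀) (√Q₀) := ⟨by linarith, by linarith⟩
  have hmem0 : (0 : ℝ) ∈ Set.Ioo (-√Q₀) (√Q₀) := ⟨by linarith, by linarith⟩
  set x := G (-R) with hx
  set y := G R with hy
  have hxI : x ∈ Set.Ioo (-(a : ℝ)) 0 := by
    refine ⟨(h.mem _ hmemR').1, ?_⟩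
    rw [← h.map_zero]
    exact h.strictMonoOn hmemR' hmem0 (by linarith)
  have hyI : y ∈ Set.Ioo (0 : ℝ) b := by
    refine ⟨?_, (h.mem _ hmemR).2⟩
    rw [← h.map_zero]
    exact h.strictMonoOn hmem0 hmemR hR0
  have hpy : prof a b y = Q₀ - R ^ 2 := h.prof_eq _ hmemR
  have hpx : prof a b x = Q₀ - R ^ 2 := by rw [h.prof_eq _ hmemR', neg_sq]
  have hw : 0 < y - x := by linarith [hxI.2, hyI.1]
  set C : ℝ := (a + b) / (2 * √Λ) with hC
  have hcd := h.continuous_dens hRm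
  let z : ℝ → ℝ := fun φ => (2 * G (R * Real.sin φ) - y - x) / (y - x)
  have hzc : Continuous z := ((continuous_const.mul (h.continuous_comp hRm)).sub
    continuous_const |>.sub continuous_const).div_const _
  let F : ℝ → ℝ := fun φ => C * Real.arcsin (z φ) - ∫ s in (0 : ℝ)..φ, A * dens DG R s
  have hFd : ∀ φ, HasDerivAt (fun φ => ∫ s in (0 : ℝ)..φ, A * dens DG R s) (A * dens DG R φ) φ :=
    hasDerivAt_primitive (continuous_const.mul hcd)
  have hmono : MonotoneOn F (Set.Icc (-(Real.pi / 2)) (Real.pi / 2)) := by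
    refine monotoneOn_of_hasDerivWithinAt_nonneg (convex_Icc _ _) ?_
      (f' := fun φ => C * ((√(1 - z φ ^ 2))⁻¹ * (2 * (DG (R * Real.sin φ) *
        (R * Real.cos φ)) / (y - x))) - A * dens DG R φ) (fun φ hφ => ?_) fun φ hφ => ?_
    · exact ((continuous_const.mul (Real.continuous_arcsin.comp hzc)).sub
        (continuous_iff_continuousAt.2 fun φ => (hFd φ).continuousAt)).continuousOn
    all_goals
      rw [interior_Icc] at hφ
      have hcos : 0 < Real.cos φ := Real.cos_pos_of_mem_Ioo hφ
      have hs : Real.sin φ ∈ Set.Ioo (-1 : ℝ) 1 := by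
        have := Real.sin_sq_add_cos_sq φ
        rw [Set.mem_Ioo, ← abs_lt, ← sq_lt_one_iff_abs_lt_one]
        nlinarith
      have hu1 : x < G (R * Real.sin φ) :=
        h.strictMonoOn hmemR' (mul_sin_mem hRm φ) (by nlinarith [hs.1])
      have hu2 : G (R * Real.sin φ) < y :=
        h.strictMonoOn (mul_sin_mem hRm φ) hmemR (by nlinarith [hs.2])
      have hz1 : -1 < z φ := by
        simp only [z]
        rw [lt_div_iff₀ hw]; linarith
      have hz2 : z φ < 1 := by
        simp only [z]
        rw [div_lt_iff₀ hw]; linarith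
    · have h1 := (h.hasDerivAt _ (mul_sin_mem hRm φ)).comp φ
        ((Real.hasDerivAt_sin φ).const_mul R)
      have h2 : HasDerivAt z (2 * (DG (R * Real.sin φ) * (R * Real.cos φ)) / (y - x)) φ :=
        (((h1.const_mul 2).sub_const y).sub_const x).div_const _
      have h3 := (Real.hasDerivAt_arcsin hz1.ne' hz2.ne).comp φ h2
      have h4 := (h3.const_mul C).sub (hFd φ)
      refine (h4.congr_deriv ?_).hasDerivWithinAt
      rw [one_div]
    · set u := G (R * Real.sin φ) with hu
      have hP : 0 < (u - x) * (y - u) := mul_pos (by linarith) (by linarith)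
      have h1 : 1 - z φ ^ 2 = (2 / (y - x)) ^ 2 * ((u - x) * (y - u)) := by
        simp only [z]
        field_simp
        ring
      have h2 : √(1 - z φ ^ 2) = 2 / (y - x) * √((u - x) * (y - u)) := by
        rw [h1, Real.sqrt_mul (sq_nonneg _), Real.sqrt_sq (by positivity)]
      have hsP : 0 < √((u - x) * (y - u)) := Real.sqrt_pos.2 hP
      have h3 : √Λ * A * √((u - x) * (y - u)) ≤ (a + b) * (R * Real.cos φ) := by
        refine le_of_sq_le_sq ?_ (by positivity)
        have h4 := mul_le_prof_sub ha hb hxI hyI (hpx.trans hpy.symm) ⟨hu1.le, hu2.le⟩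
        rw [hpy, h.prof_eq _ (mul_sin_mem hRm φ), ← hQ₀, ← hΛ, ← hA2] at h4
        rw [mul_pow, mul_pow, Real.sq_sqrt hΛpos.le, Real.sq_sqrt hP.le]
        refine h4.trans_eq ?_
        rw [hA2]
        linear_combination (-((a : ℝ) + b) ^ 2 * R ^ 2) * Real.sin_sq_add_cos_sq φ
      rw [h2, sub_nonneg]
      have hd := h.pos _ (mul_sin_mem hRm φ)
      have h5 : C * ((2 / (y - x) * √((u - x) * (y - u)))⁻¹ *
          (2 * (DG (R * Real.sin φ) * (R * Real.cos φ)) / (y - x))) =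
          ((a + b) * (R * Real.cos φ)) / (√Λ * √((u - x) * (y - u))) * dens DG R φ := by
        simp only [hC, dens]
        field_simp
      rw [h5]
      refine mul_le_mul_of_nonneg_right ?_ (h.dens_pos hRm φ).le
      rw [le_div_iff₀ (by positivity)]
      linarith
  have h1 := hmono (Set.left_mem_Icc.2 (by linarith)) (Set.right_mem_Icc.2 (by linarith))
    (by linarith : -(Real.pi / 2) ≤ Real.pi / 2)
  have hz1 : z (-(Real.pi / 2)) = -1 := by
    simp only [z, Real.sin_neg, Real.sin_pi_div_two, mul_neg, mul_one]
    rw [← hx]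
    field_simp
    ring
  have hz2 : z (Real.pi / 2) = 1 := by
    simp only [z, Real.sin_pi_div_two, mul_one]
    rw [← hy]
    field_simp
    ring
  simp only [F, hz1, hz2, Real.arcsin_neg, Real.arcsin_one] at h1
  have h2 : ∫ s in (-(Real.pi / 2))..(Real.pi / 2), A * dens DG R s =
      (∫ s in (0 : ℝ)..(Real.pi / 2), A * dens DG R s) -
        ∫ s in (0 : ℝ)..(-(Real.pi / 2)), A * dens DG R s :=
    (intervalIntegral.integral_interval_sub_left
      ((continuous_const.mul hcd).intervalIntegrable _ _)
      ((continuous_const.mul hcd).intervalIntegrable _ _)).symm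
  have h3 : A * symPeriod DG R = 2 * ∫ s in (-(Real.pi / 2))..(Real.pi / 2), A * dens DG R s := by
    rw [symPeriod, ← intervalIntegral.integral_const_mul]
    exact integral_sin_eq (f := fun v => A * (DG (R * v) / 2)) (continuous_const.mul hcd)
  have h4 : (a + b) * Real.pi / √Λ = 2 * (C * Real.pi) := by
    rw [hC]; field_simp
  rw [h3, h2, h4]
  linarith

/-- Near the maximal amplitude the increment is close to at most `π`, hence smaller than its limit
at amplitude `0`. -/
theorem exists_turn_lt (h : IsProfileInverse a b G DG) (ha : 1 ≤ a) (hb : 1 ≤ b)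
    (hab : 3 ≤ a + b) :
    ∃ R, 0 < R ∧ R < √(prof a b 0) ∧ turn a b G DG R < turn a b G DG 0 := by
  have hπ := pi_lt_turn_zero h ha hb hab
  have ha' : (0 : ℝ) < a := by exact_mod_cast ha
  have hb' : (0 : ℝ) < b := by exact_mod_cast hb
  have hQ : 0 < prof a b 0 := prof_pos (zero_mem_Ioo ha hb)
  set ε := turn a b G DG 0 - Real.pi with hε
  have hεpos : 0 < ε := sub_pos.2 hπ
  -- the amplitude for which the logarithm has the value `s²`
  set s : ℝ := 2 * ((a + b) * Real.pi) / ε with hs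
  have hspos : 0 < s := by have := Real.pi_pos; positivity
  have hexp : Real.exp (-s ^ 2) < 1 := by
    rw [Real.exp_lt_one_iff]
    linarith [pow_pos hspos 2]
  have hpos : 0 < prof a b 0 * (1 - Real.exp (-s ^ 2)) := mul_pos hQ (by linarith)
  have hlt : prof a b 0 * (1 - Real.exp (-s ^ 2)) < prof a b 0 := by
    nlinarith [Real.exp_pos (-s ^ 2)]
  refine ⟨√(prof a b 0 * (1 - Real.exp (-s ^ 2))), Real.sqrt_pos.2 hpos,
    Real.sqrt_lt_sqrt hpos.le hlt, ?_⟩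
  have h1 := turn_le h ha hb ⟨Real.sqrt_nonneg _, Real.sqrt_lt_sqrt hpos.le hlt⟩
  have h2 := area_mul_period_le h ha hb (Real.sqrt_pos.2 hpos) (Real.sqrt_lt_sqrt hpos.le hlt)
  have h3 : √(Real.log (prof a b 0 / (prof a b 0 -
      √(prof a b 0 * (1 - Real.exp (-s ^ 2))) ^ 2))) = s := by
    have : prof a b 0 / (prof a b 0 - √(prof a b 0 * (1 - Real.exp (-s ^ 2))) ^ 2) =
        Real.exp (s ^ 2) := by
      rw [Real.sq_sqrt hpos.le, div_eq_iff]
      · have h4 : Real.exp (s ^ 2) * Real.exp (-s ^ 2) = 1 := by rw [← Real.exp_add]; simp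
        linear_combination (-prof a b 0) * h4
      · have := mul_pos hQ (Real.exp_pos (-s ^ 2))
        linarith
    rw [this, Real.log_exp, Real.sqrt_sq hspos.le]
  rw [h3] at h2
  have h4 : (a + b) * Real.pi / s = ε / 2 := by
    rw [hs]
    have := Real.pi_pos
    field_simp
  linarith

/-- By continuity the increments of infinitely many evolutions are rational multiples of `π`. -/
theorem exists_rational_turns (h : IsProfileInverse a b G DG) (ha : 1 ≤ a) (hb : 1 ≤ b)
    (hab : 3 ≤ a + b) :
    ∃ (R : ℕ → ℝ) (q : ℕ → ℚ), Function.Injective q ∧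
      ∀ i, 0 < R i ∧ R i < √(prof a b 0) ∧ turn a b G DG (R i) = Real.pi * q i := by
  obtain ⟨R₁, hR0, hR1, hlt⟩ := exists_turn_lt h ha hb hab
  have hπ := Real.pi_pos
  have hlt' : turn a b G DG R₁ / Real.pi < turn a b G DG 0 / Real.pi :=
    div_lt_div_of_pos_right hlt hπ
  obtain ⟨r, hr1, hr2⟩ := exists_rat_btwn hlt'
  obtain ⟨r', hr1', hr2'⟩ := exists_rat_btwn hr2
  have hrr : r < r' := by exact_mod_cast hr1'
  let q : ℕ → ℚ := fun i => r + (r' - r) / (i + 1)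
  have hq : ∀ i, r < q i ∧ q i ≤ r' := fun i => by
    have h1 : 0 < r' - r := sub_pos.2 hrr
    have h2 : (r' - r) / ((i : ℚ) + 1) ≤ r' - r :=
      div_le_self h1.le (by linarith [(Nat.cast_nonneg i : (0 : ℚ) ≤ i)])
    have h3 : 0 < (r' - r) / ((i : ℚ) + 1) := by positivity
    exact ⟨by simp only [q]; linarith, by simp only [q]; linarith⟩
  have hinj : Function.Injective q := by
    intro i j hij
    simp only [q, add_right_inj] at hij
    have h1 : r' - r ≠ 0 := (sub_pos.2 hrr).ne'
    have h2 : (i : ℚ) + 1 ≠ 0 := by positivity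
    have h3 : (j : ℚ) + 1 ≠ 0 := by positivity
    field_simp at hij
    have : (i : ℚ) = j := by linarith
    exact_mod_cast this
  have hsol : ∀ i, ∃ R ∈ Set.Ioo 0 R₁, turn a b G DG R = Real.pi * q i := by
    intro i
    obtain ⟨h1, h2⟩ := hq i
    have h1' : (r : ℝ) < q i := by exact_mod_cast h1
    have h2' : (q i : ℝ) ≤ r' := by exact_mod_cast h2
    refine intermediate_value_Ioo' hR0.le ((continuousOn_turn h).mono fun x hx =>
      ⟨hx.1, hx.2.trans_lt hR1⟩) ⟨?_, ?_⟩
    · rw [← div_lt_iff₀' hπ]; linarith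
    · rw [← lt_div_iff₀' hπ]; linarith
  choose R hR hRq using hsol
  exact ⟨R, q, hinj, fun i => ⟨(hR i).1, (hR i).2.trans hR1, hRq i⟩⟩

end Turn

/-! ### Recovering the evolution and the level from the swept-out set -/

section Recovery

variable {a b : ℕ}

/-- An evolution with the symmetric parameters and of amplitude `R`: the extreme values of `u` are
`G (-R)` and `G R`. -/
structure HasAmplitude (D : CaseDEvolution (a + b) a) (G : ℝ → ℝ) (R : ℝ) : Prop where
  α_eq : D.α = symAlpha a b
  isLeast : IsLeast (Set.range D.u) (G (-R))
  isGreatest : IsGreatest (Set.range D.u) (G R)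

/-- The points of `N_c` on the `j`-th complex coordinate axis. -/
theorem exists_mem_N_axis_iff {m : ℕ} (D : CaseDEvolution m a) (j : Fin m) (c X : ℝ) :
    (∃ z ∈ D.N c, (∀ i ≠ j, z i = 0) ∧ ‖z j‖ ^ 2 = X) ↔
      0 ≤ sgn a j * c ∧ ∃ t, sgn a j * c * D.rad j t = X := by
  constructor
  · rintro ⟨z, ⟨t, x, hx, hz⟩, h0, rfl⟩
    have hx0 : ∀ i ≠ j, x i = 0 := fun i hi => by
      have := h0 i hi
      rw [hz, mul_eq_zero, or_iff_left (D.w_ne_zero i t)] at this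
      exact Complex.ofReal_eq_zero.1 this
    have hc : sgn a j * c = x j ^ 2 := by
      rw [← hx, quad, Finset.sum_eq_single j (fun i _ hi => by rw [hx0 i hi]; ring) (by simp),
        ← mul_assoc, sgn_mul_self, one_mul]
    rw [hc]
    refine ⟨sq_nonneg _, t, ?_⟩
    rw [hz, norm_mul, mul_pow, D.norm_w_sq, Complex.norm_real, Real.norm_eq_abs, sq_abs]
  · rintro ⟨hc, t, rfl⟩
    refine ⟨WithLp.toLp 2 fun i => ((Pi.single j (√(sgn a j * c)) : Fin m → ℝ) i : ℂ) * D.w i t,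
      ⟨t, Pi.single j (√(sgn a j * c)), ?_, fun i => rfl⟩, fun i hi => ?_, ?_⟩
    · rw [quad, Finset.sum_eq_single j (fun i _ hi => by simp [hi]) (by simp), Pi.single_eq_same,
        Real.sq_sqrt hc, ← mul_assoc, sgn_mul_self, one_mul]
    · simp [hi]
    · simp only [Pi.single_eq_same]
      rw [norm_mul, mul_pow, D.norm_w_sq, Complex.norm_real, Real.norm_eq_abs, sq_abs,
        Real.sq_sqrt hc]

/-- The sign of `c` can be read off from the coordinate axes which `N_c` meets outside `0`. -/
theorem sgn_mul_pos_of_N_eq {m : ℕ} {D D' : CaseDEvolution m a} {c c' : ℝ} {j : Fin m}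
    (h : D.N c = D'.N c') (hc : 0 < sgn a j * c) : 0 < sgn a j * c' := by
  have h1 := (exists_mem_N_axis_iff D j c _).2 ⟨hc.le, 0, rfl⟩
  rw [h, exists_mem_N_axis_iff] at h1
  obtain ⟨h2, t, ht⟩ := h1
  refine h2.lt_of_ne fun h3 => ?_
  rw [← h3, zero_mul] at ht
  exact (mul_pos hc (D.rad_pos j 0)).ne ht

namespace HasAmplitude

variable {D D' : CaseDEvolution (a + b) a} {G DG : ℝ → ℝ} {R R' : ℝ}

/-- The squared modulus `|w_j|²` has the extreme values `α_j + s_j G (∓ s_j R)`. -/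
theorem isLeast_rad (hD : HasAmplitude D G R) (j : Fin (a + b)) :
    IsLeast (Set.range (D.rad j)) (symAlpha a b j + sgn a j * G (sgn a j * -R)) := by
  obtain ⟨⟨t, ht⟩, h1⟩ := hD.isLeast
  obtain ⟨⟨s, hs⟩, h2⟩ := hD.isGreatest
  rw [mem_lowerBounds, Set.forall_mem_range] at h1
  rw [mem_upperBounds, Set.forall_mem_range] at h2
  rcases sgn_eq_or a j with h | h <;> simp only [h, one_mul, neg_one_mul, neg_neg]
  · refine ⟨⟨t, by rw [CaseDEvolution.rad, hD.α_eq, h, ht, one_mul]⟩, ?_⟩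
    rintro _ ⟨r, rfl⟩
    rw [CaseDEvolution.rad, hD.α_eq, h]
    linarith [h1 r]
  · refine ⟨⟨s, by rw [CaseDEvolution.rad, hD.α_eq, h, hs, neg_one_mul]⟩, ?_⟩
    rintro _ ⟨r, rfl⟩
    rw [CaseDEvolution.rad, hD.α_eq, h]
    linarith [h2 r]

theorem isGreatest_rad (hD : HasAmplitude D G R) (j : Fin (a + b)) :
    IsGreatest (Set.range (D.rad j)) (symAlpha a b j + sgn a j * G (sgn a j * R)) := by
  obtain ⟨⟨t, ht⟩, h1⟩ := hD.isLeast
  obtain ⟨⟨s, hs⟩, h2⟩ := hD.isGreatest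
  rw [mem_lowerBounds, Set.forall_mem_range] at h1
  rw [mem_upperBounds, Set.forall_mem_range] at h2
  rcases sgn_eq_or a j with h | h <;> simp only [h, one_mul, neg_one_mul]
  · refine ⟨⟨s, by rw [CaseDEvolution.rad, hD.α_eq, h, hs, one_mul]⟩, ?_⟩
    rintro _ ⟨r, rfl⟩
    rw [CaseDEvolution.rad, hD.α_eq, h]
    linarith [h2 r]
  · refine ⟨⟨t, by rw [CaseDEvolution.rad, hD.α_eq, h, ht, neg_one_mul]⟩, ?_⟩
    rintro _ ⟨r, rfl⟩
    rw [CaseDEvolution.rad, hD.α_eq, h]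
    linarith [h1 r]

/-- The extreme values of `|z_j|²` on the `j`-th axis. -/
theorem image_extrema (hD : HasAmplitude D G R) {c : ℝ} {j : Fin (a + b)}
    (hc : 0 < sgn a j * c) :
    IsLeast {X | ∃ z ∈ D.N c, (∀ i ≠ j, z i = 0) ∧ ‖z j‖ ^ 2 = X}
        (sgn a j * c * (symAlpha a b j + sgn a j * G (sgn a j * -R))) ∧
      IsGreatest {X | ∃ z ∈ D.N c, (∀ i ≠ j, z i = 0) ∧ ‖z j‖ ^ 2 = X}
        (sgn a j * c * (symAlpha a b j + sgn a j * G (sgn a j * R))) := by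
  obtain ⟨⟨t, ht⟩, h1⟩ := hD.isLeast_rad j
  obtain ⟨⟨s, hs⟩, h2⟩ := hD.isGreatest_rad j
  simp only [exists_mem_N_axis_iff]
  refine ⟨⟨⟨hc.le, t, by rw [ht]⟩, ?_⟩, ⟨⟨hc.le, s, by rw [hs]⟩, ?_⟩⟩
  · rintro _ ⟨-, r, rfl⟩
    exact mul_le_mul_of_nonneg_left (h1 ⟨r, rfl⟩) hc.le
  · rintro _ ⟨-, r, rfl⟩
    exact mul_le_mul_of_nonneg_left (h2 ⟨r, rfl⟩) hc.le

theorem strictMonoOn_sgn_mul (h : IsProfileInverse a b G DG) (j : Fin (a + b)) :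
    StrictMonoOn (fun y => sgn a j * G (sgn a j * y))
      (Set.Ioo (-√(prof a b 0)) (√(prof a b 0))) := by
  intro x hx y hy hxy
  rcases sgn_eq_or a j with hj | hj <;> simp only [hj, one_mul, neg_one_mul]
  · exact h.strictMonoOn hx hy hxy
  · exact neg_lt_neg (h.strictMonoOn ⟨by linarith [hy.2], by linarith [hy.1]⟩
      ⟨by linarith [hx.2], by linarith [hx.1]⟩ (neg_lt_neg hxy))

/-- A larger amplitude enlarges the range of `|z_j|²` at both ends, which no change of the level
can compensate. -/
theorem le_of_N_eq (hD : HasAmplitude D G R) (hD' : HasAmplitude D' G R')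
    (hG : IsProfileInverse a b G DG) (hR0 : 0 < R) (hR' : R' < √(prof a b 0)) {c c' : ℝ}
    {j : Fin (a + b)} (h : D.N c = D'.N c') (hc : 0 < sgn a j * c) : R' ≤ R := by
  by_contra! hlt
  have hc' := sgn_mul_pos_of_N_eq h hc
  obtain ⟨h1, h2⟩ := hD.image_extrema hc
  obtain ⟨h1', h2'⟩ := hD'.image_extrema hc'
  rw [h] at h1 h2
  have e1 := h1.unique h1'
  have e2 := h2.unique h2'
  have hmono := strictMonoOn_sgn_mul hG j
  have m1 : sgn a j * G (sgn a j * -R') < sgn a j * G (sgn a j * -R) :=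
    hmono ⟨by linarith, by linarith⟩ ⟨by linarith, by linarith⟩ (neg_lt_neg hlt)
  have m2 : sgn a j * G (sgn a j * R) < sgn a j * G (sgn a j * R') :=
    hmono ⟨by linarith, by linarith⟩ ⟨by linarith, by linarith⟩ hlt
  obtain ⟨t, ht⟩ := (hD'.isLeast_rad j).1
  obtain ⟨s, hs⟩ := (hD.isGreatest_rad j).1
  have p1 := D'.rad_pos j t
  have p2 := D.rad_pos j s
  rw [ht] at p1
  rw [hs] at p2
  rcases le_total (sgn a j * c) (sgn a j * c') with hle | hle
  · refine absurd e2 (ne_of_lt ?_)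
    exact (mul_le_mul_of_nonneg_right hle p2.le).trans_lt
      (mul_lt_mul_of_pos_left (by linarith) hc')
  · refine absurd e1 (ne_of_gt ?_)
    exact (mul_le_mul_of_nonneg_right hle p1.le).trans_lt
      (mul_lt_mul_of_pos_left (by linarith) hc)

/-- The range of `u` can be read off from the ratios `|z_j|² / |z_k|²` of the points of the
cone `N_0` in a coordinate plane, where `j ≤ a < k`. -/
theorem range_u_subset (ha : 1 ≤ a) (hb : 1 ≤ b) (hD : D.α = symAlpha a b)
    (hD' : D'.α = symAlpha a b) (h : D.N 0 = D'.N 0) : Set.range D.u ⊆ Set.range D'.u := by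
  rintro _ ⟨t, rfl⟩
  set j : Fin (a + b) := Fin.castAdd b ⟨0, ha⟩ with hj
  set k : Fin (a + b) := Fin.natAdd a ⟨0, hb⟩ with hk
  have hjk : j ≠ k := fun h => by
    have := congrArg Fin.val h
    simp [hj, hk] at this
    omega
  have hquad : ∀ x : Fin (a + b) → ℝ, (∀ i, i ≠ j → i ≠ k → x i = 0) →
      quad a x = x j ^ 2 - x k ^ 2 := fun x hx => by
    rw [quad, Fintype.sum_eq_add j k hjk fun i hi => by rw [hx i hi.1 hi.2]; ring, hj, hk,
      sgn_castAdd, sgn_natAdd]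
    ring
  let x : Fin (a + b) → ℝ := fun i => if i = j ∨ i = k then 1 else 0
  have hx0 : ∀ i, i ≠ j → i ≠ k → x i = 0 := fun i hi hi' => by simp [x, hi, hi']
  have hxj : x j = 1 := by simp [x]
  have hxk : x k = 1 := by simp [x]
  have hmem : (WithLp.toLp 2 fun i => (x i : ℂ) * D.w i t : Cm (a + b)) ∈ D.N 0 :=
    ⟨t, x, by rw [hquad x hx0, hxj, hxk]; ring, fun i => rfl⟩
  rw [h] at hmem
  obtain ⟨s, y, hy, hz⟩ := hmem
  have hz' : ∀ i, x i ^ 2 * D.rad i t = y i ^ 2 * D'.rad i s := fun i => by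
    have := congrArg (fun z => ‖z‖ ^ 2) (hz i)
    simpa [mul_pow, CaseDEvolution.norm_w_sq] using this
  have hy0 : ∀ i, i ≠ j → i ≠ k → y i = 0 := fun i hi hi' => by
    have := hz' i
    rw [hx0 i hi hi', zero_pow two_ne_zero, zero_mul, eq_comm, mul_eq_zero,
      or_iff_left (D'.rad_pos i s).ne'] at this
    exact pow_eq_zero_iff two_ne_zero |>.1 this
  rw [hquad y hy0] at hy
  have e1 := hz' j
  have e2 := hz' k
  have p := D.rad_pos j t
  rw [hxj] at e1
  rw [hxk] at e2
  simp only [CaseDEvolution.rad, hD, hD', hj, hk, symAlpha_castAdd, symAlpha_natAdd, sgn_castAdd,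
    sgn_natAdd] at e1 e2 p
  rw [← hj] at e1
  rw [← hk] at e2
  have e3 : y k ^ 2 = y j ^ 2 := by linarith
  rw [e3] at e2
  have hab : (0 : ℝ) < a + b := by positivity
  have hyj : y j ^ 2 ≠ 0 := fun h0 => by
    rw [h0] at e1
    linarith
  refine ⟨s, ?_⟩
  refine mul_left_cancel₀ (mul_ne_zero hyj hab.ne') ?_
  -- adding the two equations gives `y_j² = 1`
  have e4 : y j ^ 2 * (a + b) = a + b := by linear_combination -e1 - e2
  have e5 : y j ^ 2 = 1 := mul_right_cancel₀ hab.ne' (e4.trans (one_mul _).symm)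
  rw [e5] at e1 ⊢
  linear_combination -(a + b : ℝ) * e1

/-- The set `N_c` determines the amplitude of a symmetric evolution and the level `c`. -/
theorem eq_and_eq_of_N_eq (hD : HasAmplitude D G R) (hD' : HasAmplitude D' G R') (ha : 1 ≤ a)
    (hb : 1 ≤ b) (hG : IsProfileInverse a b G DG) (hR0 : 0 < R) (hR : R < √(prof a b 0))
    (hR0' : 0 < R') (hR' : R' < √(prof a b 0)) {c c' : ℝ} (h : D.N c = D'.N c') :
    R = R' ∧ c = c' := by
  have key : ∀ j : Fin (a + b), 0 < sgn a j * c → R = R' ∧ c = c' := by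
    intro j hc
    have hc' := sgn_mul_pos_of_N_eq h hc
    have hRR : R = R' := (le_of_N_eq hD' hD hG hR0' hR h.symm hc').antisymm
      (le_of_N_eq hD hD' hG hR0 hR' h hc)
    refine ⟨hRR, ?_⟩
    subst hRR
    have h1 := (hD.image_extrema hc).1
    rw [h] at h1
    have e := h1.unique (hD'.image_extrema hc').1
    obtain ⟨t, ht⟩ := (hD.isLeast_rad j).1
    rw [← ht] at e
    have e' := mul_right_cancel₀ (D.rad_pos j t).ne' e
    exact mul_left_cancel₀ (left_ne_zero_of_mul hc.ne') e'
  rcases lt_trichotomy c 0 with hc | rfl | hc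
  · exact key (Fin.natAdd a ⟨0, hb⟩) (by rw [sgn_natAdd]; linarith)
  · have hc' : c' = 0 := by
      by_contra hne
      rcases lt_or_gt_of_ne hne with hlt | hgt
      · have := sgn_mul_pos_of_N_eq (j := Fin.natAdd a ⟨0, hb⟩) h.symm
          (by rw [sgn_natAdd]; linarith)
        rw [mul_zero] at this
        exact this.false
      · have := sgn_mul_pos_of_N_eq (j := Fin.castAdd b ⟨0, ha⟩) h.symm
          (by rw [sgn_castAdd]; linarith)
        rw [mul_zero] at this
        exact this.false
    subst hc'
    refine ⟨?_, rfl⟩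
    have hrange : Set.range D.u = Set.range D'.u :=
      (range_u_subset ha hb hD.α_eq hD'.α_eq h).antisymm
        (range_u_subset ha hb hD'.α_eq hD.α_eq h.symm)
    have h1 := hD.isGreatest
    rw [hrange] at h1
    exact hG.strictMonoOn.injOn ⟨by linarith, hR⟩ ⟨by linarith, hR'⟩ (h1.unique hD'.isGreatest)
  · exact key (Fin.castAdd b ⟨0, ha⟩) (by rw [sgn_castAdd]; linarith)

end HasAmplitude

/-- The required sequence consists of symmetric evolutions with pairwise different rational values
of `turn / π`. -/
theorem exists_family (ha : 1 ≤ a) (hb : 1 ≤ b) (hab : 3 ≤ a + b) :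
    ∃ (D : ℕ → CaseDEvolution (a + b) a) (β : ℕ → Fin (a + b) → ℝ),
      (∀ i, (D i).IsPeriodicWithPhases (β i)) ∧ Function.Injective β ∧
        Function.Injective fun p : ℕ × ℝ => (D p.1).N p.2 := by
  obtain ⟨G, DG, hG⟩ := exists_profileInverse ha hb
  obtain ⟨R, q, hq, hR⟩ := exists_rational_turns hG ha hb hab
  choose hR0 hRQ hturn using hR
  choose D hα hβ hleast hgreatest using fun i =>
    exists_symmetric_evolution hG ha hb (hR0 i) (hRQ i)
  have hD : ∀ i, HasAmplitude (D i) G (R i) := fun i => ⟨hα i, hleast i, hgreatest i⟩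
  refine ⟨D, _, fun i => ⟨hβ i, fun j => ?_⟩, fun i k hik => hq ?_, ?_⟩
  · rw [hturn]
    refine Fin.addCases (fun l => ?_) (fun l => ?_) j
    · rw [symAlpha_castAdd, sgn_castAdd]
      exact ⟨-q i / a, by push_cast; ring⟩
    · rw [symAlpha_natAdd, sgn_natAdd]
      exact ⟨q i / b, by push_cast; ring⟩
  · have h1 := congrFun hik (Fin.castAdd b ⟨0, ha⟩)
    have ha' : (a : ℝ) ≠ 0 := by positivity
    simp only [symAlpha_castAdd, sgn_castAdd, hturn] at h1
    rw [div_left_inj' ha'] at h1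
    have h2 : (q i : ℝ) = q k := mul_left_cancel₀ Real.pi_ne_zero (by linarith)
    exact_mod_cast h2
  · rintro ⟨i, c⟩ ⟨k, c'⟩ h
    obtain ⟨h1, rfl⟩ := HasAmplitude.eq_and_eq_of_N_eq (hD i) (hD k) ha hb hG (hR0 i) (hRQ i)
      (hR0 k) (hRQ k) h
    have h2 : (q i : ℝ) = q k := by
      have := hturn i
      rw [h1, hturn k] at this
      exact (mul_left_cancel₀ Real.pi_ne_zero this).symm
    rw [hq (by exact_mod_cast h2 : q i = q k)]

end Recovery

end SLQuadric

end

theorem theorem5p9 (m a : ℕ) (hm : 3 ≤ m) (ha : 1 ≤ a) (ham : a < m) :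
    -- a countably infinite collection of 1-parameter families of distinct submanifolds
    (∃ (D : ℕ → SLQuadric.CaseDEvolution m a) (β : ℕ → Fin m → ℝ),
      (∀ i, (D i).IsPeriodicWithPhases (β i)) ∧
      Function.Injective β ∧
      Function.Injective (fun p : ℕ × ℝ => (D p.1).N p.2)) ∧
    -- the properties of every periodic family
    (∀ (D : SLQuadric.CaseDEvolution m a) (β : Fin m → ℝ), D.IsPeriodicWithPhases β →
      ∀ c : ℝ,
        (0 < c →
          SLQuadric.IsClosedImmersedSL ((𝓡 (a - 1)).prod ((𝓡 (m - a)).prod (𝓡 1)))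
            (SLQuadric.Sph (a - 1) × EuclideanSpace ℝ (Fin (m - a)) × Circle) (D.N c)) ∧
        (c < 0 →
          SLQuadric.IsClosedImmersedSL ((𝓡 a).prod ((𝓡 (m - a - 1)).prod (𝓡 1)))
            (EuclideanSpace ℝ (Fin a) × SLQuadric.Sph (m - a - 1) × Circle) (D.N c)) ∧
        (c = 0 →
          SLQuadric.IsClosedImmersedSLCone ((𝓡 (a - 1)).prod ((𝓡 (m - a - 1)).prod (𝓡 1)))
            (SLQuadric.Sph (a - 1) × SLQuadric.Sph (m - a - 1) × Circle) (D.N c))) := by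
  refine ⟨?_, fun D β hβ c => ?_⟩
  · obtain ⟨b, rfl⟩ : ∃ b, m = a + b := ⟨m - a, by omega⟩
    exact SLQuadric.exists_family ha (by omega) hm
  obtain ⟨n, rfl⟩ : ∃ n, a = n + 1 := ⟨a - 1, by omega⟩
  obtain ⟨l, rfl⟩ : ∃ l, m = n + 1 + (l + 1) := ⟨m - (n + 1) - 1, by omega⟩
  have h1 : n + 1 + (l + 1) - (n + 1) = l + 1 := by omega
  rw [h1]
  refine ⟨fun hc => D.isClosedImmersedSL_pos hm (by omega) hβ hc,
    fun hc => D.isClosedImmersedSL_neg hm (by omega) hβ hc, ?_⟩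
  rintro rfl
  exact D.isClosedImmersedSLCone_zero hm hβ
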